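/- **Notation.** For a complex number $x$ put $\binom{x}{k}=x(x-1)\cdots(x-k+1)/k!$. Let $B_r(t)$ be the Bernoulli polynomials, $B_r=B_r(0)$ (so $B_1=-\tfrac12$), $\overline B_m(t)=B_m(t-\lfloor t\rfloor)$, and let $\zeta$ be the Riemann zeta function. Let $\log$ be the principal branch unless stated otherwise. *Multiple gamma functions (Vignéras).* These are functions $G_n$ $(n\ge 0)$, holomorphic on $\mathbb C\setminus\mathbb Z_{\le 0}$, with (1) $G_{n}(z+1)=G_{n-1}(z)\,G_{n}(z)$ for $n\ge1$; (2) $G_n(1)=1$; (3) $G_n(x+1)>0$ and $\frac{d^{n+1}}{dx^{n+1}}\log G_n(x+1)\ge 0$ for real $x\ge 0$; (4) $G_0(z)=z$. *Multiple $q$-gamma functions.* For $0<q<1$ let $G_0(z+1;q)=\frac{1-q^{z+1}}{1-q}$ and, for $n\ge1$, $$G_n(z+1;q)=(1-q)^{-\binom{z}{n}}\prod_{k=1}^{\infty}\left\{\left(\frac{1-q^{z+k}}{1-q^{k}}\right)^{-\binom{-k}{n-1}}(1-q^{k})^{g_n(z,k)}\right\},\qquad g_n(z,u)=\binom{z-u}{n-1}-\binom{-u}{n-1}.$$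 *Auxiliary quantities.* For $n\ge1$ define $G_{n,j}(z)$ by $\binom{z-u}{n-1}=\sum_{j=0}^{n-1}G_{n,j}(z)u^j$, and put $$F_{n,r-1}(z)=\left.\Big(\frac{d}{dt}\Big)^{r-1}\left\{\binom{-t}{n-1}\log\frac{z+t}{z+1}\right\}\right|_{t=1},$$ $$R_{n,m}(z)=\frac{(-1)^{m-1}}{m!}\int_1^\infty \overline B_m(t)\Big(\frac{d}{dt}\Big)^{m}\left\{\binom{-t}{n-1}\log\frac{z+t}{z+1}\right\}dt .$$ **Theorem 2.** A sequence $(G_n)_{n\ge0}$ satisfying (1)–(4) exists, and every such sequence has the following properties (in particular it is unique). (a) For every $n\ge 0$, as $q\to1-0$, $G_n(z+1;q)$ converges to $G_n(z+1)$ uniformly on every compact subset of $\mathbb C\setminus\mathbb Z_{<0}$. (b) For every $n\ge1$ there is a holomorphic branch of $\log G_n(z+1)$ on $\mathbb C\setminus(-\infty,-1]$ vanishing at $z=0$, and for every integer $m>n$ and every $z\in\mathbb C\setminus(-\infty,-1]$ the integral $R_{n,m}(z)$ converges absolutely and $$\begin{aligned}\log G_n(z+1)={}&\left\{\binom{z+1}{n}+\sum_{r=1}^{n}\frac{B_r}{r!}\Big(-\frac{d}{dz}\Big)^{r-1}\binom{z}{n-1}\right\}\log(z+1)\\&-\sum_{r=1}^{n}\left\{\Big(-\frac{d}{dz}\Big)^{r-1}\binom{z}{n-1}\right\}\frac{1}{r!\,r}\left\{(z+1)^r-1\right\}\\&-\sum_{j=0}^{n-1}G_{n,j}(z)\left\{\zeta'(-j)+\frac1{(j+1)^2}\right\}+\sum_{r=1}^{m}\frac{B_r}{r!}F_{n,r-1}(z)-R_{n,m}(z).\end{aligned}$$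 -/

import Mathlib

open Filter Topology MeasureTheory

noncomputable section

/-- The complex plane without the points `0, -1, -2, …`. -/
def complNonposInt : Set ℂ := {z | ∀ k : ℕ, z ≠ -(k : ℂ)}

/-- The complex plane without the points `-1, -2, -3, …`. -/
def complNegInt : Set ℂ := {z | ∀ k : ℕ, z ≠ -((k : ℂ) + 1)}

/-- The Vignéras hierarchy of multiple gamma functions: the functions `G n` are holomorphic on the
complement of `{0, -1, -2, …}` and satisfy the generalized Bohr–Mollerup conditions. The values at
the nonpositive integers are irrelevant for `n ≥ 1` (meromorphy of `G n` there follows from the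
functional equation). As usual in a Bohr–Mollerup characterization, the convexity condition on
`log G n (x + 1)` for real `x ≥ 0` includes that `G n (x + 1)` is a positive real number. -/
structure IsMultipleGamma (G : ℕ → ℂ → ℂ) : Prop where
  differentiableOn : ∀ n, DifferentiableOn ℂ (G n) complNonposInt
  add_one : ∀ n, ∀ z ∈ complNonposInt, G (n + 1) (z + 1) = G n z * G (n + 1) z
  one : ∀ n, G n 1 = 1
  pos : ∀ n, ∀ x : ℝ, 0 ≤ x → (G n (x + 1)).im = 0 ∧ 0 < (G n (x + 1)).re
  convex : ∀ n, ∀ x : ℝ, 0 ≤ x →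
    0 ≤ iteratedDeriv (n + 1) (fun y : ℝ => Real.log (G n (y + 1)).re) x
  zero : ∀ z, G 0 z = z

/-- The exponent `g_n(z, u) = C(z - u, n - 1) - C(-u, n - 1)`. -/
def gExponent (n : ℕ) (z u : ℂ) : ℂ :=
  Ring.choose (z - u) (n - 1) - Ring.choose (-u) (n - 1)

/-- The `k`-th factor (`k ≥ 1`) in the infinite product for `G_n(z + 1; q)`, `n ≥ 1`. The first
exponent is the integer `-C(-k, n - 1)`. -/
def qMultipleGammaFactor (q : ℝ) (n : ℕ) (z : ℂ) (k : ℕ) : ℂ :=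
  ((1 - (q : ℂ) ^ (z + k)) / (1 - (q : ℂ) ^ k)) ^ (-Ring.choose (-(k : ℤ)) (n - 1)) *
    (1 - (q : ℂ) ^ k) ^ gExponent n z k

/-- The multiple `q`-gamma function `w ↦ G_n(w; q)` for `0 < q < 1`; the product formula is the
usual one for `G_n(z + 1; q)` with `z = w - 1`, and `G_0(w; q) = (1 - q ^ w) / (1 - q)`. -/
def qMultipleGamma (q : ℝ) (n : ℕ) (w : ℂ) : ℂ :=
  if n = 0 then (1 - (q : ℂ) ^ w) / (1 - q)
  else (1 - (q : ℂ)) ^ (-Ring.choose (w - 1) n) *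
    ∏' k : ℕ, qMultipleGammaFactor q n (w - 1) (k + 1)

/-- The coefficient `G_{n,j}(z)` of `u ^ j` in the polynomial `C(z - u, n - 1)` in `u`. -/
def gCoeff (n j : ℕ) (z : ℂ) : ℂ :=
  ((descPochhammer ℂ (n - 1)).comp (Polynomial.C z - Polynomial.X)).coeff j /
    ((n - 1).factorial : ℂ)

/-- Check of `gCoeff`: `C(z - u, n - 1) = ∑_{j < n} G_{n,j}(z) u ^ j`. -/
theorem choose_sub_eq_sum_gCoeff (n : ℕ) (hn : 1 ≤ n) (z u : ℂ) :
    Ring.choose (z - u) (n - 1) = ∑ j ∈ Finset.range n, gCoeff n j z * u ^ j := by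
  have hdeg : ((descPochhammer ℂ (n - 1)).comp (Polynomial.C z - Polynomial.X)).natDegree < n := by
    have h1 : (Polynomial.C z - Polynomial.X : Polynomial ℂ).natDegree ≤ 1 := by
      compute_degree
    have h2 : ((descPochhammer ℂ (n - 1)).comp
        (Polynomial.C z - Polynomial.X)).natDegree ≤ (n - 1) * 1 := by
      refine Polynomial.natDegree_comp_le.trans ?_
      rw [descPochhammer_natDegree]
      exact Nat.mul_le_mul_left _ h1
    omega
  have key := Polynomial.eval_eq_sum_range' hdeg u
  rw [Polynomial.eval_comp] at key
  simp only [Polynomial.eval_sub, Polynomial.eval_C, Polynomial.eval_X] at key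
  rw [Ring.choose_eq_smul, ← Polynomial.eval₂_smulOneHom_eq_smeval,
    ← Polynomial.eval_map, smul_eq_mul]
  have hmap : (descPochhammer ℤ (n - 1)).map (RingHom.smulOneHom : ℤ →+* ℂ)
      = descPochhammer ℂ (n - 1) := descPochhammer_map _ _
  rw [hmap, key, Finset.mul_sum]
  refine Finset.sum_congr rfl fun j _ => ?_
  simp only [gCoeff]
  ring

/-- `(-d/dz) ^ s C(z, n - 1)`. -/
def negDerivChoose (n s : ℕ) (z : ℂ) : ℂ :=
  (-1) ^ s * iteratedDeriv s (fun w : ℂ => Ring.choose w (n - 1)) z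

/-- The function `t ↦ C(-t, n - 1) log ((z + t) / (z + 1))` of the real variable `t`. -/
def chooseLog (n : ℕ) (z : ℂ) (t : ℝ) : ℂ :=
  Ring.choose (-(t : ℂ)) (n - 1) * Complex.log ((z + t) / (z + 1))

/-- `F_{n,s}(z)`, the `s`-th derivative of `chooseLog n z` at `t = 1`. -/
def bernoulliTerm (n s : ℕ) (z : ℂ) : ℂ :=
  iteratedDeriv s (chooseLog n z) 1

/-- The periodic Bernoulli function `t ↦ B_m(t - ⌊t⌋)`. -/
def periodicBernoulli (m : ℕ) (t : ℝ) : ℝ :=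
  Polynomial.aeval (Int.fract t) (Polynomial.bernoulli m)

/-- The integrand of the remainder `R_{n,m}(z)`. -/
def remainderIntegrand (n m : ℕ) (z : ℂ) (t : ℝ) : ℂ :=
  (periodicBernoulli m t : ℂ) * iteratedDeriv m (chooseLog n z) t

/-- The remainder `R_{n,m}(z)`, for `m ≥ 1`. -/
def remainder (n m : ℕ) (z : ℂ) : ℂ :=
  (-1) ^ (m - 1) / (m.factorial : ℂ) * ∫ t in Set.Ioi (1 : ℝ), remainderIntegrand n m z t

/-- The Euler–Maclaurin expression for `log G_n(z + 1)`, for `n ≥ 1` and `m > n`. Here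
`bernoulli 1 = -1/2`. -/
def eulerMaclaurinExpr (n m : ℕ) (z : ℂ) : ℂ :=
  (Ring.choose (z + 1) n +
      ∑ r ∈ Finset.Icc 1 n,
        (bernoulli r : ℂ) / (r.factorial : ℂ) * negDerivChoose n (r - 1) z) * Complex.log (z + 1)
    - ∑ r ∈ Finset.Icc 1 n,
        negDerivChoose n (r - 1) z * (1 / ((r.factorial : ℂ) * r) * ((z + 1) ^ r - 1))
    - ∑ j ∈ Finset.range n,
        gCoeff n j z * (deriv riemannZeta (-(j : ℂ)) + 1 / ((j : ℂ) + 1) ^ 2)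
    + ∑ r ∈ Finset.Icc 1 m,
        (bernoulli r : ℂ) / (r.factorial : ℂ) * bernoulliTerm n (r - 1) z
    - remainder n m z

end

/-!
The logarithm of `G_n(z + 1; q)` is formally `-C(z, n) log (1 - q) +
∑_k (C(z - k, n - 1) log (1 - q ^ k) - C(-k, n - 1) log (1 - q ^ (z + k)))`, and Pascal's rule makes
the sums satisfy the additive functional equation (`qLogGamma_add_one`). Everything in it that is
polynomial in `z` is removed by taking the error of Lagrange interpolation at `0, 1, …, n`
(`hasSum_lagRem_qLogGamma`). What is left is a sum of interpolation errors of
`y ↦ log (1 - q ^ y) - log (1 - q)`. These functions and their limit `log y` all satisfy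
`|f'(y)| ≤ 1 / Re y`, so Cauchy's estimate bounds the error for `f (z + k)` by `O(k ^ (-n - 1))`
uniformly in `q`, against coefficients `C(-k, n - 1) = O(k ^ (n - 1))`. The values at the nodes
converge by the functional equation, so dominated convergence gives a limit for `Re z > -1`, jointly
in `q` and `z` (`tendsto_qLogGamma`). The functional equation carries the convergence of
`G_n(w; q)` to all `w ∉ ℤ_{≤ 0}` (`tendsto_qMultipleGamma`), and convergence jointly in both
variables is locally uniform convergence. The limit is a hierarchy: from order `n + 1` on, the
derivatives of `log G_n(z + 1)` are explicit series, which yields the convexity condition.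

Uniqueness is the argument of Bohr and Mollerup (`IsMultipleGamma.eq_multipleGamma`): the difference
`p` of two solutions for `log G_n(x + 1)` is 1-periodic, and monotonicity of the `n`-th derivatives
squeezes the oscillation of `p⁽ⁿ⁾` by a quantity tending to `0`. So `p⁽ⁿ⁾` is constant, hence so is
the periodic function `p`, and the identity theorem does the rest.

For the asymptotic formula, Euler–Maclaurin summation regularizes `-∑_{k ≥ 0} (w + k)^j log (w + k)`
to a function `Z_j` (`powLogSum`), holomorphic on the slit plane, of polynomial growth, with
`Z_j(w + 1) = Z_j(w) + w ^ j log w`. Applied to `k ^ (-s)` the same summation continues `ζ`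
analytically, and differentiation at `s = -j` gives `Z_j(1) = ζ'(-j)` (`powLogSum_one`). The
Euler–Maclaurin expression of the theorem equals `∑_j G_{n,j}(z) (Z_j(z + 1) - ζ'(-j))`
(`eulerMaclaurinExpr_eq_sum`); comparing the coefficients of `log (z + 1)` takes a polynomial
identity, itself an instance of Euler–Maclaurin summation. This sum vanishes at `0` and, by Pascal's
rule for `G_{n,j}`, obeys the functional equation of `log G_n(z + 1)`. Its high derivatives tend to
`0` along the reals by Cauchy's estimate, as do those of `log G_n(z + 1)`, so the difference is
periodic with a vanishing derivative and therefore zero (`regularizedLogGamma_ofReal`).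
-/

/-! ### Binomial coefficients and the polynomials `G_{n,j}` -/

/-- The binomial coefficient `C(X, k)` as a polynomial. -/
noncomputable def choosePoly (k : ℕ) : Polynomial ℂ :=
  Polynomial.C ((k.factorial : ℂ)⁻¹) * descPochhammer ℂ k

lemma choosePoly_eval (k : ℕ) (z : ℂ) : (choosePoly k).eval z = Ring.choose z k := by
  rw [Ring.choose_eq_smul, ← Polynomial.eval₂_smulOneHom_eq_smeval, ← Polynomial.eval_map,
    smul_eq_mul, choosePoly, Polynomial.eval_mul, Polynomial.eval_C]
  congr 2
  exact (descPochhammer_map (RingHom.smulOneHom : ℤ →+* ℂ) k).symm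

lemma natDegree_choosePoly_le (k : ℕ) : (choosePoly k).natDegree ≤ k := by
  refine (Polynomial.natDegree_C_mul_le _ _).trans ?_
  rw [descPochhammer_natDegree]

lemma gCoeff_eq_coeff (n j : ℕ) (z : ℂ) :
    gCoeff (n + 1) j z
      = ((choosePoly n).comp (Polynomial.C z - Polynomial.X)).coeff j := by
  rw [gCoeff, choosePoly, Polynomial.mul_comp, Polynomial.C_comp, Polynomial.coeff_C_mul]
  simp only [Nat.add_sub_cancel]
  rw [div_eq_inv_mul]

lemma choose_add_one (z : ℂ) (n : ℕ) :
    Ring.choose (z + 1) (n + 1) = Ring.choose z n + Ring.choose z (n + 1) :=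
  Ring.choose_succ_succ z n

lemma choosePoly_comp_add_one (n : ℕ) :
    (choosePoly (n + 1)).comp (Polynomial.X + 1) = choosePoly n + choosePoly (n + 1) := by
  refine Polynomial.funext fun z => ?_
  simp only [Polynomial.eval_comp, Polynomial.eval_add, Polynomial.eval_X, Polynomial.eval_one,
    choosePoly_eval, choose_add_one]

/-- Pascal's rule for the coefficients of `C(z - u, n)` in powers of `u`. -/
lemma gCoeff_add_one (n j : ℕ) (z : ℂ) :
    gCoeff (n + 2) j (z + 1) = gCoeff (n + 1) j z + gCoeff (n + 2) j z := by
  rw [gCoeff_eq_coeff, gCoeff_eq_coeff, gCoeff_eq_coeff, ← Polynomial.coeff_add,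
    ← Polynomial.add_comp, ← choosePoly_comp_add_one, Polynomial.comp_assoc]
  congr 2
  simp only [map_add, map_one, Polynomial.add_comp, Polynomial.X_comp, Polynomial.one_comp]
  ring

lemma gCoeff_one (j : ℕ) (z : ℂ) : gCoeff 1 j z = if j = 0 then 1 else 0 := by
  rw [gCoeff_eq_coeff]
  simp [choosePoly, Polynomial.coeff_one]

/-- `G_{n+1,j}(z) = (-d/dz)^j C(z, n) / j!`, by Taylor's formula. -/
lemma gCoeff_eq_eval (n j : ℕ) (z : ℂ) :
    gCoeff (n + 1) j z
      = (-1) ^ j / (j.factorial : ℂ) * (Polynomial.derivative^[j] (choosePoly n)).eval z := by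
  have h : (choosePoly n).comp (Polynomial.C z - Polynomial.X)
      = (Polynomial.taylor z (choosePoly n)).comp (-Polynomial.X) := by
    rw [Polynomial.taylor_apply, Polynomial.comp_assoc]
    congr 1
    simp only [Polynomial.add_comp, Polynomial.X_comp, Polynomial.C_comp]
    ring
  have h2 : (j.factorial : ℂ) ≠ 0 := by exact_mod_cast j.factorial_ne_zero
  have h3 := congrArg (fun p => Polynomial.eval z (p (choosePoly n)))
    (Polynomial.factorial_smul_hasseDeriv (R := ℂ) (k := j))
  rw [LinearMap.smul_apply, Polynomial.eval_smul, nsmul_eq_mul] at h3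
  have h4 : (-Polynomial.X : Polynomial ℂ) = Polynomial.C (-1) * Polynomial.X := by simp
  rw [gCoeff_eq_coeff, h, h4, Polynomial.comp_C_mul_X_coeff, Polynomial.taylor_coeff, ← h3]
  field_simp

lemma gCoeff_eq_zero {n j : ℕ} (h : n < j) (z : ℂ) : gCoeff (n + 1) j z = 0 := by
  rw [gCoeff_eq_eval, Polynomial.iterate_derivative_eq_zero
    ((natDegree_choosePoly_le n).trans_lt h), Polynomial.eval_zero, mul_zero]

lemma norm_choose_le (w : ℂ) (d : ℕ) : ‖Ring.choose w d‖ ≤ (‖w‖ + d) ^ d := by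
  have hd : Ring.choose w d = (d.factorial : ℂ)⁻¹ * ∏ i ∈ Finset.range d, (w - i) := by
    rw [← choosePoly_eval, choosePoly, Polynomial.eval_mul, Polynomial.eval_C,
      descPochhammer_eval_eq_prod_range]
  rw [hd, norm_mul, norm_prod]
  have h1 : ‖((d.factorial : ℂ)⁻¹)‖ ≤ 1 := by
    rw [norm_inv, Complex.norm_natCast]
    exact inv_le_one_of_one_le₀ (by exact_mod_cast Nat.succ_le_of_lt d.factorial_pos)
  have h2 : ∏ i ∈ Finset.range d, ‖w - (i : ℂ)‖ ≤ (‖w‖ + d) ^ d := by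
    calc ∏ i ∈ Finset.range d, ‖w - (i : ℂ)‖ ≤ ∏ _i ∈ Finset.range d, (‖w‖ + d) := by
          refine Finset.prod_le_prod (fun _ _ => norm_nonneg _) fun i hi => ?_
          refine (norm_sub_le _ _).trans ?_
          rw [Complex.norm_natCast]
          have : (i : ℝ) ≤ d := by exact_mod_cast (Finset.mem_range.1 hi).le
          linarith
      _ = _ := by simp
  calc _ ≤ 1 * (‖w‖ + d) ^ d := by gcongr
    _ = _ := one_mul _

lemma intCast_choose (k : ℤ) (n : ℕ) : ((Ring.choose k n : ℤ) : ℂ) = Ring.choose (k : ℂ) n := by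
  simpa using Ring.map_choose (Int.castRingHom ℂ) k n

lemma choose_neg_natCast (k n : ℕ) :
    Ring.choose (-(k : ℂ)) n = (-1) ^ n * ((k + n - 1).choose n : ℂ) := by
  rcases Nat.eq_zero_or_pos (k + n) with h | h
  · obtain ⟨rfl, rfl⟩ : k = 0 ∧ n = 0 := by omega
    simp
  · rw [Ring.choose_neg]
    have : ((k : ℂ) + n - 1) = ((k + n - 1 : ℕ) : ℂ) := by
      rw [Nat.cast_sub (by omega)]; push_cast; ring
    rw [this, Ring.choose_natCast]
    simp [Int.negOnePow_def, Units.smul_def]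

lemma norm_choose_neg_le (k n : ℕ) (hk : 1 ≤ k) :
    ‖Ring.choose (-(k : ℂ)) n‖ ≤ ((n : ℝ) + 1) ^ n * (k : ℝ) ^ n := by
  refine (norm_choose_le _ _).trans ?_
  rw [norm_neg, Complex.norm_natCast, ← mul_pow]
  have : (1 : ℝ) ≤ k := by exact_mod_cast hk
  gcongr
  nlinarith [(Nat.cast_nonneg n : (0 : ℝ) ≤ n)]

/-! ### The logarithm of the multiple `q`-gamma functions -/

/-- The logarithm of the `k`-th factor in the product for `G_{n+1}(z + 1; q)`, with the powers of
`1 - q ^ k` collected. -/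
noncomputable def qLogTerm (q : ℝ) (n : ℕ) (z : ℂ) (k : ℕ) : ℂ :=
  -(Ring.choose (-(k : ℂ)) n * Complex.log (1 - (q : ℂ) ^ (z + k))) +
    Ring.choose (z - k) n * Complex.log (1 - (q : ℂ) ^ k)

/-- The logarithm of `G_n(z + 1; q)`, obtained by summing the principal logarithms of the
factors. -/
noncomputable def qLogGamma (q : ℝ) : ℕ → ℂ → ℂ
  | 0, z => Complex.log (1 - (q : ℂ) ^ (z + 1)) - Complex.log (1 - (q : ℂ))
  | n + 1, z => -(Ring.choose z (n + 1) * Complex.log (1 - (q : ℂ))) +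
      ∑' k : ℕ, qLogTerm q n z (k + 1)

section
variable {q : ℝ}

lemma summable_mul_log_one_sub_cpow (h0 : 0 < q) (h1 : q < 1) (z : ℂ) (n : ℕ) {P : ℕ → ℂ} {A : ℝ}
    (hA : 0 ≤ A) (hP : ∀ k : ℕ, ‖P k‖ ≤ (A + k) ^ n) :
    Summable fun k : ℕ => P k * Complex.log (1 - (q : ℂ) ^ (z + k)) := by
  have hq0 : (q : ℂ) ≠ 0 := by exact_mod_cast h0.ne'
  have hnorm : ∀ k : ℕ, ‖(q : ℂ) ^ (z + k)‖ = ‖(q : ℂ) ^ z‖ * q ^ k := fun k => by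
    rw [Complex.cpow_add _ _ hq0, norm_mul, Complex.cpow_natCast, norm_pow, Complex.norm_real,
      Real.norm_of_nonneg h0.le]
  have hs : Summable fun k : ℕ => ((A + 1) ^ n * (3 / 2 * ‖(q : ℂ) ^ z‖)) * ((k : ℝ) ^ n * q ^ k) :=
    (summable_pow_mul_geometric_of_norm_lt_one n
      (by rwa [Real.norm_of_nonneg h0.le] : ‖q‖ < 1)).mul_left _
  have ht : Tendsto (fun k : ℕ => ‖(q : ℂ) ^ z‖ * q ^ k) atTop (𝓝 0) := by
    simpa using (tendsto_pow_atTop_nhds_zero_of_lt_one h0.le h1).const_mul ‖(q : ℂ) ^ z‖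
  refine Summable.of_norm_bounded_eventually_nat hs ?_
  filter_upwards [ht.eventually (ge_mem_nhds (by norm_num : (0 : ℝ) < 1 / 2)),
    eventually_ge_atTop 1] with k hk hk1
  have hk1' : (1 : ℝ) ≤ k := by exact_mod_cast hk1
  have hlog : ‖Complex.log (1 - (q : ℂ) ^ (z + k))‖ ≤ 3 / 2 * (‖(q : ℂ) ^ z‖ * q ^ k) := by
    have := Complex.norm_log_one_add_half_le_self (z := -(q : ℂ) ^ (z + k))
      (by rw [norm_neg, hnorm]; exact hk)
    rwa [norm_neg, hnorm, ← sub_eq_add_neg] at this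
  have hA' : (A + k) ^ n ≤ (A + 1) ^ n * (k : ℝ) ^ n := by
    rw [← mul_pow]; gcongr; nlinarith
  calc ‖P k * Complex.log (1 - (q : ℂ) ^ (z + k))‖
      ≤ ((A + 1) ^ n * (k : ℝ) ^ n) * (3 / 2 * (‖(q : ℂ) ^ z‖ * q ^ k)) := by
        rw [norm_mul]; gcongr; exact (hP k).trans hA'
    _ = _ := by ring

lemma summable_choose_neg_mul_log (h0 : 0 < q) (h1 : q < 1) (n : ℕ) (z : ℂ) :
    Summable fun k : ℕ => Ring.choose (-(k : ℂ)) n * Complex.log (1 - (q : ℂ) ^ (z + k)) := by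
  refine summable_mul_log_one_sub_cpow h0 h1 z n (A := n) (Nat.cast_nonneg n) fun k => ?_
  refine (norm_choose_le _ _).trans ?_
  rw [norm_neg, Complex.norm_natCast, add_comm]

lemma summable_choose_sub_mul_log (h0 : 0 < q) (h1 : q < 1) (n : ℕ) (z : ℂ) :
    Summable fun k : ℕ => Ring.choose (z - k) n * Complex.log (1 - (q : ℂ) ^ k) := by
  have := summable_mul_log_one_sub_cpow h0 h1 0 n (P := fun k : ℕ => Ring.choose (z - k) n)
    (A := ‖z‖ + n) (by positivity) fun k => by
      refine (norm_choose_le _ _).trans (pow_le_pow_left₀ (by positivity) ?_ n)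
      have := norm_sub_le z (k : ℂ)
      rw [Complex.norm_natCast] at this
      linarith
  simpa [zero_add, Complex.cpow_natCast] using this

lemma summable_qLogTerm (h0 : 0 < q) (h1 : q < 1) (n : ℕ) (z : ℂ) :
    Summable fun k : ℕ => qLogTerm q n z k :=
  (summable_choose_neg_mul_log h0 h1 n z).neg.add (summable_choose_sub_mul_log h0 h1 n z)

lemma summable_qLogTerm_succ (h0 : 0 < q) (h1 : q < 1) (n : ℕ) (z : ℂ) :
    Summable fun k : ℕ => qLogTerm q n z (k + 1) :=
  (summable_nat_add_iff 1).2 (summable_qLogTerm h0 h1 n z)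

lemma one_sub_pow_ne_zero (h0 : 0 < q) (h1 : q < 1) {k : ℕ} (hk : k ≠ 0) :
    (1 - (q : ℂ) ^ k) ≠ 0 := by
  have : q ^ k < 1 := pow_lt_one₀ h0.le h1 hk
  rw [← Complex.ofReal_pow, ← Complex.ofReal_one, ← Complex.ofReal_sub]
  exact_mod_cast (sub_pos.2 this).ne'

lemma qMultipleGammaFactor_eq_exp (h0 : 0 < q) (h1 : q < 1) (n : ℕ) (z : ℂ) {k : ℕ} (hk : k ≠ 0)
    (hz : (q : ℂ) ^ (z + k) ≠ 1) :
    qMultipleGammaFactor q (n + 1) z k = Complex.exp (qLogTerm q n z k) := by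
  have hb := one_sub_pow_ne_zero h0 h1 hk
  have hA : 1 - (q : ℂ) ^ (z + k) ≠ 0 := sub_ne_zero.2 hz.symm
  have hc : ((Ring.choose (-(k : ℤ)) n : ℤ) : ℂ) = Ring.choose (-(k : ℂ)) n := by
    rw [intCast_choose]; simp
  rw [qMultipleGammaFactor, gExponent, Nat.add_sub_cancel, Complex.cpow_def_of_ne_zero hb]
  have h3 : (1 - (q : ℂ) ^ (z + k)) / (1 - (q : ℂ) ^ k)
      = Complex.exp (Complex.log (1 - (q : ℂ) ^ (z + k)) - Complex.log (1 - (q : ℂ) ^ k)) := by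
    rw [Complex.exp_sub, Complex.exp_log hA, Complex.exp_log hb]
  rw [h3, ← Complex.exp_int_mul, ← Complex.exp_add, qLogTerm]
  congr 1
  push_cast
  rw [hc]
  ring

/-- Away from the zeros of the factors, `G_n(z + 1; q)` is the exponential of `qLogGamma`. -/
lemma qMultipleGamma_eq_exp (h0 : 0 < q) (h1 : q < 1) (n : ℕ) (z : ℂ)
    (hz : ∀ k : ℕ, (q : ℂ) ^ (z + (k + 1 : ℕ)) ≠ 1) :
    qMultipleGamma q n (z + 1) = Complex.exp (qLogGamma q n z) := by
  have hb : (1 - (q : ℂ)) ≠ 0 := by simpa using one_sub_pow_ne_zero h0 h1 one_ne_zero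
  cases n with
  | zero =>
    have hA : 1 - (q : ℂ) ^ (z + 1) ≠ 0 := sub_ne_zero.2 (by simpa using (hz 0).symm)
    simp only [qMultipleGamma, if_true, qLogGamma]
    rw [Complex.exp_sub, Complex.exp_log hA, Complex.exp_log hb]
  | succ n =>
    have hp : ∏' k : ℕ, qMultipleGammaFactor q (n + 1) z (k + 1)
        = Complex.exp (∑' k : ℕ, qLogTerm q n z (k + 1)) := by
      rw [← ((summable_qLogTerm_succ h0 h1 n z).hasSum.cexp).tprod_eq]
      refine tprod_congr fun k => ?_
      exact qMultipleGammaFactor_eq_exp h0 h1 n z k.succ_ne_zero (hz k)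
    rw [qMultipleGamma, if_neg n.succ_ne_zero, add_sub_cancel_right, hp,
      Complex.cpow_def_of_ne_zero hb, ← Complex.exp_add, qLogGamma]
    congr 1
    ring

/-- The functional equation of the multiple `q`-gamma functions in additive form. The sums over
`k` telescope by Pascal's rule. -/
lemma qLogGamma_add_one (h0 : 0 < q) (h1 : q < 1) (n : ℕ) (z : ℂ) :
    qLogGamma q (n + 1) (z + 1) = qLogGamma q (n + 1) z + qLogGamma q n z := by
  set e : ℕ → ℕ → ℂ := fun n k =>
    Ring.choose (-(k : ℂ)) n * Complex.log (1 - (q : ℂ) ^ (z + 1 + k)) with he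
  have hes : ∀ n, Summable (e n) := fun n => summable_choose_neg_mul_log h0 h1 n (z + 1)
  have htel : ∀ n, ∑' k : ℕ, (e n k - e n (k + 1)) = e n 0 := fun n => by
    rw [(hes n).tsum_sub ((summable_nat_add_iff 1).2 (hes n)), (hes n).tsum_eq_zero_add]
    ring
  have hedge : ∀ k : ℕ, (z + 1 + k : ℂ) = z + (k + 1 : ℕ) := fun k => by push_cast; ring
  cases n with
  | zero =>
    have hk : ∀ k : ℕ, qLogTerm q 0 (z + 1) (k + 1)
        = qLogTerm q 0 z (k + 1) + (e 0 k - e 0 (k + 1)) := fun k => by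
      simp only [qLogTerm, he, Ring.choose_zero_right, hedge k]
      ring
    have hs : Summable fun k : ℕ => e 0 k - e 0 (k + 1) :=
      (hes 0).sub ((summable_nat_add_iff 1).2 (hes 0))
    simp only [qLogGamma]
    rw [tsum_congr hk, (summable_qLogTerm_succ h0 h1 0 z).tsum_add hs, htel]
    simp only [he, Ring.choose_zero_right, zero_add, Ring.choose_one_right, Nat.cast_zero,
      add_zero]
    ring
  | succ n =>
    have hk : ∀ k : ℕ, qLogTerm q (n + 1) (z + 1) (k + 1)
        = (qLogTerm q (n + 1) z (k + 1) + qLogTerm q n z (k + 1))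
          + (e (n + 1) k - e (n + 1) (k + 1)) := fun k => by
      have p1 : Ring.choose (z + 1 - ((k + 1 : ℕ) : ℂ)) (n + 1)
          = Ring.choose (z - ((k + 1 : ℕ) : ℂ)) n + Ring.choose (z - ((k + 1 : ℕ) : ℂ)) (n + 1) := by
        rw [← choose_add_one]; congr 1; ring
      have p2 : Ring.choose (-(k : ℂ)) (n + 1)
          = Ring.choose (-((k + 1 : ℕ) : ℂ)) n + Ring.choose (-((k + 1 : ℕ) : ℂ)) (n + 1) := by
        rw [← choose_add_one]; congr 1; push_cast; ring
      simp only [qLogTerm, he, hedge k, p1, p2]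
      ring
    have hs : Summable fun k : ℕ => e (n + 1) k - e (n + 1) (k + 1) :=
      (hes _).sub ((summable_nat_add_iff 1).2 (hes _))
    have s1 := summable_qLogTerm_succ h0 h1 (n + 1) z
    have s2 := summable_qLogTerm_succ h0 h1 n z
    have h00 : e (n + 1) 0 = 0 := by simp [he]
    simp only [qLogGamma]
    rw [tsum_congr hk, (s1.add s2).tsum_add hs, htel, s1.tsum_add s2, h00, choose_add_one]
    ring

lemma qLogGamma_zero (n : ℕ) : qLogGamma q n 0 = 0 := by
  cases n with
  | zero => simp [qLogGamma]
  | succ n =>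
    have : ∀ k : ℕ, qLogTerm q n 0 (k + 1) = 0 := fun k => by
      simp only [qLogTerm, zero_add, Complex.cpow_natCast, zero_sub]
      ring
    simp [qLogGamma, this]

end

/-! ### Lagrange interpolation errors of functions like the logarithm -/

/-- The Lagrange basis polynomial at the node `j` for the nodes `0, 1, …, n`, as a function. -/
noncomputable def lagBasis (n j : ℕ) (z : ℂ) : ℂ :=
  (Lagrange.basis (Finset.range (n + 1)) (fun i : ℕ => (i : ℂ)) j).eval z

/-- The error `f(z) - ∑_{j ≤ n} f(j) ℓ_j(z)` of Lagrange interpolation at the nodes `0, …, n`. -/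
noncomputable def lagRem (n : ℕ) (f : ℂ → ℂ) (z : ℂ) : ℂ :=
  f z - ∑ j ∈ Finset.range (n + 1), f j * lagBasis n j z

lemma continuous_lagBasis (n j : ℕ) : Continuous (lagBasis n j) :=
  Polynomial.continuous _

lemma lagRem_eval (n : ℕ) (p : Polynomial ℂ) (hp : p.degree < (n + 1 : ℕ)) (z : ℂ) :
    lagRem n (fun z => p.eval z) z = 0 := by
  have h := Lagrange.eq_interpolate (s := Finset.range (n + 1)) (v := fun i : ℕ => (i : ℂ)) (f := p)
    (Nat.cast_injective.injOn) (by simpa using hp)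
  have h2 := congrArg (Polynomial.eval z) h
  rw [Lagrange.interpolate_apply, Polynomial.eval_finsetSum] at h2
  simp only [Polynomial.eval_mul, Polynomial.eval_C] at h2
  simp only [lagRem, lagBasis]
  rw [h2, sub_self]

lemma lagRem_choose (n : ℕ) {d : ℕ} (hd : d ≤ n) (a z : ℂ) :
    lagRem n (fun z => Ring.choose (z - a) d) z = 0 := by
  have := lagRem_eval n ((choosePoly d).comp (Polynomial.X - Polynomial.C a)) ?_ z
  · simpa [Polynomial.eval_comp, choosePoly_eval] using this
  · refine Polynomial.degree_le_natDegree.trans_lt ?_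
    have h1 := Polynomial.natDegree_comp_le (p := choosePoly d) (q := Polynomial.X - Polynomial.C a)
    have h2 := natDegree_choosePoly_le d
    rw [Polynomial.natDegree_X_sub_C, mul_one] at h1
    exact_mod_cast (by omega : _ < n + 1)

lemma lagRem_sub (n : ℕ) (f g : ℂ → ℂ) (z : ℂ) :
    lagRem n (fun z => f z - g z) z = lagRem n f z - lagRem n g z := by
  simp only [lagRem, sub_mul, Finset.sum_sub_distrib]
  ring

lemma lagRem_const_mul (n : ℕ) (c : ℂ) (f : ℂ → ℂ) (z : ℂ) :
    lagRem n (fun z => c * f z) z = c * lagRem n f z := by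
  simp only [lagRem, mul_sub, Finset.mul_sum, mul_assoc]

lemma lagRem_const (n : ℕ) (c z : ℂ) : lagRem n (fun _ => c) z = 0 := by
  have := lagRem_choose n (Nat.zero_le n) 0 z
  simp only [Ring.choose_zero_right] at this
  simpa [this] using lagRem_const_mul n c (fun _ => 1) z

/-- A function with small `n`-th derivative on a convex set is close to a polynomial of degree
less than `n`. -/
lemma exists_norm_sub_sum_le {s : Set ℂ} (hs : Convex ℝ s) (ho : IsOpen s) (h0 : (0 : ℂ) ∈ s)
    {M : ℝ} (n : ℕ) (g : ℂ → ℂ) (hg : DifferentiableOn ℂ g s)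
    (hM : ∀ z ∈ s, ‖iteratedDeriv n g z‖ ≤ M) :
    ∃ a : ℕ → ℂ, ∀ z ∈ s, ‖g z - ∑ i ∈ Finset.range n, a i * z ^ i‖ ≤ M * ‖z‖ ^ n := by
  induction n generalizing g with
  | zero => exact ⟨0, fun z hz => by simpa using hM z hz⟩
  | succ n ih =>
    have hM0 : 0 ≤ M := (norm_nonneg _).trans (hM 0 h0)
    obtain ⟨a, ha⟩ := ih (deriv g) (hg.deriv ho) (fun z hz => by
      rw [← iteratedDeriv_succ']; exact hM z hz)
    refine ⟨fun i => Nat.casesOn i (g 0) fun i => a i / (i + 1), fun z hz => ?_⟩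
    set h : ℂ → ℂ := fun w => g w - (∑ i ∈ Finset.range n, a i / (i + 1) * w ^ (i + 1)) with hh
    have hd : ∀ w ∈ s, HasDerivAt h (deriv g w - ∑ i ∈ Finset.range n, a i * w ^ i) w := by
      intro w hw
      refine ((hg.differentiableAt (ho.mem_nhds hw)).hasDerivAt).sub ?_
      refine HasDerivAt.fun_sum fun i _ => ?_
      have hi : ((i : ℂ) + 1) ≠ 0 := by exact_mod_cast i.succ_ne_zero
      refine ((hasDerivAt_pow (i + 1) w).const_mul (a i / (i + 1))).congr_deriv ?_
      rw [Nat.add_sub_cancel, Nat.cast_add, Nat.cast_one]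
      field_simp
    have hseg : segment ℝ 0 z ⊆ s := hs.segment_subset h0 hz
    have hb : ∀ w ∈ segment ℝ 0 z,
        ‖deriv g w - ∑ i ∈ Finset.range n, a i * w ^ i‖ ≤ M * ‖z‖ ^ n := by
      intro w hw
      refine (ha w (hseg hw)).trans ?_
      have : ‖w‖ ≤ ‖z‖ := by
        have := (convexOn_norm (convex_univ (E := ℂ) (𝕜 := ℝ))).le_max_of_mem_segment
          (Set.mem_univ 0) (Set.mem_univ z) hw
        simpa using this
      gcongr
    have := (convex_segment (𝕜 := ℝ) (0 : ℂ) z).norm_image_sub_le_of_norm_hasDerivWithin_le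
      (fun w hw => (hd w (hseg hw)).hasDerivWithinAt) hb
      (left_mem_segment ℝ 0 z) (right_mem_segment ℝ 0 z)
    rw [sub_zero] at this
    rw [Finset.sum_range_succ']
    have h00 : h 0 = g 0 := by simp [hh]
    rw [h00] at this
    calc _ = ‖h z - g 0‖ := by
            simp only [hh, pow_zero, mul_one, sub_add_eq_sub_sub]
            rfl
      _ ≤ _ := this
      _ = _ := by ring

/-- The functions on the right half-plane with `|f'(y)| ≤ 1 / Re y`; they include the logarithm and
its `q`-analogues, and their higher derivatives obey bounds that do not depend on the function. -/
structure IsLogLike (f : ℂ → ℂ) : Prop where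
  differentiableAt : ∀ y : ℂ, 0 < y.re → DifferentiableAt ℂ f y
  norm_deriv_le : ∀ y : ℂ, 0 < y.re → ‖deriv f y‖ ≤ 1 / y.re

lemma IsLogLike.norm_iteratedDeriv_le {f : ℂ → ℂ} (hf : IsLogLike f) (n : ℕ) {y : ℂ}
    (hy : 0 < y.re) :
    ‖iteratedDeriv (n + 1) f y‖ ≤ n.factorial * (2 / y.re) ^ (n + 1) := by
  have hball : ∀ w ∈ Metric.closedBall y (y.re / 2), y.re / 2 ≤ w.re := fun w hw => by
    have h1 := (Complex.abs_re_le_norm (w - y)).trans (mem_closedBall_iff_norm.1 hw)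
    rw [Complex.sub_re] at h1
    linarith [(abs_le.1 h1).1]
  have hopen : IsOpen {w : ℂ | 0 < w.re} := isOpen_lt continuous_const Complex.continuous_re
  have hdiff : DifferentiableOn ℂ (deriv f) {w : ℂ | 0 < w.re} :=
    DifferentiableOn.deriv (fun w hw => (hf.differentiableAt w hw).differentiableWithinAt) hopen
  have hsub : Metric.closedBall y (y.re / 2) ⊆ {w : ℂ | 0 < w.re} := fun w hw =>
    lt_of_lt_of_le (half_pos hy) (hball w hw)
  rw [iteratedDeriv_succ']
  have := Complex.norm_iteratedDeriv_le_of_forall_mem_sphere_norm_le (f := deriv f) (c := y)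
    (R := y.re / 2) (C := 2 / y.re) n (half_pos hy)
    ((hdiff.mono hsub).diffContOnCl_ball le_rfl) fun w hw => by
      have hw' := Metric.sphere_subset_closedBall hw
      refine (hf.norm_deriv_le w (hsub hw')).trans ?_
      rw [div_le_div_iff₀ (hsub hw') hy]
      linarith [hball w hw']
  refine this.trans (le_of_eq ?_)
  rw [pow_succ, div_pow, div_pow]
  field_simp

/-- The dependence on `z` of the bound for the interpolation error. -/
noncomputable def lagWeight (n : ℕ) (z : ℂ) : ℝ :=
  ‖z‖ ^ (n + 1) + ∑ j ∈ Finset.range (n + 1), (j : ℝ) ^ (n + 1) * ‖lagBasis n j z‖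

lemma continuous_lagWeight (n : ℕ) : Continuous (lagWeight n) := by
  have := continuous_lagBasis n
  unfold lagWeight
  fun_prop

lemma lagWeight_nonneg (n : ℕ) (z : ℂ) : 0 ≤ lagWeight n z := by
  unfold lagWeight; positivity

lemma IsLogLike.norm_lagRem_le {f : ℂ → ℂ} (hf : IsLogLike f) (n : ℕ) {δ : ℝ} (hδ : 0 < δ)
    (hδ1 : δ < 1) {k : ℕ} (hk : 1 ≤ k) {z : ℂ} (hz : δ - 1 < z.re) :
    ‖lagRem n (fun w => f (w + k)) z‖
      ≤ n.factorial * (2 / (δ * k)) ^ (n + 1) * lagWeight n z := by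
  set s : Set ℂ := {w | δ - 1 < w.re} with hs
  have hk' : (1 : ℝ) ≤ k := by exact_mod_cast hk
  have hre : ∀ w ∈ s, δ * k ≤ (w + k).re := fun w hw => by
    have : δ - 1 < w.re := hw
    simp only [Complex.add_re, Complex.natCast_re]
    nlinarith
  have hpos : 0 < δ * k := by positivity
  have ho : IsOpen s := isOpen_lt continuous_const Complex.continuous_re
  set M : ℝ := n.factorial * (2 / (δ * k)) ^ (n + 1) with hMdef
  have hM : ∀ w : ℂ, δ * k ≤ (w + k).re →
      ‖iteratedDeriv (n + 1) (fun w => f (w + k)) w‖ ≤ M := fun w hw => by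
    rw [iteratedDeriv_comp_add_const]
    refine (hf.norm_iteratedDeriv_le n (hpos.trans_le hw)).trans ?_
    rw [hMdef]
    have := hpos.trans_le hw
    gcongr
  have hd : DifferentiableOn ℂ (fun w => f (w + k)) s := fun w hw =>
    ((hf.differentiableAt _ (hpos.trans_le (hre w hw))).comp w
      (differentiableAt_id.add_const (k : ℂ))).differentiableWithinAt
  have hmem' : ∀ j : ℕ, (j : ℂ) ∈ s := fun j => by
    have := (Nat.cast_nonneg j : (0 : ℝ) ≤ j)
    simp only [hs, Set.mem_ofPred_eq, Complex.natCast_re]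
    linarith
  obtain ⟨a, ha⟩ := exists_norm_sub_sum_le (convex_halfSpace_re_gt (δ - 1)) ho
    (by exact_mod_cast hmem' 0) (n + 1) _ hd fun w hw => hM w (hre w hw)
  set p : Polynomial ℂ := ∑ i ∈ Finset.range (n + 1), Polynomial.C (a i) * Polynomial.X ^ i with hp
  have hpe : ∀ w, p.eval w = ∑ i ∈ Finset.range (n + 1), a i * w ^ i := fun w => by
    simp [hp, Polynomial.eval_finsetSum]
  have hpd : p.degree < (n + 1 : ℕ) := by
    refine (Polynomial.degree_sum_le _ _).trans_lt ?_
    rw [Finset.sup_lt_iff (by exact_mod_cast WithBot.bot_lt_coe _)]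
    intro i hi
    refine (Polynomial.degree_C_mul_X_pow_le i (a i)).trans_lt ?_
    exact_mod_cast Finset.mem_range.1 hi
  have hsplit : lagRem n (fun w => f (w + k)) z = lagRem n (fun w => f (w + k) - p.eval w) z := by
    rw [lagRem_sub, lagRem_eval n p hpd, sub_zero]
  have hb : ∀ w ∈ s, ‖f (w + k) - p.eval w‖ ≤ M * ‖w‖ ^ (n + 1) := fun w hw => by
    rw [hpe]; exact ha w hw
  rw [hsplit, lagRem, lagWeight, mul_add, Finset.mul_sum]
  refine (norm_sub_le _ _).trans (add_le_add (hb z hz) ((norm_sum_le _ _).trans ?_))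
  refine Finset.sum_le_sum fun j _ => ?_
  rw [norm_mul, ← mul_assoc]
  refine mul_le_mul_of_nonneg_right ?_ (norm_nonneg _)
  simpa using hb j (hmem' j)

lemma isLogLike_log : IsLogLike Complex.log where
  differentiableAt y hy := (Complex.hasDerivAt_log (Or.inl hy)).differentiableAt
  norm_deriv_le y hy := by
    rw [(Complex.hasDerivAt_log (Or.inl hy)).deriv, norm_inv, ← one_div]
    gcongr
    exact Complex.re_le_norm y

section
variable {q : ℝ}

/-- The `q`-analogue of `log y`. -/
noncomputable def qLog (q : ℝ) (y : ℂ) : ℂ :=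
  Complex.log (1 - (q : ℂ) ^ y) - Complex.log (1 - (q : ℂ))

lemma norm_cpow_ofReal_lt_one (h0 : 0 < q) (h1 : q < 1) {y : ℂ} (hy : 0 < y.re) :
    ‖(q : ℂ) ^ y‖ < 1 := by
  rw [Complex.norm_cpow_eq_rpow_re_of_pos h0]
  exact Real.rpow_lt_one h0.le h1 hy

lemma one_sub_cpow_mem_slitPlane (h0 : 0 < q) (h1 : q < 1) {y : ℂ} (hy : 0 < y.re) :
    1 - (q : ℂ) ^ y ∈ Complex.slitPlane := by
  have := Complex.mem_slitPlane_of_norm_lt_one (z := -(q : ℂ) ^ y)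
    (by rw [norm_neg]; exact norm_cpow_ofReal_lt_one h0 h1 hy)
  rwa [← sub_eq_add_neg] at this

lemma hasDerivAt_qLog (h0 : 0 < q) (h1 : q < 1) {y : ℂ} (hy : 0 < y.re) :
    HasDerivAt (qLog q) (-((q : ℂ) ^ y * Complex.log q) / (1 - (q : ℂ) ^ y)) y := by
  have hq0 : (q : ℂ) ≠ 0 := by exact_mod_cast h0.ne'
  have h := ((hasDerivAt_id y).const_cpow (Or.inl hq0)).const_sub 1
  have h2 := (h.clog (one_sub_cpow_mem_slitPlane h0 h1 hy)).sub_const (Complex.log (1 - (q : ℂ)))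
  simp only [id, mul_one] at h2
  exact h2

lemma isLogLike_qLog (h0 : 0 < q) (h1 : q < 1) : IsLogLike (qLog q) where
  differentiableAt y hy := (hasDerivAt_qLog h0 h1 hy).differentiableAt
  norm_deriv_le y hy := by
    have hn : ‖(q : ℂ) ^ y‖ = Real.exp (Real.log q * y.re) := by
      rw [Complex.norm_cpow_eq_rpow_re_of_pos h0, Real.rpow_def_of_pos h0]
    have hlt := norm_cpow_ofReal_lt_one h0 h1 hy
    have hl : Real.log q < 0 := Real.log_neg h0 h1
    have hlog : ‖Complex.log (q : ℂ)‖ = -Real.log q := by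
      rw [← Complex.ofReal_log h0.le, Complex.norm_real, Real.norm_of_nonpos hl.le]
    have hden : 1 - ‖(q : ℂ) ^ y‖ ≤ ‖1 - (q : ℂ) ^ y‖ := by
      simpa using norm_sub_norm_le (1 : ℂ) ((q : ℂ) ^ y)
    have hpos : 0 < 1 - ‖(q : ℂ) ^ y‖ := sub_pos.2 hlt
    rw [(hasDerivAt_qLog h0 h1 hy).deriv, norm_div, norm_neg, norm_mul, hlog]
    refine (div_le_div_of_nonneg_left (by have := norm_nonneg ((q : ℂ) ^ y); nlinarith)
      hpos hden).trans ?_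
    rw [div_le_div_iff₀ hpos hy, hn]
    -- with `u = -log q * Re y` this is `u ≤ e ^ u - 1`
    have hu := Real.add_one_le_exp (-(Real.log q * y.re))
    have he : Real.exp (Real.log q * y.re) * Real.exp (-(Real.log q * y.re)) = 1 := by
      rw [← Real.exp_add]; simp
    nlinarith [Real.exp_pos (Real.log q * y.re)]

end

/-! ### Convergence of the logarithms for `q → 1-0` -/

lemma tendsto_prodMk_nhds {l : Filter ℝ} (z : ℂ) :
    Tendsto (fun q : ℝ => (q, z)) l (l ×ˢ 𝓝 z) :=
  tendsto_id.prodMk tendsto_const_nhds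

lemma eventually_mem_Ioo (z : ℂ) : ∀ᶠ p : ℝ × ℂ in 𝓝[<] (1 : ℝ) ×ˢ 𝓝 z, 0 < p.1 ∧ p.1 < 1 :=
  tendsto_fst.eventually (Ioo_mem_nhdsLT (zero_lt_one' ℝ))

/-- The `q`-number `(1 - q ^ y) / (1 - q)` tends to `y`: it equals
`y * (log q / (q - 1)) * ((e ^ u - 1) / u)` with `u = y log q`. -/
lemma tendsto_qNumber (y : ℂ) :
    Tendsto (fun p : ℝ × ℂ => (1 - (p.1 : ℂ) ^ p.2) / (1 - (p.1 : ℂ)))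
      (𝓝[<] (1 : ℝ) ×ˢ 𝓝 y) (𝓝 y) := by
  have hs : Tendsto (fun q : ℝ => (slope Real.log 1 q : ℂ)) (𝓝[<] (1 : ℝ)) (𝓝 1) := by
    have h := (hasDerivAt_iff_tendsto_slope.1 (Real.hasDerivAt_log one_ne_zero))
    rw [inv_one] at h
    have := (Complex.continuous_ofReal.tendsto 1).comp
      (h.mono_left (nhdsWithin_mono (s := Set.Iio 1) 1 fun q hq => (Set.mem_Iio.1 hq).ne))
    simpa [Function.comp_def] using this
  have hcont : Continuous (dslope Complex.exp 0) := by
    rw [← continuousOn_univ]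
    exact (continuousOn_dslope univ_mem).2
      ⟨Complex.continuous_exp.continuousOn, Complex.differentiableAt_exp⟩
  have hu : Tendsto (fun p : ℝ × ℂ => p.2 * (Real.log p.1 : ℂ)) (𝓝[<] (1 : ℝ) ×ˢ 𝓝 y) (𝓝 0) := by
    have h1 : Tendsto (fun q : ℝ => (Real.log q : ℂ)) (𝓝[<] (1 : ℝ)) (𝓝 0) := by
      have h : Tendsto Real.log (𝓝 1) (𝓝 0) := by
        simpa using (Real.continuousAt_log one_ne_zero).tendsto
      simpa [Function.comp_def] using (Complex.continuous_ofReal.tendsto 0).comp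
        (h.mono_left nhdsWithin_le_nhds)
    simpa using tendsto_snd.mul (h1.comp tendsto_fst)
  have hd : Tendsto (fun p : ℝ × ℂ => dslope Complex.exp 0 (p.2 * (Real.log p.1 : ℂ)))
      (𝓝[<] (1 : ℝ) ×ˢ 𝓝 y) (𝓝 1) := by
    have h := (hcont.tendsto 0).comp hu
    rwa [dslope_same, Complex.deriv_exp, Complex.exp_zero] at h
  have hmain := (tendsto_snd.mul (hs.comp tendsto_fst)).mul hd
  rw [mul_one, mul_one] at hmain
  refine hmain.congr' ?_
  filter_upwards [eventually_mem_Ioo y] with p hp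
  have h0 : (p.1 : ℂ) ≠ 0 := by exact_mod_cast hp.1.ne'
  have h1 : (1 - (p.1 : ℂ)) ≠ 0 := by
    rw [sub_ne_zero]; exact_mod_cast hp.2.ne'
  have h1' : ((p.1 : ℂ) - 1) ≠ 0 := by rw [← neg_ne_zero]; simpa using h1
  have hexp : (p.1 : ℂ) ^ p.2 - 1
      = p.2 * (Real.log p.1 : ℂ) * dslope Complex.exp 0 (p.2 * (Real.log p.1 : ℂ)) := by
    have h := sub_smul_dslope Complex.exp 0 (p.2 * (Real.log p.1 : ℂ))
    rw [sub_zero, Complex.exp_zero, smul_eq_mul] at h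
    rw [h, Complex.cpow_def_of_ne_zero h0, Complex.ofReal_log hp.1.le, mul_comm p.2]
  simp only [Function.comp_apply, slope_def_field, Real.log_one, sub_zero]
  push_cast
  have hexp' : 1 - (p.1 : ℂ) ^ p.2
      = -(p.2 * (Real.log p.1 : ℂ) * dslope Complex.exp 0 (p.2 * (Real.log p.1 : ℂ))) := by
    rw [← hexp]; ring
  have hneg : (1 - (p.1 : ℂ)) = -((p.1 : ℂ) - 1) := by ring
  rw [hexp', hneg, neg_div_neg_eq]
  ring

lemma tendsto_qLog {y : ℂ} (hy : 0 < y.re) :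
    Tendsto (fun p : ℝ × ℂ => qLog p.1 p.2) (𝓝[<] (1 : ℝ) ×ˢ 𝓝 y) (𝓝 (Complex.log y)) := by
  have h := ((continuousAt_clog (Or.inl hy)).tendsto).comp (tendsto_qNumber y)
  refine h.congr' ?_
  have hre : ∀ᶠ p : ℝ × ℂ in 𝓝[<] (1 : ℝ) ×ˢ 𝓝 y, 0 < p.2.re :=
    tendsto_snd.eventually ((isOpen_lt continuous_const Complex.continuous_re).mem_nhds hy)
  filter_upwards [eventually_mem_Ioo y, hre] with p hp hp2
  have hne := Complex.slitPlane_ne_zero (one_sub_cpow_mem_slitPlane hp.1 hp.2 hp2)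
  have hr : 0 < (1 - p.1)⁻¹ := inv_pos.2 (sub_pos.2 hp.2)
  have h2 := Complex.log_ofReal_mul hr hne
  have h3 : Complex.log (1 - (p.1 : ℂ)) = (Real.log (1 - p.1) : ℂ) := by
    rw [Complex.ofReal_log (sub_pos.2 hp.2).le]; simp
  rw [Function.comp_apply, qLog, div_eq_inv_mul, h3]
  push_cast [Real.log_inv] at h2
  rw [h2]
  ring

lemma tendsto_qLog_comp {α : Type*} {l : Filter α} {a : α → ℝ} {b : α → ℂ} {y : ℂ} (hy : 0 < y.re)
    (ha : Tendsto a l (𝓝[<] (1 : ℝ))) (hb : Tendsto b l (𝓝 y)) :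
    Tendsto (fun x => qLog (a x) (b x)) l (𝓝 (Complex.log y)) := by
  have h := Tendsto.comp (g := fun p : ℝ × ℂ => qLog p.1 p.2) (tendsto_qLog hy) (ha.prodMk hb)
  simp only [Function.comp_def] at h
  exact h

lemma qLogGamma_zero_left (q : ℝ) (z : ℂ) : qLogGamma q 0 z = qLog q (z + 1) := rfl

/-- Interpolation at `0, …, n + 1` removes all polynomial terms from the sum defining
`log G_{n+1}(z + 1; q)`. -/
lemma hasSum_lagRem_qLogGamma {q : ℝ} (h0 : 0 < q) (h1 : q < 1) (n : ℕ) (z : ℂ) :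
    HasSum (fun k : ℕ => -(Ring.choose (-((k + 1 : ℕ) : ℂ)) n *
      lagRem (n + 1) (fun w => qLog q (w + (k + 1 : ℕ))) z))
      (lagRem (n + 1) (qLogGamma q (n + 1)) z) := by
  have hS : ∀ w, HasSum (fun k : ℕ => qLogTerm q n w (k + 1)) (∑' k : ℕ, qLogTerm q n w (k + 1)) :=
    fun w => (summable_qLogTerm_succ h0 h1 n w).hasSum
  have h2 : HasSum (fun k : ℕ => lagRem (n + 1) (fun w => qLogTerm q n w (k + 1)) z)
      (lagRem (n + 1) (fun w => ∑' k : ℕ, qLogTerm q n w (k + 1)) z) :=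
    (hS z).sub (hasSum_sum fun j _ => (hS j).mul_right _)
  have h3 : lagRem (n + 1) (qLogGamma q (n + 1)) z
      = lagRem (n + 1) (fun w => ∑' k : ℕ, qLogTerm q n w (k + 1)) z := by
    have h4 : qLogGamma q (n + 1) = fun w => (∑' k : ℕ, qLogTerm q n w (k + 1)) -
        Complex.log (1 - (q : ℂ)) * Ring.choose w (n + 1) := by
      funext w; rw [qLogGamma]; ring
    have h5 := lagRem_choose (n + 1) le_rfl 0 z
    simp only [sub_zero] at h5
    rw [h4, lagRem_sub, lagRem_const_mul, h5, mul_zero, sub_zero]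
  rw [h3]
  refine h2.congr_fun fun k => ?_
  have h6 : (fun w => qLogTerm q n w (k + 1)) = fun w : ℂ =>
      Complex.log (1 - (q : ℂ) ^ (k + 1)) * Ring.choose (w - (k + 1 : ℕ)) n -
      Ring.choose (-((k + 1 : ℕ) : ℂ)) n * (qLog q (w + (k + 1 : ℕ)) -
        -Complex.log (1 - (q : ℂ))) := by
    funext w; rw [qLogTerm, qLog]; ring
  rw [h6, lagRem_sub, lagRem_const_mul, lagRem_choose (n + 1) (Nat.le_succ n), lagRem_const_mul,
    lagRem_sub, lagRem_const]
  ring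

/-- The value of `log G_n(j + 1)` at the natural number `j`, from the functional equation. -/
noncomputable def logGammaNat : ℕ → ℕ → ℂ
  | 0, j => Complex.log (j + 1)
  | _ + 1, 0 => 0
  | n + 1, j + 1 => logGammaNat (n + 1) j + logGammaNat n j

/-- The logarithm of the multiple gamma function `G_n(z + 1)` for `Re z > -1`: the interpolation
polynomial for the values at `0, …, n` plus a sum of interpolation errors of logarithms. -/
noncomputable def logMultipleGamma : ℕ → ℂ → ℂ
  | 0, z => Complex.log (z + 1)
  | n + 1, z => (∑ j ∈ Finset.range (n + 2), logGammaNat (n + 1) j * lagBasis (n + 1) j z) +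
      ∑' k : ℕ, -(Ring.choose (-((k + 1 : ℕ) : ℂ)) n *
        lagRem (n + 1) (fun w => Complex.log (w + (k + 1 : ℕ))) z)

lemma tendsto_qLogGamma_natCast (n j : ℕ) :
    Tendsto (fun q : ℝ => qLogGamma q n j) (𝓝[<] (1 : ℝ)) (𝓝 (logGammaNat n j)) := by
  induction n generalizing j with
  | zero =>
    have : 0 < ((j : ℂ) + 1).re := by simp; positivity
    simp only [qLogGamma_zero_left, logGammaNat]
    exact tendsto_qLog_comp this tendsto_id tendsto_const_nhds
  | succ n ihn =>
    induction j with
    | zero => simp only [Nat.cast_zero, qLogGamma_zero, logGammaNat]; exact tendsto_const_nhds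
    | succ j ihj =>
      refine (ihj.add (ihn j)).congr' ?_
      filter_upwards [Ioo_mem_nhdsLT (zero_lt_one' ℝ)] with q hq
      rw [Nat.cast_succ, qLogGamma_add_one hq.1 hq.2]

/-- A bound, uniform over log-like functions, for the terms of the sums of interpolation errors. -/
lemma IsLogLike.norm_choose_mul_lagRem_le {f : ℂ → ℂ} (hf : IsLogLike f) (n : ℕ) {δ : ℝ}
    (hδ : 0 < δ) (hδ1 : δ < 1) {z : ℂ} (hz : δ - 1 < z.re) {W : ℝ} (hW : lagWeight (n + 1) z ≤ W)
    (k : ℕ) :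
    ‖-(Ring.choose (-((k + 1 : ℕ) : ℂ)) n *
        lagRem (n + 1) (fun w => f (w + (k + 1 : ℕ))) z)‖
      ≤ (((n : ℝ) + 1) ^ n * ((n + 1).factorial * (2 / δ) ^ (n + 2) * W)) *
        (1 / ((k + 1 : ℕ) : ℝ) ^ 2) := by
  have h1 := norm_choose_neg_le (k + 1) n (by omega)
  have h2 := hf.norm_lagRem_le (n + 1) hδ hδ1 (k := k + 1) (by omega) hz
  have hk : (0 : ℝ) < ((k + 1 : ℕ) : ℝ) := by positivity
  have hW0 := (lagWeight_nonneg (n + 1) z).trans hW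
  rw [norm_neg, norm_mul]
  calc _ ≤ (((n : ℝ) + 1) ^ n * ((k + 1 : ℕ) : ℝ) ^ n) *
        ((n + 1).factorial * (2 / (δ * (k + 1 : ℕ))) ^ (n + 2) * W) := by
        gcongr
        exact h2.trans (by gcongr)
    _ = _ := by
        rw [div_pow, div_pow, mul_pow, pow_add (((k + 1 : ℕ) : ℝ)) n 2]
        field_simp

lemma summable_one_div_succ_sq (C : ℝ) :
    Summable fun k : ℕ => C * (1 / ((k + 1 : ℕ) : ℝ) ^ 2) :=
  ((summable_nat_add_iff 1).2 (Real.summable_one_div_nat_pow.2 one_lt_two)).mul_left C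

lemma exists_eventually_re_gt {z : ℂ} (hz : -1 < z.re) (n : ℕ) :
    ∃ δ : ℝ, 0 < δ ∧ δ < 1 ∧ ∀ᶠ w in 𝓝 z, δ - 1 < w.re ∧ lagWeight n w ≤ lagWeight n z + 1 := by
  refine ⟨min (1 / 2) ((z.re + 1) / 2), lt_min (by norm_num) (by linarith),
    (min_le_left _ _).trans_lt (by norm_num), ?_⟩
  have h1 : min (1 / 2) ((z.re + 1) / 2) - 1 < z.re := by
    have := min_le_right (1 / 2) ((z.re + 1) / 2)
    linarith
  exact (Complex.continuous_re.continuousAt.eventually (lt_mem_nhds h1)).and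
    (((continuous_lagWeight n).tendsto z).eventually (ge_mem_nhds (lt_add_one _)))

/-- Local uniform convergence `log G_n(z + 1; q) → log G_n(z + 1)` on `Re z > -1`, by dominated
convergence for the sums of interpolation errors. -/
theorem tendsto_qLogGamma (n : ℕ) {z : ℂ} (hz : -1 < z.re) :
    Tendsto (fun p : ℝ × ℂ => qLogGamma p.1 n p.2) (𝓝[<] (1 : ℝ) ×ˢ 𝓝 z)
      (𝓝 (logMultipleGamma n z)) := by
  cases n with
  | zero =>
    have h1 : 0 < (z + 1).re := by simp; linarith
    simp only [qLogGamma_zero_left, logMultipleGamma]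
    exact tendsto_qLog_comp h1 tendsto_fst (tendsto_snd.add_const 1)
  | succ n =>
    obtain ⟨δ, hδ, hδ1, hev⟩ := exists_eventually_re_gt hz (n + 1)
    have hnode : ∀ j : ℕ, Tendsto (fun p : ℝ × ℂ =>
        qLogGamma p.1 (n + 1) j * lagBasis (n + 1) j p.2) (𝓝[<] (1 : ℝ) ×ˢ 𝓝 z)
        (𝓝 (logGammaNat (n + 1) j * lagBasis (n + 1) j z)) := fun j =>
      ((tendsto_qLogGamma_natCast (n + 1) j).comp tendsto_fst).mul
        (((continuous_lagBasis _ _).tendsto z).comp tendsto_snd)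
    have hterm : ∀ k : ℕ, Tendsto (fun p : ℝ × ℂ => -(Ring.choose (-((k + 1 : ℕ) : ℂ)) n *
        lagRem (n + 1) (fun w => qLog p.1 (w + (k + 1 : ℕ))) p.2)) (𝓝[<] (1 : ℝ) ×ˢ 𝓝 z)
        (𝓝 (-(Ring.choose (-((k + 1 : ℕ) : ℂ)) n *
          lagRem (n + 1) (fun w => Complex.log (w + (k + 1 : ℕ))) z))) := by
      intro k
      refine (Tendsto.const_mul _ ?_).neg
      simp only [lagRem]
      refine Tendsto.sub ?_ (tendsto_finsetSum _ fun j _ => Tendsto.mul ?_ ?_)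
      · have h1 : 0 < (z + (k + 1 : ℕ)).re := by
          simp only [Complex.add_re, Complex.natCast_re]; push_cast
          linarith [(Nat.cast_nonneg k : (0 : ℝ) ≤ k)]
        exact tendsto_qLog_comp h1 tendsto_fst (tendsto_snd.add_const _)
      · have h1 : 0 < ((j : ℂ) + (k + 1 : ℕ)).re := by
          simp only [Complex.add_re, Complex.natCast_re]; positivity
        exact tendsto_qLog_comp h1 tendsto_fst tendsto_const_nhds
      · exact ((continuous_lagBasis _ _).tendsto z).comp tendsto_snd
    have hsum := tendsto_tsum_of_dominated_convergence (summable_one_div_succ_sq _) hterm (by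
      filter_upwards [eventually_mem_Ioo z, tendsto_snd.eventually hev] with p hp hp2 k
      exact (isLogLike_qLog hp.1 hp.2).norm_choose_mul_lagRem_le n hδ hδ1 hp2.1 hp2.2 k)
    refine ((tendsto_finsetSum _ fun j _ => hnode j).add hsum).congr' ?_
    filter_upwards [eventually_mem_Ioo z] with p hp
    rw [(hasSum_lagRem_qLogGamma hp.1 hp.2 n p.2).tsum_eq, lagRem]
    ring

lemma logMultipleGamma_add_one (n : ℕ) {z : ℂ} (hz : -1 < z.re) :
    logMultipleGamma (n + 1) (z + 1) = logMultipleGamma (n + 1) z + logMultipleGamma n z := by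
  have hz1 : -1 < (z + 1).re := by simp; linarith
  have h1 := (tendsto_qLogGamma (n + 1) hz1).comp (tendsto_prodMk_nhds _)
  have h2 := ((tendsto_qLogGamma (n + 1) hz).comp (tendsto_prodMk_nhds _)).add
    ((tendsto_qLogGamma n hz).comp (tendsto_prodMk_nhds _))
  refine tendsto_nhds_unique (h1.congr' ?_) h2
  filter_upwards [Ioo_mem_nhdsLT (zero_lt_one' ℝ)] with q hq
  exact qLogGamma_add_one hq.1 hq.2 n z

lemma logMultipleGamma_zero (n : ℕ) : logMultipleGamma n 0 = 0 := by
  have h1 := (tendsto_qLogGamma n (z := 0) (by simp)).comp (tendsto_prodMk_nhds _)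
  refine tendsto_nhds_unique h1 ?_
  simp only [Function.comp_def, qLogGamma_zero]
  exact tendsto_const_nhds

lemma log_one_sub_cpow_im {q : ℝ} (h0 : 0 < q) (h1 : q < 1) {x : ℝ} (hx : 0 < x) :
    (Complex.log (1 - (q : ℂ) ^ (x : ℂ))).im = 0 := by
  have h2 : 0 ≤ 1 - q ^ x := (sub_pos.2 (Real.rpow_lt_one h0.le h1 hx)).le
  rw [← Complex.ofReal_cpow h0.le, ← Complex.ofReal_one, ← Complex.ofReal_sub,
    ← Complex.ofReal_log h2, Complex.ofReal_im]

lemma choose_ofReal_im (x : ℝ) (n : ℕ) : (Ring.choose (x : ℂ) n).im = 0 := by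
  have : Ring.choose (x : ℂ) n = ((Ring.choose x n : ℝ) : ℂ) :=
    (Ring.map_choose Complex.ofRealHom x n).symm
  rw [this, Complex.ofReal_im]

lemma qLogGamma_im {q : ℝ} (h0 : 0 < q) (h1 : q < 1) (n : ℕ) {x : ℝ} (hx : -1 < x) :
    (qLogGamma q n x).im = 0 := by
  have hl : ∀ k : ℕ, 0 < k → (Complex.log (1 - (q : ℂ) ^ ((x : ℂ) + k))).im = 0 := fun k hk => by
    have hk' : (1 : ℝ) ≤ k := by exact_mod_cast hk
    have := log_one_sub_cpow_im h0 h1 (x := x + k) (by linarith)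
    simpa using this
  have hl0 : ∀ k : ℕ, 0 < k → (Complex.log (1 - (q : ℂ) ^ k)).im = 0 := fun k hk => by
    have := log_one_sub_cpow_im h0 h1 (x := k) (by exact_mod_cast hk)
    simpa using this
  have hL : (Complex.log (1 - (q : ℂ))).im = 0 := by simpa using hl0 1 one_pos
  cases n with
  | zero =>
    have := hl 1 one_pos
    rw [Nat.cast_one] at this
    rw [qLogGamma, Complex.sub_im, this, hL, sub_zero]
  | succ n =>
    have ht : ∀ k : ℕ, (qLogTerm q n x (k + 1)).im = 0 := fun k => by
      have c1 := choose_ofReal_im (-((k + 1 : ℕ) : ℝ)) n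
      have c2 := choose_ofReal_im (x - ((k + 1 : ℕ) : ℝ)) n
      rw [Complex.ofReal_neg, Complex.ofReal_natCast] at c1
      rw [Complex.ofReal_sub, Complex.ofReal_natCast] at c2
      rw [qLogTerm, Complex.add_im, Complex.neg_im, Complex.mul_im, Complex.mul_im, c1, c2,
        hl (k + 1) k.succ_pos, hl0 (k + 1) k.succ_pos]
      ring
    rw [qLogGamma, Complex.add_im, Complex.neg_im, Complex.mul_im, hL, choose_ofReal_im,
      Complex.im_tsum (summable_qLogTerm_succ h0 h1 n x)]
    simp [ht]

/-- `log G_n(x + 1)` is real for real `x > -1`. -/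
lemma logMultipleGamma_im (n : ℕ) {x : ℝ} (hx : -1 < x) : (logMultipleGamma n x).im = 0 := by
  have h1 := (Complex.continuous_im.tendsto _).comp
    ((tendsto_qLogGamma n (z := x) (by simpa using hx)).comp (tendsto_prodMk_nhds _))
  refine tendsto_nhds_unique (h1.congr' ?_) tendsto_const_nhds
  filter_upwards [Ioo_mem_nhdsLT (zero_lt_one' ℝ)] with q hq
  exact qLogGamma_im hq.1 hq.2 n hx

/-! ### Derivatives of `log G_n(z + 1)` -/

lemma iteratedDeriv_polynomial_eval (p : Polynomial ℂ) (N : ℕ) (z : ℂ) :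
    iteratedDeriv N (fun w => p.eval w) z = (Polynomial.derivative^[N] p).eval z := by
  induction N generalizing z with
  | zero => simp
  | succ N ih =>
    rw [iteratedDeriv_succ, Function.iterate_succ_apply']
    have : iteratedDeriv N (fun w => p.eval w) = fun z => (Polynomial.derivative^[N] p).eval z :=
      funext ih
    rw [this, Polynomial.deriv]

lemma TendstoLocallyUniformlyOn.iteratedDeriv {ι : Type*} {φ : Filter ι} {F : ι → ℂ → ℂ}
    {f : ℂ → ℂ} {U : Set ℂ} (hf : TendstoLocallyUniformlyOn F f φ U)
    (hF : ∀ i, DifferentiableOn ℂ (F i) U) (hU : IsOpen U) (N : ℕ) :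
    TendstoLocallyUniformlyOn (fun i => iteratedDeriv N (F i)) (iteratedDeriv N f) φ U := by
  induction N with
  | zero => simpa using hf
  | succ N ih =>
    have hd : ∀ i, DifferentiableOn ℂ (_root_.iteratedDeriv N (F i)) U := fun i => by
      have := ((hF i).analyticOnNhd hU).iterated_deriv N
      rw [← iteratedDeriv_eq_iterate] at this
      exact this.differentiableOn
    have := ih.deriv (Eventually.of_forall hd) hU
    simp only [iteratedDeriv_succ]
    exact this

lemma hasSum_iteratedDeriv_of_summable_norm {F : ℕ → ℂ → ℂ} {U : Set ℂ} {u : ℕ → ℝ}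
    (hu : Summable u) (hF : ∀ i, DifferentiableOn ℂ (F i) U) (hU : IsOpen U)
    (hle : ∀ i, ∀ w ∈ U, ‖F i w‖ ≤ u i) {z : ℂ} (hz : z ∈ U) (N : ℕ) :
    HasSum (fun i => iteratedDeriv N (F i) z) (iteratedDeriv N (fun w => ∑' i, F i w) z) := by
  have h := ((tendstoUniformlyOn_tsum hu hle).tendstoLocallyUniformlyOn).iteratedDeriv
    (fun s => DifferentiableOn.fun_sum fun i _ => hF i) hU N
  refine (h.tendsto_at hz).congr fun s => ?_
  exact iteratedDeriv_fun_sum fun i _ => ((hF i).analyticOnNhd hU z hz).contDiffAt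

lemma iteratedDeriv_log_add {N : ℕ} {a z : ℂ} (hz : z + a ∈ Complex.slitPlane) :
    iteratedDeriv (N + 1) (fun w => Complex.log (w + a)) z
      = (-1) ^ N * N.factorial / (z + a) ^ (N + 1) := by
  have := congrFun (iteratedDeriv_comp_add_const (N + 1) Complex.log a) z
  rw [this, iteratedDeriv_succ_log hz, div_eq_mul_inv]
  congr 1
  rw [← zpow_natCast, ← zpow_neg]
  congr 1
  push_cast; ring

/-- The polynomial part of an interpolation error does not contribute to high derivatives. -/
lemma iteratedDeriv_lagRem {n N : ℕ} (hN : n < N) {f : ℂ → ℂ} {z : ℂ} (hf : AnalyticAt ℂ f z) :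
    iteratedDeriv N (lagRem n f) z = iteratedDeriv N f z := by
  set p := Lagrange.interpolate (Finset.range (n + 1)) (fun i : ℕ => (i : ℂ)) (fun j => f j) with hp
  have h1 : lagRem n f = fun w => f w - p.eval w := by
    funext w
    simp [lagRem, lagBasis, hp, Lagrange.interpolate_apply, Polynomial.eval_finsetSum]
  have h2 : p.degree < (n + 1 : ℕ) := by
    have := Lagrange.degree_interpolate_lt (s := Finset.range (n + 1))
      (v := fun i : ℕ => (i : ℂ)) (fun j => f j) Nat.cast_injective.injOn
    rwa [Finset.card_range] at this
  have h3 : p.natDegree < N := by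
    rcases eq_or_ne p 0 with h | h
    · rw [h]; simp; omega
    · have := (Polynomial.natDegree_lt_iff_degree_lt h).2 h2
      omega
  rw [h1, iteratedDeriv_fun_sub hf.contDiffAt (p.differentiable.analyticAt z).contDiffAt,
    iteratedDeriv_polynomial_eval, Polynomial.iterate_derivative_eq_zero h3, Polynomial.eval_zero,
    sub_zero]

lemma iteratedDeriv_sum_lagBasis {n N : ℕ} (hN : n < N) (c : ℕ → ℂ) (z : ℂ) :
    iteratedDeriv N (fun w => ∑ j ∈ Finset.range (n + 1), c j * lagBasis n j w) z = 0 := by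
  set p := Lagrange.interpolate (Finset.range (n + 1)) (fun i : ℕ => (i : ℂ)) c with hp
  have h1 : (fun w => ∑ j ∈ Finset.range (n + 1), c j * lagBasis n j w) = fun w => p.eval w := by
    funext w
    simp [lagBasis, hp, Lagrange.interpolate_apply, Polynomial.eval_finsetSum]
  have h2 : p.degree < (n + 1 : ℕ) := by
    have := Lagrange.degree_interpolate_lt (s := Finset.range (n + 1))
      (v := fun i : ℕ => (i : ℂ)) c Nat.cast_injective.injOn
    rwa [Finset.card_range] at this
  have h3 : p.natDegree < N := by
    rcases eq_or_ne p 0 with h | h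
    · rw [h]; simp; omega
    · have := (Polynomial.natDegree_lt_iff_degree_lt h).2 h2
      omega
  rw [h1, iteratedDeriv_polynomial_eval, Polynomial.iterate_derivative_eq_zero h3,
    Polynomial.eval_zero]

lemma differentiable_lagBasis (n j : ℕ) : Differentiable ℂ (lagBasis n j) :=
  Polynomial.differentiable _

lemma add_natCast_succ_mem_slitPlane {z : ℂ} (hz : -1 < z.re) (k : ℕ) :
    z + (k + 1 : ℕ) ∈ Complex.slitPlane := by
  refine Or.inl ?_
  simp only [Complex.add_re, Complex.natCast_re]
  push_cast
  linarith [(Nat.cast_nonneg k : (0 : ℝ) ≤ k)]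

lemma analyticAt_log_add_natCast {z : ℂ} (hz : -1 < z.re) (k : ℕ) :
    AnalyticAt ℂ (fun w => Complex.log (w + (k + 1 : ℕ))) z :=
  (analyticAt_id.add analyticAt_const).clog (add_natCast_succ_mem_slitPlane hz k)

/-- Around each point of `Re z > -1` the series defining `logMultipleGamma` is dominated by a
convergent series of constants. -/
lemma exists_nhds_norm_term_le (n : ℕ) {z : ℂ} (hz : -1 < z.re) :
    ∃ (U : Set ℂ) (u : ℕ → ℝ), IsOpen U ∧ z ∈ U ∧ (∀ w ∈ U, -1 < w.re) ∧ Summable u ∧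
      ∀ k, ∀ w ∈ U, ‖-(Ring.choose (-((k + 1 : ℕ) : ℂ)) n *
        lagRem (n + 1) (fun w => Complex.log (w + (k + 1 : ℕ))) w)‖ ≤ u k := by
  obtain ⟨δ, hδ, hδ1, hev⟩ := exists_eventually_re_gt hz (n + 1)
  obtain ⟨U, hU, hUo, hzU⟩ := eventually_nhds_iff.1 hev
  refine ⟨U, _, hUo, hzU, fun w hw => by linarith [(hU w hw).1], summable_one_div_succ_sq _,
    fun k w hw => isLogLike_log.norm_choose_mul_lagRem_le n hδ hδ1 (hU w hw).1 (hU w hw).2 k⟩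

lemma differentiableAt_lagRem_log (n k : ℕ) {z : ℂ} (hz : -1 < z.re) :
    DifferentiableAt ℂ (lagRem n (fun w => Complex.log (w + (k + 1 : ℕ)))) z := by
  unfold lagRem
  refine (analyticAt_log_add_natCast hz k).differentiableAt.sub ?_
  exact DifferentiableAt.fun_sum fun j _ => (differentiable_lagBasis n j z).const_mul _

lemma differentiableAt_logMultipleGamma (n : ℕ) {z : ℂ} (hz : -1 < z.re) :
    DifferentiableAt ℂ (logMultipleGamma n) z := by
  cases n with
  | zero =>
    have h2 : logMultipleGamma 0 = fun w => Complex.log (w + (0 + 1 : ℕ)) := by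
      funext w; simp [logMultipleGamma]
    rw [h2]
    exact (analyticAt_log_add_natCast hz 0).differentiableAt
  | succ n =>
    obtain ⟨U, u, hUo, hzU, hre, hu, hle⟩ := exists_nhds_norm_term_le n hz
    have h1 : DifferentiableAt ℂ (fun w => ∑' k : ℕ, -(Ring.choose (-((k + 1 : ℕ) : ℂ)) n *
        lagRem (n + 1) (fun w => Complex.log (w + (k + 1 : ℕ))) w)) z :=
      (Complex.differentiableOn_tsum_of_summable_norm hu (fun k w hw =>
        ((differentiableAt_lagRem_log (n + 1) k (hre w hw)).const_mul
          _).neg.differentiableWithinAt) hUo hle).differentiableAt (hUo.mem_nhds hzU)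
    have h2 : DifferentiableAt ℂ (fun w => ∑ j ∈ Finset.range (n + 2),
        logGammaNat (n + 1) j * lagBasis (n + 1) j w) z :=
      DifferentiableAt.fun_sum fun j _ => (differentiable_lagBasis (n + 1) j z).const_mul _
    exact h2.add h1

lemma isOpen_re_gt_neg_one : IsOpen {z : ℂ | -1 < z.re} :=
  isOpen_lt continuous_const Complex.continuous_re

lemma analyticAt_logMultipleGamma (n : ℕ) {z : ℂ} (hz : -1 < z.re) :
    AnalyticAt ℂ (logMultipleGamma n) z :=
  DifferentiableOn.analyticAt (s := {z : ℂ | -1 < z.re})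
    (fun _ hw => (differentiableAt_logMultipleGamma n hw).differentiableWithinAt)
    (isOpen_re_gt_neg_one.mem_nhds hz)

/-- The derivatives of order `> n` of `log G_n(z + 1)`. -/
lemma hasSum_iteratedDeriv_logMultipleGamma {n N : ℕ} (hN : n + 1 ≤ N) {z : ℂ} (hz : -1 < z.re) :
    HasSum (fun k : ℕ => -(Ring.choose (-((k + 1 : ℕ) : ℂ)) n *
      ((-1) ^ N * N.factorial / (z + (k + 1 : ℕ)) ^ (N + 1))))
      (iteratedDeriv (N + 1) (logMultipleGamma (n + 1)) z) := by
  obtain ⟨U, u, hUo, hzU, hre, hu, hle⟩ := exists_nhds_norm_term_le n hz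
  have hd : ∀ k, DifferentiableOn ℂ (fun w => -(Ring.choose (-((k + 1 : ℕ) : ℂ)) n *
        lagRem (n + 1) (fun w => Complex.log (w + (k + 1 : ℕ))) w)) U := fun k w hw =>
    ((differentiableAt_lagRem_log (n + 1) k (hre w hw)).const_mul _).neg.differentiableWithinAt
  have h := hasSum_iteratedDeriv_of_summable_norm hu hd hUo hle hzU (N + 1)
  have h1 : AnalyticAt ℂ (fun w => ∑' k : ℕ, -(Ring.choose (-((k + 1 : ℕ) : ℂ)) n *
        lagRem (n + 1) (fun w => Complex.log (w + (k + 1 : ℕ))) w)) z :=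
    (Complex.differentiableOn_tsum_of_summable_norm hu hd hUo hle).analyticAt (hUo.mem_nhds hzU)
  have h2 : AnalyticAt ℂ (fun w => ∑ j ∈ Finset.range (n + 2),
      logGammaNat (n + 1) j * lagBasis (n + 1) j w) z :=
    Differentiable.analyticAt (Differentiable.fun_sum fun j _ =>
      (differentiable_lagBasis (n + 1) j).const_mul _) z
  have h3 : iteratedDeriv (N + 1) (logMultipleGamma (n + 1)) z
      = iteratedDeriv (N + 1) (fun w => ∑' k : ℕ, -(Ring.choose (-((k + 1 : ℕ) : ℂ)) n *
        lagRem (n + 1) (fun w => Complex.log (w + (k + 1 : ℕ))) w)) z := by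
    have h4 : logMultipleGamma (n + 1) = fun w => (∑ j ∈ Finset.range (n + 2),
        logGammaNat (n + 1) j * lagBasis (n + 1) j w) +
        ∑' k : ℕ, -(Ring.choose (-((k + 1 : ℕ) : ℂ)) n *
          lagRem (n + 1) (fun w => Complex.log (w + (k + 1 : ℕ))) w) := by
      funext w; rw [logMultipleGamma]
    rw [h4, iteratedDeriv_fun_add h2.contDiffAt h1.contDiffAt,
      iteratedDeriv_sum_lagBasis (by omega), zero_add]
  rw [h3]
  refine h.congr_fun fun k => ?_
  have h5 : AnalyticAt ℂ (lagRem (n + 1) (fun w => Complex.log (w + (k + 1 : ℕ)))) z :=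
    DifferentiableOn.analyticAt (s := {z : ℂ | -1 < z.re})
      (fun _ hw => (differentiableAt_lagRem_log (n + 1) k hw).differentiableWithinAt)
      (isOpen_re_gt_neg_one.mem_nhds hz)
  rw [iteratedDeriv_fun_neg, iteratedDeriv_const_mul_field, iteratedDeriv_lagRem (by omega)
    (analyticAt_log_add_natCast hz k), iteratedDeriv_log_add (add_natCast_succ_mem_slitPlane hz k)]

/-- The generalized convexity of `log G_n(x + 1)`. -/
lemma iteratedDeriv_logMultipleGamma_re_nonneg (n : ℕ) {x : ℝ} (hx : 0 ≤ x) :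
    0 ≤ (iteratedDeriv (n + 1) (logMultipleGamma n) x).re := by
  have hz : -1 < (x : ℂ).re := by rw [Complex.ofReal_re]; linarith
  cases n with
  | zero =>
    have h := iteratedDeriv_log_add (N := 0) (a := 1) (z := x) (Or.inl (by simp; linarith))
    have h2 : logMultipleGamma 0 = fun w => Complex.log (w + 1) := rfl
    have h3 : ((-1) ^ 0 * ((0).factorial : ℂ) / ((x : ℂ) + 1) ^ (0 + 1)) = ((1 / (x + 1) : ℝ) : ℂ) := by
      simp
    rw [h2, h, h3, Complex.ofReal_re]
    positivity
  | succ n =>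
    have h := Complex.hasSum_re (hasSum_iteratedDeriv_logMultipleGamma (le_refl (n + 1)) hz)
    refine h.nonneg fun k => ?_
    have h1 : -(Ring.choose (-((k + 1 : ℕ) : ℂ)) n *
      ((-1) ^ (n + 1) * (n + 1).factorial / ((x : ℂ) + (k + 1 : ℕ)) ^ (n + 1 + 1)))
      = ((((k + 1 + n - 1).choose n : ℝ) *
        ((n + 1).factorial / (x + (k + 1 : ℕ)) ^ (n + 1 + 1)) : ℝ) : ℂ) := by
      rw [choose_neg_natCast]
      push_cast
      have : ((-1 : ℂ) ^ n) * (-1) ^ n = 1 := by rw [← mul_pow]; simp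
      rw [pow_succ (-1 : ℂ) n]
      linear_combination ((k + 1 + n - 1).choose n : ℂ) *
        ((n + 1).factorial / ((x : ℂ) + (k + 1)) ^ (n + 1 + 1)) * this
    rw [h1, Complex.ofReal_re]
    positivity

/-- The derivatives of order `> n` of `log G_n(x + 1)` vanish at infinity. -/
lemma tendsto_iteratedDeriv_logMultipleGamma {n N : ℕ} (hN : n ≤ N) :
    Tendsto (fun x : ℝ => iteratedDeriv (N + 1) (logMultipleGamma n) x) atTop (𝓝 0) := by
  have hbase : ∀ k : ℕ, Tendsto (fun x : ℝ => (-1 : ℂ) ^ N * N.factorial /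
      ((x : ℂ) + (k + 1 : ℕ)) ^ (N + 1)) atTop (𝓝 0) := fun k => by
    refine tendsto_zero_iff_norm_tendsto_zero.2 ?_
    have h1 : Tendsto (fun x : ℝ => x + ((k + 1 : ℕ) : ℝ)) atTop atTop :=
      tendsto_atTop_add_const_right _ _ tendsto_id
    have h2 : Tendsto (fun x : ℝ => (N.factorial : ℝ) / (x + ((k + 1 : ℕ) : ℝ)) ^ (N + 1))
        atTop (𝓝 0) :=
      (tendsto_pow_atTop N.succ_ne_zero |>.comp h1).const_div_atTop _
    refine h2.congr' ?_
    filter_upwards [eventually_ge_atTop 0] with x hx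
    have h3 : ((x : ℂ) + (k + 1 : ℕ)) = ((x + (k + 1 : ℕ) : ℝ) : ℂ) := by push_cast; ring
    rw [h3, norm_div, norm_mul, norm_pow, norm_pow, norm_neg, norm_one, one_pow, one_mul,
      Complex.norm_natCast, Complex.norm_real, Real.norm_of_nonneg (by positivity)]
  cases n with
  | zero =>
    have h := hbase 0
    refine h.congr' ?_
    filter_upwards [eventually_ge_atTop 0] with x hx
    have h2 : logMultipleGamma 0 = fun w => Complex.log (w + 1) := rfl
    rw [h2, iteratedDeriv_log_add (Or.inl (by simp; linarith))]
    simp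
  | succ n =>
    have hs : Summable fun k : ℕ => (((n : ℝ) + 1) ^ n * N.factorial) *
        (1 / ((k + 1 : ℕ) : ℝ) ^ 2) := summable_one_div_succ_sq _
    have h := tendsto_tsum_of_dominated_convergence (𝓕 := atTop)
      (f := fun (x : ℝ) (k : ℕ) => -(Ring.choose (-((k + 1 : ℕ) : ℂ)) n *
      ((-1) ^ N * N.factorial / ((x : ℂ) + (k + 1 : ℕ)) ^ (N + 1)))) (g := fun _ => 0) hs
      (fun k => by simpa using ((hbase k).const_mul (Ring.choose (-((k + 1 : ℕ) : ℂ)) n)).neg) (by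
        filter_upwards [eventually_ge_atTop 0] with x hx k
        have h3 : ((x : ℂ) + (k + 1 : ℕ)) = ((x + (k + 1 : ℕ) : ℝ) : ℂ) := by push_cast; ring
        rw [h3, norm_neg, norm_mul, norm_div, norm_mul, norm_pow, norm_pow, norm_neg, norm_one,
          one_pow, one_mul, Complex.norm_natCast, Complex.norm_real,
          Real.norm_of_nonneg (by positivity)]
        have hk : (1 : ℝ) ≤ ((k + 1 : ℕ) : ℝ) := by exact_mod_cast Nat.succ_le_succ (Nat.zero_le k)
        have h5 := norm_choose_neg_le (k + 1) n (by omega)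
        calc _ ≤ (((n : ℝ) + 1) ^ n * ((k + 1 : ℕ) : ℝ) ^ n) *
              (N.factorial / ((k + 1 : ℕ) : ℝ) ^ (n + 2)) := by
              gcongr
              calc ((k + 1 : ℕ) : ℝ) ^ (n + 2) ≤ ((k + 1 : ℕ) : ℝ) ^ (N + 1) :=
                    pow_le_pow_right₀ hk (by omega)
                _ ≤ _ := by gcongr; linarith
          _ = _ := by
              rw [pow_add]; field_simp)
    rw [tsum_zero] at h
    refine h.congr' ?_
    filter_upwards [eventually_ge_atTop 0] with x hx
    exact (hasSum_iteratedDeriv_logMultipleGamma hN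
      (by rw [Complex.ofReal_re]; linarith)).tsum_eq

/-! ### The multiple gamma functions -/

/-- The members of a chain of functions, each the derivative of the preceding one, are the iterated
derivatives of the first. -/
lemma iteratedDeriv_eq_of_hasDerivAt {𝕜 E : Type*} [NontriviallyNormedField 𝕜]
    [NormedAddCommGroup E] [NormedSpace 𝕜 E] {O : Set 𝕜} (hO : IsOpen O) {D : ℕ → 𝕜 → E}
    (hD : ∀ i, ∀ x ∈ O, HasDerivAt (D i) (D (i + 1) x) x) (i : ℕ) {x : 𝕜} (hx : x ∈ O) :
    iteratedDeriv i (D 0) x = D i x := by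
  induction i generalizing x with
  | zero => simp
  | succ i ih =>
    rw [iteratedDeriv_succ]
    have : iteratedDeriv i (D 0) =ᶠ[𝓝 x] D i := by
      filter_upwards [hO.mem_nhds hx] with y hy using ih hy
    rw [this.deriv_eq, (hD i x hx).deriv]

section
variable {U : Set ℂ} {F : ℂ → ℂ}

lemma hasDerivAt_iteratedDeriv (hU : IsOpen U) (hF : DifferentiableOn ℂ F U) (i : ℕ) {z : ℂ}
    (hz : z ∈ U) : HasDerivAt (iteratedDeriv i F) (iteratedDeriv (i + 1) F z) z := by
  have := (hF.analyticOnNhd hU).iterated_deriv i z hz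
  rw [← iteratedDeriv_eq_iterate] at this
  rw [iteratedDeriv_succ]
  exact this.differentiableAt.hasDerivAt

lemma iteratedDeriv_re_ofReal (hU : IsOpen U) (hF : DifferentiableOn ℂ F U) (i : ℕ) {x : ℝ}
    (hx : (x : ℂ) ∈ U) :
    iteratedDeriv i (fun y : ℝ => (F y).re) x = (iteratedDeriv i F x).re := by
  have := iteratedDeriv_eq_of_hasDerivAt (D := fun i (y : ℝ) => (iteratedDeriv i F y).re)
    (hU.preimage Complex.continuous_ofReal)
    (fun i y hy => (hasDerivAt_iteratedDeriv hU hF i hy).real_of_complex) i hx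
  simpa using this

lemma iteratedDeriv_comp_ofReal (hU : IsOpen U) (hF : DifferentiableOn ℂ F U) (i : ℕ) {x : ℝ}
    (hx : (x : ℂ) ∈ U) :
    iteratedDeriv i (fun y : ℝ => F y) x = iteratedDeriv i F x := by
  have := iteratedDeriv_eq_of_hasDerivAt (D := fun i (y : ℝ) => iteratedDeriv i F y)
    (hU.preimage Complex.continuous_ofReal)
    (fun i y hy => (hasDerivAt_iteratedDeriv hU hF i hy).comp_ofReal) i hx
  simpa using this

end

lemma isOpen_complNonposInt : IsOpen complNonposInt := by
  have h1 : IsClosed (Set.range fun k : ℕ => (((k : ℝ) : ℂ))) :=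
    (Complex.isometry_ofReal.isClosedEmbedding.comp Nat.isClosedEmbedding_coe_real).isClosed_range
  have h2 : complNonposInt = (fun z : ℂ => -z) ⁻¹' (Set.range fun k : ℕ => (((k : ℝ) : ℂ)))ᶜ := by
    ext z
    simp only [complNonposInt, Set.mem_ofPred_eq, Set.mem_preimage, Set.mem_compl_iff,
      Set.mem_range, not_exists, Complex.ofReal_natCast]
    exact forall_congr' fun k => ⟨fun h h' => h (by rw [h', neg_neg]), fun h h' => h (by
      rw [h', neg_neg])⟩
  rw [h2]
  exact h1.isOpen_compl.preimage continuous_neg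

lemma add_one_mem_complNonposInt {z : ℂ} (hz : z ∈ complNonposInt) : z + 1 ∈ complNonposInt :=
  fun k h => hz (k + 1) (by push_cast; linear_combination h)

lemma mem_complNonposInt_of_re_pos {z : ℂ} (hz : 0 < z.re) : z ∈ complNonposInt := fun k h => by
  rw [h] at hz
  simp only [Complex.neg_re, Complex.natCast_re] at hz
  linarith [(Nat.cast_nonneg k : (0 : ℝ) ≤ k)]

/-- Near a point outside `ℤ_{≤ 0}` no factor of the product vanishes once `q` is close to `1`: the
nonreal solutions of `q ^ y = 1` have imaginary part at least `2π / |log q|`. -/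
lemma eventually_cpow_ne_one {w : ℂ} (hw : w ∈ complNonposInt) :
    ∀ᶠ p : ℝ × ℂ in 𝓝[<] (1 : ℝ) ×ˢ 𝓝 w, ∀ k : ℕ, (p.1 : ℂ) ^ (p.2 + k) ≠ 1 := by
  have h1 : ∀ᶠ z in 𝓝 w, z ∈ complNonposInt := isOpen_complNonposInt.mem_nhds hw
  have h2 : Tendsto (fun p : ℝ × ℂ => |Real.log p.1 * p.2.im|) (𝓝[<] (1 : ℝ) ×ˢ 𝓝 w) (𝓝 0) := by
    have hl : Tendsto Real.log (𝓝[<] (1 : ℝ)) (𝓝 0) := by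
      have : Tendsto Real.log (𝓝 1) (𝓝 0) := by
        simpa using (Real.continuousAt_log one_ne_zero).tendsto
      exact this.mono_left nhdsWithin_le_nhds
    simpa using ((hl.comp tendsto_fst).mul ((Complex.continuous_im.tendsto w).comp tendsto_snd)).abs
  filter_upwards [eventually_mem_Ioo w, tendsto_snd.eventually h1,
    h2.eventually (gt_mem_nhds (by positivity : (0 : ℝ) < 2 * Real.pi))] with p hp hpw hpi k hk
  have h0 : (p.1 : ℂ) ≠ 0 := by exact_mod_cast hp.1.ne'
  rw [Complex.cpow_def_of_ne_zero h0, Complex.exp_eq_one_iff, ← Complex.ofReal_log hp.1.le] at hk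
  obtain ⟨m, hm⟩ := hk
  have him := congrArg Complex.im hm
  have hre := congrArg Complex.re hm
  simp at him hre
  rw [him, abs_mul, abs_of_pos (by positivity : (0 : ℝ) < 2 * Real.pi)] at hpi
  have hm0 : m = 0 := by
    have h3 : |(m : ℝ)| < 1 := by
      by_contra h
      nlinarith [Real.pi_pos]
    exact Int.abs_lt_one_iff.1 (by exact_mod_cast h3)
  have hl : Real.log p.1 ≠ 0 := (Real.log_neg hp.1 hp.2).ne
  rw [hm0, Int.cast_zero, zero_mul, mul_eq_zero] at hm
  rcases hm with hm | hm
  · exact hl (by exact_mod_cast hm)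
  · exact hpw k (by linear_combination hm)

section
variable {q : ℝ}

lemma qMultipleGamma_eq_exp_sub_one (h0 : 0 < q) (h1 : q < 1) (n : ℕ) {w : ℂ}
    (hw : ∀ k : ℕ, (q : ℂ) ^ (w + k) ≠ 1) :
    qMultipleGamma q n w = Complex.exp (qLogGamma q n (w - 1)) := by
  have := qMultipleGamma_eq_exp h0 h1 n (w - 1) fun k => by
    have h2 : w - 1 + ((k + 1 : ℕ) : ℂ) = w + k := by push_cast; ring
    rw [h2]
    exact hw k
  rwa [sub_add_cancel] at this

lemma qMultipleGamma_add_one (h0 : 0 < q) (h1 : q < 1) (n : ℕ) {w : ℂ}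
    (hw : ∀ k : ℕ, (q : ℂ) ^ (w + k) ≠ 1) :
    qMultipleGamma q (n + 1) (w + 1) = qMultipleGamma q n w * qMultipleGamma q (n + 1) w := by
  have hw1 : ∀ k : ℕ, (q : ℂ) ^ (w + 1 + k) ≠ 1 := fun k => by
    have := hw (k + 1)
    have h2 : w + 1 + (k : ℂ) = w + (k + 1 : ℕ) := by push_cast; ring
    rwa [h2]
  rw [qMultipleGamma_eq_exp_sub_one h0 h1 _ hw, qMultipleGamma_eq_exp_sub_one h0 h1 _ hw,
    qMultipleGamma_eq_exp_sub_one h0 h1 _ hw1, ← Complex.exp_add, add_comm (qLogGamma _ _ _),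
    ← qLogGamma_add_one h0 h1, add_sub_cancel_right, sub_add_cancel]

end

/-- The multiple gamma function `G_n`, constructed as the limit of the multiple `q`-gamma functions
for `q → 1-0`, jointly in `q` and the argument. -/
noncomputable def multipleGamma (n : ℕ) (w : ℂ) : ℂ :=
  limUnder (𝓝[<] (1 : ℝ) ×ˢ 𝓝 w) fun p : ℝ × ℂ => qMultipleGamma p.1 n p.2

lemma tendsto_qMultipleGamma_zero (w : ℂ) :
    Tendsto (fun p : ℝ × ℂ => qMultipleGamma p.1 0 p.2) (𝓝[<] (1 : ℝ) ×ˢ 𝓝 w) (𝓝 w) := by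
  simpa [qMultipleGamma] using tendsto_qNumber w

lemma tendsto_qMultipleGamma_of_re_pos (n : ℕ) {w : ℂ} (hw : 0 < w.re) :
    Tendsto (fun p : ℝ × ℂ => qMultipleGamma p.1 n p.2) (𝓝[<] (1 : ℝ) ×ˢ 𝓝 w)
      (𝓝 (Complex.exp (logMultipleGamma n (w - 1)))) := by
  have h1 : Tendsto (fun p : ℝ × ℂ => (p.1, p.2 - 1)) (𝓝[<] (1 : ℝ) ×ˢ 𝓝 w)
      (𝓝[<] (1 : ℝ) ×ˢ 𝓝 (w - 1)) := tendsto_fst.prodMk (tendsto_snd.sub_const 1)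
  have h2 := (tendsto_qLogGamma n (z := w - 1) (by simpa using hw)).comp h1
  refine ((Complex.continuous_exp.tendsto _).comp h2).congr' ?_
  filter_upwards [eventually_mem_Ioo w,
    eventually_cpow_ne_one (mem_complNonposInt_of_re_pos hw)] with p hp hpk
  exact (qMultipleGamma_eq_exp_sub_one hp.1 hp.2 n hpk).symm

/-- The limit of `G_n(w; q)` exists and is nonzero. The functional equation extends the region of
convergence to the left, one unit at a time. -/
lemma exists_tendsto_qMultipleGamma (n N : ℕ) {w : ℂ} (hw : w ∈ complNonposInt)
    (hN : -(N : ℝ) < w.re) :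
    ∃ g : ℂ, g ≠ 0 ∧ Tendsto (fun p : ℝ × ℂ => qMultipleGamma p.1 n p.2)
      (𝓝[<] (1 : ℝ) ×ˢ 𝓝 w) (𝓝 g) := by
  induction n generalizing N w with
  | zero => exact ⟨w, by simpa using hw 0, tendsto_qMultipleGamma_zero w⟩
  | succ n ihn =>
    induction N generalizing w with
    | zero => exact ⟨_, Complex.exp_ne_zero _, tendsto_qMultipleGamma_of_re_pos _ (by simpa using hN)⟩
    | succ N ihN =>
      obtain ⟨g, hg, htg⟩ := ihN (add_one_mem_complNonposInt hw) (by
        push_cast at hN; simp; linarith)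
      obtain ⟨g', hg', htg'⟩ := ihn (N + 1) hw hN
      refine ⟨g / g', div_ne_zero hg hg', ?_⟩
      have h1 : Tendsto (fun p : ℝ × ℂ => (p.1, p.2 + 1)) (𝓝[<] (1 : ℝ) ×ˢ 𝓝 w)
          (𝓝[<] (1 : ℝ) ×ˢ 𝓝 (w + 1)) := tendsto_fst.prodMk (tendsto_snd.add_const 1)
      refine ((htg.comp h1).div htg' hg').congr' ?_
      filter_upwards [eventually_mem_Ioo w, eventually_cpow_ne_one hw] with p hp hpk
      have hne : qMultipleGamma p.1 n p.2 ≠ 0 := by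
        rw [qMultipleGamma_eq_exp_sub_one hp.1 hp.2 n hpk]
        exact Complex.exp_ne_zero _
      rw [Pi.div_apply, Function.comp_apply, qMultipleGamma_add_one hp.1 hp.2 n hpk,
        mul_div_cancel_left₀ _ hne]

lemma exists_natCast_neg_lt (w : ℂ) : ∃ N : ℕ, -(N : ℝ) < w.re := by
  obtain ⟨N, hN⟩ := exists_nat_gt (-w.re)
  exact ⟨N, by linarith⟩

lemma tendsto_qMultipleGamma (n : ℕ) {w : ℂ} (hw : w ∈ complNonposInt) :
    Tendsto (fun p : ℝ × ℂ => qMultipleGamma p.1 n p.2) (𝓝[<] (1 : ℝ) ×ˢ 𝓝 w)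
      (𝓝 (multipleGamma n w)) := by
  obtain ⟨N, hN⟩ := exists_natCast_neg_lt w
  obtain ⟨g, -, hg⟩ := exists_tendsto_qMultipleGamma n N hw hN
  exact tendsto_nhds_limUnder ⟨g, hg⟩

lemma multipleGamma_ne_zero (n : ℕ) {w : ℂ} (hw : w ∈ complNonposInt) : multipleGamma n w ≠ 0 := by
  obtain ⟨N, hN⟩ := exists_natCast_neg_lt w
  obtain ⟨g, hg0, hg⟩ := exists_tendsto_qMultipleGamma n N hw hN
  rwa [tendsto_nhds_unique (tendsto_qMultipleGamma n hw) hg]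

lemma multipleGamma_zero_left (w : ℂ) : multipleGamma 0 w = w :=
  (tendsto_qMultipleGamma_zero w).limUnder_eq

lemma multipleGamma_eq_exp (n : ℕ) {w : ℂ} (hw : 0 < w.re) :
    multipleGamma n w = Complex.exp (logMultipleGamma n (w - 1)) :=
  (tendsto_qMultipleGamma_of_re_pos n hw).limUnder_eq

lemma multipleGamma_add_one (n : ℕ) {w : ℂ} (hw : w ∈ complNonposInt) :
    multipleGamma (n + 1) (w + 1) = multipleGamma n w * multipleGamma (n + 1) w := by
  have h1 : Tendsto (fun p : ℝ × ℂ => (p.1, p.2 + 1)) (𝓝[<] (1 : ℝ) ×ˢ 𝓝 w)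
      (𝓝[<] (1 : ℝ) ×ˢ 𝓝 (w + 1)) := tendsto_fst.prodMk (tendsto_snd.add_const 1)
  have h2 := (tendsto_qMultipleGamma (n + 1) (add_one_mem_complNonposInt hw)).comp h1
  have h3 := (tendsto_qMultipleGamma n hw).mul (tendsto_qMultipleGamma (n + 1) hw)
  refine tendsto_nhds_unique (h2.congr' ?_) h3
  filter_upwards [eventually_mem_Ioo w, eventually_cpow_ne_one hw] with p hp hpk
  exact qMultipleGamma_add_one hp.1 hp.2 n hpk

lemma differentiableAt_multipleGamma (n : ℕ) {w : ℂ} (hw : w ∈ complNonposInt) :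
    DifferentiableAt ℂ (multipleGamma n) w := by
  obtain ⟨N, hN⟩ := exists_natCast_neg_lt w
  induction n generalizing N w with
  | zero =>
    have : multipleGamma 0 = id := funext multipleGamma_zero_left
    rw [this]
    exact differentiableAt_id
  | succ n ihn =>
    induction N generalizing w with
    | zero =>
      have hre : 0 < w.re := by simpa using hN
      have h1 : DifferentiableAt ℂ (fun w => Complex.exp (logMultipleGamma (n + 1) (w - 1))) w :=
        (DifferentiableAt.comp w (differentiableAt_logMultipleGamma (n + 1) (by simpa using hre))
          (differentiableAt_id.sub_const 1)).cexp
      refine h1.congr_of_eventuallyEq ?_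
      filter_upwards [(isOpen_lt continuous_const Complex.continuous_re).mem_nhds hre] with v hv
      exact multipleGamma_eq_exp (n + 1) hv
    | succ N ihN =>
      have h1 := ihN (add_one_mem_complNonposInt hw) (by push_cast at hN; simp; linarith)
      have h2 := ihn hw (N + 1) hN
      have h3 : DifferentiableAt ℂ (fun v => multipleGamma (n + 1) (v + 1)) w :=
        DifferentiableAt.comp (g := multipleGamma (n + 1)) w h1 (differentiableAt_id.add_const 1)
      refine (h3.div h2 (multipleGamma_ne_zero n hw)).congr_of_eventuallyEq ?_
      filter_upwards [isOpen_complNonposInt.mem_nhds hw] with v hv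
      rw [Pi.div_apply, multipleGamma_add_one n hv,
        mul_div_cancel_left₀ _ (multipleGamma_ne_zero n hv)]

lemma multipleGamma_ofReal_add_one (n : ℕ) {x : ℝ} (hx : -1 < x) :
    multipleGamma n (x + 1) = (Real.exp (logMultipleGamma n x).re : ℂ) := by
  have h := multipleGamma_eq_exp n (w := (x : ℂ) + 1) (by simp; linarith)
  rw [h, add_sub_cancel_right, Complex.ofReal_exp]
  congr 1
  apply Complex.ext
  · simp
  · simpa using logMultipleGamma_im n hx

lemma log_multipleGamma_re (n : ℕ) {x : ℝ} (hx : -1 < x) :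
    Real.log (multipleGamma n (x + 1)).re = (logMultipleGamma n x).re := by
  rw [multipleGamma_ofReal_add_one n hx, Complex.ofReal_re, Real.log_exp]

lemma iteratedDeriv_log_multipleGamma_re (n N : ℕ) {x : ℝ} (hx : -1 < x) :
    iteratedDeriv N (fun y : ℝ => Real.log (multipleGamma n (y + 1)).re) x
      = (iteratedDeriv N (logMultipleGamma n) x).re := by
  rw [← iteratedDeriv_re_ofReal isOpen_re_gt_neg_one (fun _ hw =>
    (differentiableAt_logMultipleGamma n hw).differentiableWithinAt) N
    (show (x : ℂ) ∈ {z : ℂ | -1 < z.re} by simpa using hx)]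
  refine Filter.EventuallyEq.iteratedDeriv_eq N ?_
  filter_upwards [lt_mem_nhds hx] with y hy
  exact log_multipleGamma_re n hy

theorem isMultipleGamma_multipleGamma : IsMultipleGamma multipleGamma where
  differentiableOn n _ hw := (differentiableAt_multipleGamma n hw).differentiableWithinAt
  add_one n _ hw := multipleGamma_add_one n hw
  one n := by
    have := multipleGamma_ofReal_add_one n (x := 0) (by norm_num)
    simpa [logMultipleGamma_zero] using this
  pos n x hx := by
    rw [multipleGamma_ofReal_add_one n (by linarith), Complex.ofReal_im, Complex.ofReal_re]
    exact ⟨rfl, Real.exp_pos _⟩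
  convex n x hx := by
    rw [iteratedDeriv_log_multipleGamma_re n (n + 1) (by linarith)]
    exact iteratedDeriv_logMultipleGamma_re_nonneg n hx
  zero := multipleGamma_zero_left

/-! ### Uniform convergence and uniqueness -/

/-- Uniform convergence on compact sets from convergence in both variables jointly. -/
lemma tendstoUniformlyOn_qMultipleGamma (n : ℕ) {K : Set ℂ} (hK : IsCompact K)
    (hKs : K ⊆ complNegInt) :
    TendstoUniformlyOn (fun (q : ℝ) (z : ℂ) => qMultipleGamma q n (z + 1))
      (fun z : ℂ => multipleGamma n (z + 1)) (𝓝[<] (1 : ℝ)) K := by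
  refine (tendstoLocallyUniformlyOn_iff_tendstoUniformlyOn_of_compact hK).1 ?_
  refine tendstoLocallyUniformlyOn_iff_forall_tendsto.2 fun z hz => ?_
  have hz1 : z + 1 ∈ complNonposInt := fun k h => hKs hz k (by linear_combination h)
  have h1 : Tendsto (fun p : ℝ × ℂ => (p.1, p.2 + 1)) (𝓝[<] (1 : ℝ) ×ˢ 𝓝 z)
      (𝓝[<] (1 : ℝ) ×ˢ 𝓝 (z + 1)) := tendsto_fst.prodMk (tendsto_snd.add_const 1)
  have h2 := (tendsto_qMultipleGamma n hz1).comp h1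
  have h3 : Tendsto (fun p : ℝ × ℂ => multipleGamma n (p.2 + 1)) (𝓝[<] (1 : ℝ) ×ˢ 𝓝 z)
      (𝓝 (multipleGamma n (z + 1))) :=
    (differentiableAt_multipleGamma n hz1).continuousAt.tendsto.comp (tendsto_snd.add_const 1)
  have h4 : Tendsto (fun p : ℝ × ℂ => (multipleGamma n (p.2 + 1), qMultipleGamma p.1 n (p.2 + 1)))
      (𝓝[<] (1 : ℝ) ×ˢ 𝓝 z) (uniformity ℂ) :=
    (h3.prodMk_nhds h2).mono_right (nhds_le_uniformity _)
  exact h4.mono_left (prod_mono_right _ nhdsWithin_le_nhds)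

lemma isPreconnected_complNonposInt : IsPreconnected complNonposInt := by
  have h1 : complNonposInt = (Set.range fun k : ℕ => -(k : ℂ))ᶜ := by
    ext z
    simp only [complNonposInt, Set.mem_ofPred_eq, Set.mem_compl_iff, Set.mem_range, not_exists]
    exact forall_congr' fun k => ne_comm
  rw [h1]
  exact ((Set.countable_range _).isConnected_compl_of_one_lt_rank (by simp)).isPreconnected

/-- The identity theorem for holomorphic functions that agree on a real half-line. -/
lemma eqOn_of_eq_ofReal {U : Set ℂ} (hU : IsOpen U) (hUc : IsPreconnected U) {f g : ℂ → ℂ}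
    (hf : DifferentiableOn ℂ f U) (hg : DifferentiableOn ℂ g U) {a b : ℝ} (hab : a < b)
    (hb : (b : ℂ) ∈ U) (h : ∀ x : ℝ, a < x → f x = g x) : Set.EqOn f g U := by
  refine (hf.analyticOnNhd hU).eqOn_of_preconnected_of_frequently_eq (hg.analyticOnNhd hU) hUc hb ?_
  have h1 : Tendsto (fun x : ℝ => (x : ℂ)) (𝓝[≠] b) (𝓝[≠] (b : ℂ)) := by
    refine tendsto_nhdsWithin_iff.2 ⟨(Complex.continuous_ofReal.tendsto b).mono_left
      nhdsWithin_le_nhds, ?_⟩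
    filter_upwards [self_mem_nhdsWithin] with x hx
    exact fun hxb => hx (Complex.ofReal_injective hxb)
  refine h1.frequently (Eventually.frequently ?_)
  filter_upwards [nhdsWithin_le_nhds (lt_mem_nhds hab)] with x hx using h x hx

section
variable {E : Type*} [NormedAddCommGroup E] [NormedSpace ℝ E]

/-- A smooth periodic function with a constant higher derivative is constant. -/
lemma exists_const_of_periodic (n : ℕ) (p : ℝ → E)
    (hd : ∀ i, ∀ x : ℝ, 0 < x → DifferentiableAt ℝ (iteratedDeriv i p) x)
    (hp : ∀ x : ℝ, 0 < x → p (x + 1) = p x)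
    (hc : ∃ c, ∀ x : ℝ, 0 < x → iteratedDeriv n p x = c) : ∃ c, ∀ x : ℝ, 0 < x → p x = c := by
  induction n generalizing p with
  | zero => simpa using hc
  | succ n ih =>
    obtain ⟨c, hc⟩ := ih (deriv p) (fun i x hx => by
        rw [← iteratedDeriv_succ']; exact hd (i + 1) x hx)
      (fun x hx => by
        rw [← deriv_comp_add_const]
        refine Filter.EventuallyEq.deriv_eq ?_
        filter_upwards [lt_mem_nhds hx] with y hy using hp y hy)
      (by simpa only [← iteratedDeriv_succ'] using hc)
    have hdp : ∀ x : ℝ, 0 < x → HasDerivAt p c x := fun x hx => by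
      have := (hd 0 x hx).hasDerivAt
      rw [iteratedDeriv_zero, hc x hx] at this
      exact this
    have hcst : ∀ x : ℝ, 0 < x → p x - x • c = p 1 - (1 : ℝ) • c := fun x hx => by
      have hD : ∀ y ∈ Set.Ioi (0 : ℝ), HasDerivAt (fun x : ℝ => p x - x • c) 0 y := fun y hy => by
        have h1 := (hdp y hy).fun_sub ((hasDerivAt_id y).smul_const c)
        simpa using h1
      exact isOpen_Ioi.is_const_of_deriv_eq_zero isPreconnected_Ioi
        (fun y hy => (hD y hy).differentiableAt.differentiableWithinAt)
        (fun y hy => (hD y hy).deriv) hx (Set.mem_Ioi.2 one_pos)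
    have h0 : c = 0 := by
      have h1 := hcst 2 two_pos
      have h2 := hp 1 one_pos
      rw [one_add_one_eq_two] at h2
      rw [h2, sub_right_inj, ← sub_eq_zero, ← sub_smul] at h1
      norm_num at h1
      exact h1
    exact ⟨p 1, fun x hx => by simpa [h0] using hcst x hx⟩

end

lemma contDiffAt_differentiableAt_iteratedDeriv {f : ℝ → ℝ} {x : ℝ} (hf : ∀ n : ℕ, ContDiffAt ℝ n f x)
    (i : ℕ) : DifferentiableAt ℝ (iteratedDeriv i f) x := by
  have h1 := (hf (i + 1)).contDiffWithinAt (s := Set.univ)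
  have h2 := h1.differentiableWithinAt_iteratedDerivWithin (m := i)
    (by exact_mod_cast Nat.lt_succ_self i) (by simp)
  rw [iteratedDerivWithin_univ] at h2
  exact h2.differentiableAt univ_mem

lemma contDiffAt_re_ofReal {f : ℂ → ℂ} {x : ℝ} (hf : AnalyticAt ℂ f (x + 1)) (n : ℕ) :
    ContDiffAt ℝ n (fun y : ℝ => (f (y + 1)).re) x := by
  have h1 : ContDiffAt ℝ n f ((x : ℂ) + 1) := hf.contDiffAt.restrict_scalars ℝ
  have h2 : ContDiffAt ℝ n (fun y : ℝ => (y : ℂ) + 1) x :=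
    (Complex.ofRealCLM.contDiff.add contDiff_const).contDiffAt
  have h3 := ContDiffAt.comp x h1 h2
  exact Complex.reCLM.contDiff.contDiffAt.comp x h3

/-- Uniqueness on the half-line, for one step of the hierarchy: a function whose increments over
`[x, x + 1]` are prescribed is determined up to a constant if its derivative of order `n` is
increasing and the derivative of order `n` of the increment vanishes at infinity. -/
lemma exists_sub_eq_const {F Fc e : ℝ → ℝ} {n : ℕ}
    (hF : ∀ x : ℝ, 0 < x → ∀ N : ℕ, ContDiffAt ℝ N F x)
    (hFc : ∀ x : ℝ, 0 < x → ∀ N : ℕ, ContDiffAt ℝ N Fc x)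
    (he : ∀ x : ℝ, 0 < x → ∀ N : ℕ, ContDiffAt ℝ N e x)
    (hF1 : ∀ x : ℝ, 0 < x → F (x + 1) = F x + e x)
    (hFc1 : ∀ x : ℝ, 0 < x → Fc (x + 1) = Fc x + e x)
    (hF2 : ∀ x : ℝ, 0 < x → 0 ≤ iteratedDeriv (n + 1) F x)
    (hFc2 : ∀ x : ℝ, 0 < x → 0 ≤ iteratedDeriv (n + 1) Fc x)
    (he2 : Tendsto (iteratedDeriv n e) atTop (𝓝 0)) :
    ∃ c, ∀ x : ℝ, 0 < x → F x - Fc x = c := by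
  have hmono : ∀ {f : ℝ → ℝ}, (∀ x : ℝ, 0 < x → ∀ N : ℕ, ContDiffAt ℝ N f x) →
      (∀ x : ℝ, 0 < x → 0 ≤ iteratedDeriv (n + 1) f x) →
      MonotoneOn (iteratedDeriv n f) (Set.Ioi 0) := fun {f} hf hf2 => by
    have hd : DifferentiableOn ℝ (iteratedDeriv n f) (Set.Ioi 0) := fun x hx =>
      (contDiffAt_differentiableAt_iteratedDeriv (hf x hx) n).differentiableWithinAt
    refine monotoneOn_of_deriv_nonneg (convex_Ioi 0) hd.continuousOn ?_ ?_
    · rwa [interior_Ioi]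
    · rw [interior_Ioi]
      intro x hx
      rw [← iteratedDeriv_succ]
      exact hf2 x hx
  have hshift : ∀ {f : ℝ → ℝ}, (∀ x : ℝ, 0 < x → ∀ N : ℕ, ContDiffAt ℝ N f x) →
      (∀ x : ℝ, 0 < x → f (x + 1) = f x + e x) →
      ∀ x : ℝ, 0 < x → iteratedDeriv n f (x + 1) = iteratedDeriv n f x + iteratedDeriv n e x :=
    fun {f} hf hf1 x hx => by
      rw [← iteratedDeriv_fun_add (hf x hx n) (he x hx n),
        ← congrFun (iteratedDeriv_comp_add_const n f 1) x]
      refine Filter.EventuallyEq.iteratedDeriv_eq n ?_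
      filter_upwards [lt_mem_nhds hx] with y hy using hf1 y hy
  set p : ℝ → ℝ := fun x => F x - Fc x with hp
  have hpd : ∀ x : ℝ, 0 < x → iteratedDeriv n p x = iteratedDeriv n F x - iteratedDeriv n Fc x :=
    fun x hx => iteratedDeriv_fun_sub (hF x hx n) (hFc x hx n)
  have hper : ∀ x : ℝ, 0 < x → ∀ j : ℕ, iteratedDeriv n p (x + j) = iteratedDeriv n p x := by
    intro x hx j
    induction j with
    | zero => simp
    | succ j ih =>
      have hj : 0 < x + j := by positivity
      rw [← ih, Nat.cast_succ, ← add_assoc, hpd _ (by positivity), hpd _ hj,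
        hshift hF hF1 _ hj, hshift hFc hFc1 _ hj]
      ring
  have hclose : ∀ x h : ℝ, 0 < x → 0 ≤ h → h ≤ 1 →
      |iteratedDeriv n p (x + h) - iteratedDeriv n p x| ≤ iteratedDeriv n e x := by
    intro x h hx hh0 hh1
    have hxh : 0 < x + h := by positivity
    have hx1 : 0 < x + 1 := by positivity
    have m1 := hmono hF hF2 (Set.mem_Ioi.2 hx) (Set.mem_Ioi.2 hxh) (by linarith)
    have m2 := hmono hF hF2 (Set.mem_Ioi.2 hxh) (Set.mem_Ioi.2 hx1) (by linarith)
    have m3 := hmono hFc hFc2 (Set.mem_Ioi.2 hx) (Set.mem_Ioi.2 hxh) (by linarith)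
    have m4 := hmono hFc hFc2 (Set.mem_Ioi.2 hxh) (Set.mem_Ioi.2 hx1) (by linarith)
    rw [hshift hF hF1 x hx] at m2
    rw [hshift hFc hFc1 x hx] at m4
    rw [hpd _ hxh, hpd _ hx, abs_le]
    constructor <;> linarith
  have hlocal : ∀ x h : ℝ, 0 < x → 0 ≤ h → h ≤ 1 →
      iteratedDeriv n p (x + h) = iteratedDeriv n p x := by
    intro x h hx hh0 hh1
    have h1 : Tendsto (fun j : ℕ => iteratedDeriv n e (x + j)) atTop (𝓝 0) :=
      he2.comp (tendsto_atTop_add_const_left _ x tendsto_natCast_atTop_atTop)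
    have h2 : |iteratedDeriv n p (x + h) - iteratedDeriv n p x| ≤ 0 := by
      refine ge_of_tendsto' h1 fun j => ?_
      have h3 := hclose (x + j) h (by positivity) hh0 hh1
      rwa [show x + (j : ℝ) + h = x + h + j by ring, hper (x + h) (by positivity) j,
        hper x hx j] at h3
    exact sub_eq_zero.1 (abs_nonpos_iff.1 h2)
  refine exists_const_of_periodic n p (fun i x hx => contDiffAt_differentiableAt_iteratedDeriv
    (fun N => (hF x hx N).sub (hFc x hx N)) i) (fun x hx => by
      simp only [hp, hF1 x hx, hFc1 x hx]; ring) ⟨iteratedDeriv n p 1, fun x hx => ?_⟩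
  have hfl : ∀ x y : ℝ, 0 < x → x ≤ y → iteratedDeriv n p y = iteratedDeriv n p x := by
    intro x y hx hxy
    have h1 := Nat.floor_le (sub_nonneg.2 hxy)
    have h2 := (Nat.lt_floor_add_one (y - x)).le
    have h3 := hlocal x (y - x - ⌊y - x⌋₊) hx (by linarith) (by linarith)
    have h4 := hper (x + (y - x - ⌊y - x⌋₊)) (by linarith) ⌊y - x⌋₊
    rwa [show x + (y - x - ⌊y - x⌋₊) + ⌊y - x⌋₊ = y by ring, h3] at h4
  rcases le_total 1 x with h | h
  · exact hfl 1 x one_pos h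
  · exact (hfl x 1 hx h).symm

/-- The generalized Bohr–Mollerup theorem: the hierarchy is unique. -/
theorem IsMultipleGamma.eq_multipleGamma {G : ℕ → ℂ → ℂ} (hG : IsMultipleGamma G) (n : ℕ) :
    Set.EqOn (G n) (multipleGamma n) complNonposInt := by
  induction n with
  | zero =>
    intro w _
    rw [hG.zero, multipleGamma_zero_left]
  | succ n ih =>
    have hmem : ∀ x : ℝ, 0 ≤ x → ((x : ℂ) + 1) ∈ complNonposInt := fun x hx =>
      mem_complNonposInt_of_re_pos (by simp; linarith)
    have hH := isMultipleGamma_multipleGamma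
    -- the argument uses only the defining properties, so it applies to both hierarchies
    have hsmooth : ∀ {H : ℕ → ℂ → ℂ}, IsMultipleGamma H → ∀ m, ∀ x : ℝ, 0 < x → ∀ N : ℕ,
        ContDiffAt ℝ N (fun y : ℝ => Real.log (H m (y + 1)).re) x := fun {H} hH m x hx N =>
      (contDiffAt_re_ofReal ((hH.differentiableOn m).analyticAt
        (isOpen_complNonposInt.mem_nhds (hmem x hx.le))) N).log (hH.pos m x hx.le).2.ne'
    have hfun : ∀ {H : ℕ → ℂ → ℂ}, IsMultipleGamma H →
        Set.EqOn (H n) (multipleGamma n) complNonposInt → ∀ x : ℝ, 0 ≤ x →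
        Real.log (H (n + 1) ((x + 1 : ℝ) + 1)).re = Real.log (H (n + 1) (x + 1)).re +
          Real.log (multipleGamma n (x + 1)).re := fun {H} hH hHn x hx => by
      have h1 := hH.add_one n _ (hmem x hx)
      obtain ⟨i1, p1⟩ := hH.pos n x hx
      obtain ⟨i2, p2⟩ := hH.pos (n + 1) x hx
      rw [← hHn (hmem x hx), Complex.ofReal_add, Complex.ofReal_one, h1, Complex.mul_re, i1, i2,
        zero_mul, sub_zero, Real.log_mul p1.ne' p2.ne', add_comm]
    obtain ⟨c, hc⟩ := exists_sub_eq_const (n := n + 1)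
      (hsmooth hG (n + 1)) (hsmooth hH (n + 1)) (hsmooth hH n)
      (fun x hx => hfun hG ih x hx.le) (fun x hx => hfun hH (fun _ _ => rfl) x hx.le)
      (fun x hx => hG.convex (n + 1) x hx.le) (fun x hx => hH.convex (n + 1) x hx.le) (by
        have h1 := (Complex.continuous_re.tendsto _).comp
          (tendsto_iteratedDeriv_logMultipleGamma (le_refl n))
        refine h1.congr' ?_
        filter_upwards [eventually_gt_atTop (-1)] with x hx
        exact (iteratedDeriv_log_multipleGamma_re n (n + 1) hx).symm)
    have hc0 : c = 0 := by
      have h1 := hc 1 one_pos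
      have h2 := hfun hG ih 0 le_rfl
      have h3 := hfun hH (fun _ _ => rfl) 0 le_rfl
      simp only [zero_add, Complex.ofReal_zero, hG.one, hH.one, Complex.one_re, Real.log_one]
        at h2 h3
      rw [← h1]
      linarith
    refine eqOn_of_eq_ofReal isOpen_complNonposInt isPreconnected_complNonposInt
      (hG.differentiableOn _) (hH.differentiableOn _) (a := 1) (b := 2) one_lt_two ?_ ?_
    · exact mem_complNonposInt_of_re_pos (by simp)
    · intro x hx
      have hx0 : 0 < x - 1 := sub_pos.2 hx
      have h1 := hc (x - 1) hx0
      obtain ⟨i1, p1⟩ := hG.pos (n + 1) (x - 1) hx0.le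
      obtain ⟨i2, p2⟩ := hH.pos (n + 1) (x - 1) hx0.le
      rw [hc0, sub_eq_zero] at h1
      have h2 := Real.log_injOn_pos (Set.mem_Ioi.2 p1) (Set.mem_Ioi.2 p2) h1
      have h3 : ((x - 1 : ℝ) : ℂ) + 1 = x := by push_cast; ring
      rw [h3] at i1 i2 h2
      exact Complex.ext h2 (i1.trans i2.symm)

/-! ### One-step Euler–Maclaurin summation -/

lemma periodicBernoulli_eq (m : ℕ) (t : ℝ) :
    periodicBernoulli m t = bernoulliFun m (Int.fract t) := by
  rw [periodicBernoulli, bernoulliFun, Polynomial.eval_map_algebraMap]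

lemma periodicBernoulli_add_one (m : ℕ) (t : ℝ) :
    periodicBernoulli m (t + 1) = periodicBernoulli m t := by
  rw [periodicBernoulli, periodicBernoulli, Int.fract_add_one]

lemma measurable_periodicBernoulli (m : ℕ) : Measurable (periodicBernoulli m) := by
  have : periodicBernoulli m = fun t => bernoulliFun m (Int.fract t) :=
    funext (periodicBernoulli_eq m)
  rw [this]
  exact (continuous_bernoulliFun m).measurable.comp measurable_fract

lemma exists_abs_periodicBernoulli_le (m : ℕ) : ∃ C, 0 ≤ C ∧ ∀ t, |periodicBernoulli m t| ≤ C := by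
  obtain ⟨C, hC⟩ := (isCompact_Icc (a := (0 : ℝ)) (b := 1)).exists_bound_of_continuousOn
    (continuous_bernoulliFun m).continuousOn
  refine ⟨C, (norm_nonneg _).trans (hC 0 (by simp)), fun t => ?_⟩
  rw [periodicBernoulli_eq]
  exact hC _ ⟨Int.fract_nonneg t, (Int.fract_lt_one t).le⟩

/-- Euler–Maclaurin summation over one unit step. The functions `D i` are the successive
derivatives of `D 0`, and `Φ` is an antiderivative. -/
lemma euler_maclaurin_unit {Φ : ℝ → ℂ} {D : ℕ → ℝ → ℂ}
    (hΦ : ∀ t ∈ Set.Icc (0 : ℝ) 1, HasDerivAt Φ (D 0 t) t)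
    (hD : ∀ i, ∀ t ∈ Set.Icc (0 : ℝ) 1, HasDerivAt (D i) (D (i + 1) t) t) (m : ℕ) :
    D 0 0 = Φ 1 - Φ 0 +
      ∑ r ∈ Finset.Icc 1 (m + 1), (bernoulli r : ℂ) / (r.factorial : ℂ) *
        (D (r - 1) 1 - D (r - 1) 0) +
      (-1) ^ m / ((m + 1).factorial : ℂ) *
        ∫ t in (0 : ℝ)..1, (bernoulliFun (m + 1) t : ℂ) * D (m + 1) t := by
  have hcont : ∀ i, ContinuousOn (D i) (Set.Icc 0 1) := fun i t ht =>
    (hD i t ht).continuousAt.continuousWithinAt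
  have huI : Set.uIcc (0 : ℝ) 1 = Set.Icc 0 1 := Set.uIcc_of_le zero_le_one
  have hint : ∀ i, IntervalIntegrable (D i) volume 0 1 := fun i =>
    ContinuousOn.intervalIntegrable (by rw [huI]; exact hcont i)
  have hb : ∀ k : ℕ, ∀ t ∈ Set.uIcc (0 : ℝ) 1, HasDerivAt (fun t : ℝ => (bernoulliFun (k + 1) t : ℂ))
      (((k : ℂ) + 1) * (bernoulliFun k t : ℂ)) t := fun k t _ => by
    have := (hasDerivAt_bernoulliFun (k + 1) t).ofReal_comp
    rw [Nat.add_sub_cancel] at this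
    convert this using 1
    push_cast; ring
  have hbint : ∀ k : ℕ, IntervalIntegrable (fun t : ℝ => ((k : ℂ) + 1) * (bernoulliFun k t : ℂ))
      volume 0 1 := fun k =>
    (continuous_const.mul (Complex.continuous_ofReal.comp
      (continuous_bernoulliFun k))).intervalIntegrable 0 1
  -- integration by parts
  have hparts : ∀ k : ℕ, ∫ t in (0 : ℝ)..1, (bernoulliFun (k + 1) t : ℂ) * D (k + 1) t
      = (bernoulliFun (k + 1) 1 : ℂ) * D k 1 - (bernoulliFun (k + 1) 0 : ℂ) * D k 0
        - ((k : ℂ) + 1) * ∫ t in (0 : ℝ)..1, (bernoulliFun k t : ℂ) * D k t := fun k => by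
    rw [intervalIntegral.integral_mul_deriv_eq_deriv_mul (hb k)
      (fun t ht => hD k t (huI ▸ ht)) (hbint k) (hint (k + 1)),
      ← intervalIntegral.integral_const_mul]
    simp only [mul_assoc]
  induction m with
  | zero =>
    have h0 : ∫ t in (0 : ℝ)..1, (bernoulliFun 0 t : ℂ) * D 0 t = Φ 1 - Φ 0 := by
      simp only [bernoulliFun_zero, Complex.ofReal_one, one_mul]
      exact intervalIntegral.integral_eq_sub_of_hasDerivAt (fun t ht => hΦ t (huI ▸ ht)) (hint 0)
    rw [hparts, h0]
    simp [bernoulli_one]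
    ring
  | succ m ih =>
    have he : (bernoulliFun (m + 1 + 1) 1 : ℂ) = (bernoulli (m + 1 + 1) : ℂ) := by
      rw [bernoulliFun_endpoints_eq_of_ne_one (by omega), bernoulliFun_eval_zero]
      simp
    have he0 : (bernoulliFun (m + 1 + 1) 0 : ℂ) = (bernoulli (m + 1 + 1) : ℂ) := by
      rw [bernoulliFun_eval_zero]; simp
    -- the sign agrees because the Bernoulli numbers of odd index `> 1` vanish
    have hsign : (-1 : ℂ) ^ m * (bernoulli (m + 1 + 1) : ℂ) = (bernoulli (m + 1 + 1) : ℂ) := by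
      rcases Nat.even_or_odd m with h | h
      · rw [h.neg_one_pow, one_mul]
      · rw [bernoulli_eq_zero_of_odd h.add_one.add_one (by omega)]; simp
    have hf : ((m + 1 + 1).factorial : ℂ) = ((m : ℂ) + 1 + 1) * ((m + 1).factorial : ℂ) := by
      rw [Nat.factorial_succ]; push_cast; ring
    have hf0 : ((m + 1).factorial : ℂ) ≠ 0 := by exact_mod_cast (m + 1).factorial_ne_zero
    have hm0 : ((m : ℂ) + 1 + 1) ≠ 0 := by exact_mod_cast (m + 1).succ_ne_zero
    rw [Finset.sum_Icc_succ_top (by omega), hparts (m + 1), he, he0, hf]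
    conv_lhs => rw [ih]
    rw [Nat.add_sub_cancel]
    push_cast
    field_simp
    linear_combination (D (m + 1) 1 - D (m + 1) 0) * hsign

lemma integrableOn_Ioi_comp_add_one {E : Type*} [NormedAddCommGroup E] {g : ℝ → E} {a : ℝ} :
    IntegrableOn (fun t => g (t + 1)) (Set.Ioi a) ↔ IntegrableOn g (Set.Ioi (a + 1)) := by
  have := (measurePreserving_add_right volume (1 : ℝ)).integrableOn_comp_preimage
    (MeasurableEquiv.addRight (1 : ℝ)).measurableEmbedding (f := g) (s := Set.Ioi (a + 1))
  rw [Set.preimage_add_const_Ioi, add_sub_cancel_right] at this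
  exact this

lemma setIntegral_Ioi_comp_add_one (g : ℝ → ℂ) (a : ℝ) :
    ∫ t in Set.Ioi a, g (t + 1) = ∫ t in Set.Ioi (a + 1), g t := by
  have := (measurePreserving_add_right volume (1 : ℝ)).setIntegral_preimage_emb
    (MeasurableEquiv.addRight (1 : ℝ)).measurableEmbedding g (Set.Ioi (a + 1))
  rwa [Set.preimage_add_const_Ioi, add_sub_cancel_right] at this

/-- The value `-Φ(0) - ∑ B_r / r! D_{r-1}(0) + (-1)^{m-1} / m! ∫_0^∞ B̄_m(t) D_m(t) dt` that
Euler–Maclaurin summation of order `m` assigns to `∑_{k ≥ 0} D_0(k)`, where the `D i` are the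
derivatives of `D 0` and `Φ` is an antiderivative that stands for the integral from `∞`. -/
noncomputable def emSum (m : ℕ) (Φ : ℝ → ℂ) (D : ℕ → ℝ → ℂ) : ℂ :=
  -Φ 0 - ∑ r ∈ Finset.Icc 1 m, (bernoulli r : ℂ) / (r.factorial : ℂ) * D (r - 1) 0 +
    (-1) ^ (m - 1) / (m.factorial : ℂ) *
      ∫ t in Set.Ioi (0 : ℝ), (periodicBernoulli m t : ℂ) * D m t

/-- Dropping the first term of the sum. -/
lemma emSum_sub_emSum_add_one {m : ℕ} (hm : 1 ≤ m) {Φ : ℝ → ℂ} {D : ℕ → ℝ → ℂ}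
    (hΦ : ∀ t ∈ Set.Icc (0 : ℝ) 1, HasDerivAt Φ (D 0 t) t)
    (hD : ∀ i, ∀ t ∈ Set.Icc (0 : ℝ) 1, HasDerivAt (D i) (D (i + 1) t) t)
    (hint : IntegrableOn (fun t => (periodicBernoulli m t : ℂ) * D m t) (Set.Ioi 0)) :
    emSum m Φ D - emSum m (fun t => Φ (t + 1)) (fun i t => D i (t + 1)) = D 0 0 := by
  obtain ⟨m, rfl⟩ := Nat.exists_eq_add_of_le' hm
  have h1 : ∫ t in Set.Ioi (0 : ℝ), (periodicBernoulli (m + 1) t : ℂ) * D (m + 1) (t + 1)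
      = ∫ t in Set.Ioi (1 : ℝ), (periodicBernoulli (m + 1) t : ℂ) * D (m + 1) t := by
    have := setIntegral_Ioi_comp_add_one
      (fun t => (periodicBernoulli (m + 1) t : ℂ) * D (m + 1) t) 0
    simp only [periodicBernoulli_add_one, zero_add] at this
    exact this
  have h2 : ∫ t in Set.Ioi (0 : ℝ), (periodicBernoulli (m + 1) t : ℂ) * D (m + 1) t
      = (∫ t in (0 : ℝ)..1, (bernoulliFun (m + 1) t : ℂ) * D (m + 1) t) +
        ∫ t in Set.Ioi (1 : ℝ), (periodicBernoulli (m + 1) t : ℂ) * D (m + 1) t := by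
    have hu : Set.Ioi (0 : ℝ) = Set.Ioc 0 1 ∪ Set.Ioi 1 := (Set.Ioc_union_Ioi_eq_Ioi zero_le_one).symm
    rw [hu, setIntegral_union (Set.Ioc_disjoint_Ioi le_rfl) measurableSet_Ioi
      (hint.mono_set Set.Ioc_subset_Ioi_self) (hint.mono_set (Set.Ioi_subset_Ioi zero_le_one)),
      intervalIntegral.integral_of_le zero_le_one, integral_Ioc_eq_integral_Ioo,
      integral_Ioc_eq_integral_Ioo]
    congr 1
    refine setIntegral_congr_fun measurableSet_Ioo fun t ht => ?_
    simp only [periodicBernoulli_eq, Int.fract_eq_self.2 ⟨ht.1.le, ht.2⟩]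
  have h3 := euler_maclaurin_unit hΦ hD m
  simp only [mul_sub, Finset.sum_sub_distrib] at h3
  rw [emSum, emSum, h1, h2, h3]
  simp only [zero_add, Nat.add_sub_cancel]
  ring

/-- A parametric integral of functions that are holomorphic in the parameter and dominated by an
integrable function is holomorphic; Cauchy's estimate bounds the derivatives. -/
lemma differentiableAt_integral_of_norm_le {μ : Measure ℝ} {F : ℂ → ℝ → ℂ} {b : ℝ → ℝ} {U : Set ℂ}
    (hU : IsOpen U) {z : ℂ} (hz : z ∈ U) (hm : ∀ x ∈ U, AEStronglyMeasurable (F x) μ)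
    (hd : ∀ᵐ t ∂μ, DifferentiableOn ℂ (fun x => F x t) U)
    (hb : ∀ᵐ t ∂μ, ∀ x ∈ U, ‖F x t‖ ≤ b t) (hbi : Integrable b μ) :
    DifferentiableAt ℂ (fun x => ∫ t, F x t ∂μ) z := by
  obtain ⟨ε, hε, hball⟩ := Metric.isOpen_iff.1 hU z hz
  have hε2 : 0 < ε / 2 := half_pos hε
  have hzint : Integrable (F z) μ := hbi.mono' (hm z hz) (hb.mono fun t ht => ht z hz)
  have hsub : ∀ x ∈ Metric.ball z (ε / 2), Metric.closedBall x (ε / 4) ⊆ U := fun x hx y hy =>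
    hball (Metric.mem_ball.2 (by
      have h1 := Metric.mem_ball.1 hx
      have h2 := Metric.mem_closedBall.1 hy
      linarith [dist_triangle y x z]))
  have hmeas : AEStronglyMeasurable (fun t => deriv (fun x => F x t) z) μ := by
    obtain ⟨u, hu⟩ := exists_seq_tendsto (𝓝[≠] (0 : ℂ))
    have hu0 := (tendsto_nhdsWithin_iff.1 hu).1
    have hev : ∀ᶠ n in atTop, z + u n ∈ U := by
      have : Tendsto (fun n => z + u n) atTop (𝓝 z) := by simpa using hu0.const_add z
      exact this.eventually (hU.mem_nhds hz)
    obtain ⟨n0, hn0⟩ := eventually_atTop.1 hev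
    refine aestronglyMeasurable_of_tendsto_ae (u := atTop)
      (f := fun n t => (u (n + n0))⁻¹ • (F (z + u (n + n0)) t - F z t)) (fun n =>
        ((hm (z + u (n + n0)) (hn0 _ (Nat.le_add_left _ _))).sub (hm z hz)).const_smul
          (u (n + n0))⁻¹) ?_
    filter_upwards [hd] with t ht
    have h1 := (ht.differentiableAt (hU.mem_nhds hz)).hasDerivAt.tendsto_slope_zero
    exact h1.comp ((tendsto_add_atTop_iff_nat n0).2 hu)
  refine (hasDerivAt_integral_of_dominated_loc_of_deriv_le (Metric.ball_mem_nhds z hε2)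
    (F' := fun x t => deriv (fun x => F x t) x) (bound := fun t => b t / (ε / 4)) ?_ hzint hmeas
    ?_ (hbi.div_const _) ?_).2.differentiableAt
  · filter_upwards [hU.mem_nhds hz] with x hx using hm x hx
  · filter_upwards [hd, hb] with t htd htb x hx
    exact Complex.norm_deriv_le_of_forall_mem_sphere_norm_le (by positivity)
      ((htd.mono (hsub x hx)).diffContOnCl_ball le_rfl)
      fun y hy => htb y (hsub x hx (Metric.sphere_subset_closedBall hy))
  · filter_upwards [hd] with t htd x hx
    exact (htd.differentiableAt (hU.mem_nhds (hsub x hx (Metric.mem_closedBall_self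
      (by positivity))))).hasDerivAt

/-! ### Euler–Maclaurin summation of `w ^ j log w` -/

/-- The coefficient of `w ^ (-s - i)` in the `i`-th derivative of `w ^ (-s)`. -/
noncomputable def powCoeff (s : ℂ) : ℕ → ℂ
  | 0 => 1
  | i + 1 => (-s - i) * powCoeff s i

/-- The derivative of `powCoeff s i` with respect to `s`. -/
noncomputable def powCoeffDeriv (s : ℂ) : ℕ → ℂ
  | 0 => 0
  | i + 1 => (-s - i) * powCoeffDeriv s i - powCoeff s i

lemma hasDerivAt_powCoeff (s : ℂ) (i : ℕ) :
    HasDerivAt (fun s => powCoeff s i) (powCoeffDeriv s i) s := by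
  induction i with
  | zero => exact hasDerivAt_const s 1
  | succ i ih =>
    have h : HasDerivAt (fun s : ℂ => -s - i) (-1) s := (hasDerivAt_id s).neg.sub_const _
    refine (h.mul ih).congr_deriv ?_
    simp only [powCoeffDeriv]; ring

lemma powCoeff_neg_natCast {j i : ℕ} (h : j < i) : powCoeff (-(j : ℂ)) i = 0 := by
  induction i, h using Nat.le_induction with
  | base => simp [powCoeff]
  | succ i _ ih => rw [powCoeff, ih, mul_zero]

/-- The `i`-th derivative of `w ^ (-s)`. -/
noncomputable def powDeriv (s : ℂ) (i : ℕ) (w : ℂ) : ℂ := powCoeff s i * w ^ (-s - i)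

/-- The `i`-th derivative of `w ^ (-s) log w`; it is `-d/ds` of `powDeriv s i w`. -/
noncomputable def powLogDeriv (s : ℂ) (i : ℕ) (w : ℂ) : ℂ :=
  powCoeff s i * w ^ (-s - i) * Complex.log w - powCoeffDeriv s i * w ^ (-s - i)

lemma hasDerivAt_cpow_const {w : ℂ} (hw : w ∈ Complex.slitPlane) (a : ℂ) :
    HasDerivAt (fun w : ℂ => w ^ a) (a * w ^ (a - 1)) w := by
  simpa using (hasDerivAt_id w).cpow_const (c := a) hw

lemma hasDerivAt_powDeriv (s : ℂ) (i : ℕ) {w : ℂ} (hw : w ∈ Complex.slitPlane) :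
    HasDerivAt (powDeriv s i) (powDeriv s (i + 1) w) w := by
  refine ((hasDerivAt_cpow_const hw (-s - i)).const_mul (powCoeff s i)).congr_deriv ?_
  simp only [powDeriv, powCoeff]
  rw [show -s - ((i + 1 : ℕ) : ℂ) = -s - i - 1 by push_cast; ring]
  ring

lemma hasDerivAt_powLogDeriv (s : ℂ) (i : ℕ) {w : ℂ} (hw : w ∈ Complex.slitPlane) :
    HasDerivAt (powLogDeriv s i) (powLogDeriv s (i + 1) w) w := by
  have hp := hasDerivAt_cpow_const hw (-s - i)
  refine (((hp.const_mul (powCoeff s i)).mul (Complex.hasDerivAt_log hw)).sub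
    (hp.const_mul (powCoeffDeriv s i))).congr_deriv ?_
  have h0 : w ≠ 0 := Complex.slitPlane_ne_zero hw
  simp only [powLogDeriv, powCoeff, powCoeffDeriv]
  rw [show -s - ((i + 1 : ℕ) : ℂ) = -s - i - 1 by push_cast; ring, Complex.cpow_sub _ _ h0,
    Complex.cpow_one]
  field_simp
  ring

lemma powLogDeriv_neg_natCast (j i : ℕ) (w : ℂ) :
    powLogDeriv (-(j : ℂ)) i w = powCoeff (-(j : ℂ)) i * w ^ ((j : ℤ) - i) * Complex.log w -
      powCoeffDeriv (-(j : ℂ)) i * w ^ ((j : ℤ) - i) := by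
  have : w ^ (-(-(j : ℂ)) - i) = w ^ ((j : ℤ) - i) := by
    rw [← Complex.cpow_intCast]; push_cast; rw [neg_neg]
  rw [powLogDeriv, this]

lemma powLogDeriv_zero (j : ℕ) (w : ℂ) :
    powLogDeriv (-(j : ℂ)) 0 w = w ^ j * Complex.log w := by
  simp [powLogDeriv_neg_natCast, powCoeff, powCoeffDeriv]

lemma powLogDeriv_of_lt {j i : ℕ} (h : j < i) (w : ℂ) :
    powLogDeriv (-(j : ℂ)) i w = -powCoeffDeriv (-(j : ℂ)) i * (w ^ (i - j))⁻¹ := by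
  rw [powLogDeriv_neg_natCast, powCoeff_neg_natCast h, ← zpow_natCast, ← zpow_neg,
    Nat.cast_sub h.le, neg_sub]
  ring

/-- The antiderivative `w ^ (j + 1) log w / (j + 1) - w ^ (j + 1) / (j + 1) ^ 2` of
`w ^ j log w`. -/
noncomputable def powLogPrimitive (j : ℕ) (w : ℂ) : ℂ :=
  w ^ (j + 1) * Complex.log w / (j + 1) - w ^ (j + 1) / ((j : ℂ) + 1) ^ 2

lemma hasDerivAt_powLogPrimitive (j : ℕ) {w : ℂ} (hw : w ∈ Complex.slitPlane) :
    HasDerivAt (powLogPrimitive j) (powLogDeriv (-(j : ℂ)) 0 w) w := by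
  have hp := hasDerivAt_pow (j + 1) w
  refine (((hp.mul (Complex.hasDerivAt_log hw)).div_const _).sub
    (hp.div_const (((j : ℂ) + 1) ^ 2))).congr_deriv ?_
  have h0 : w ≠ 0 := Complex.slitPlane_ne_zero hw
  have h1 : (j : ℂ) + 1 ≠ 0 := Nat.cast_add_one_ne_zero j
  rw [powLogDeriv_zero]
  push_cast
  field_simp
  ring

lemma HasDerivAt.comp_const_add_ofReal {f : ℂ → ℂ} {f' w : ℂ} {t : ℝ}
    (h : HasDerivAt f f' (w + t)) : HasDerivAt (fun t : ℝ => f (w + t)) f' t :=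
  (h.comp_const_add w (t : ℂ)).comp_ofReal

lemma add_ofReal_mem_slitPlane {w : ℂ} (hw : w ∈ Complex.slitPlane) {t : ℝ} (ht : 0 ≤ t) :
    w + t ∈ Complex.slitPlane := by
  rw [Complex.mem_slitPlane_iff] at hw ⊢
  simp only [Complex.add_re, Complex.add_im, Complex.ofReal_re, Complex.ofReal_im, add_zero]
  exact hw.imp (fun h => by linarith) id

/-- Locally uniformly in the slit plane, `|w + t|` is bounded below by a multiple of `1 + t`: after
division by `1 + t`, the point `w + t` lies on the segment from `w` to `1`. -/
lemma exists_ball_le_norm_add {w : ℂ} (hw : w ∈ Complex.slitPlane) :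
    ∃ ε > 0, ∃ c > 0, Metric.ball w ε ⊆ Complex.slitPlane ∧
      ∀ x ∈ Metric.ball w ε, ∀ t : ℝ, 0 ≤ t → c * (1 + t) ≤ ‖x + t‖ := by
  obtain ⟨ε, hε, hball⟩ := Metric.nhds_basis_closedBall.mem_iff.1
    (Complex.isOpen_slitPlane.mem_nhds hw)
  have hK : IsCompact (Metric.closedBall w ε ×ˢ Set.Icc (0 : ℝ) 1) :=
    (isCompact_closedBall w ε).prod isCompact_Icc
  obtain ⟨p, hp, hmin⟩ := hK.exists_isMinOn (f := fun p : ℂ × ℝ => ‖(p.2 : ℂ) + (1 - p.2) * p.1‖)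
    ⟨(w, 0), Metric.mem_closedBall_self hε.le, by simp⟩ (by fun_prop)
  have hpos : ∀ q ∈ Metric.closedBall w ε ×ˢ Set.Icc (0 : ℝ) 1,
      (q.2 : ℂ) + (1 - q.2) * q.1 ∈ Complex.slitPlane := fun q hq => by
    have := Complex.starConvex_one_slitPlane (hball hq.1) hq.2.1 (sub_nonneg.2 hq.2.2)
      (add_sub_cancel _ _)
    simpa using this
  refine ⟨ε, hε, _, norm_pos_iff.2 (Complex.slitPlane_ne_zero (hpos p hp)),
    Metric.ball_subset_closedBall.trans hball, fun x hx t ht => ?_⟩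
  have ht1 : 0 < 1 + t := by linarith
  have hm := isMinOn_iff.1 hmin (x, t / (1 + t)) ⟨Metric.ball_subset_closedBall hx,
    by positivity, (div_le_one ht1).2 (by linarith)⟩
  have htc : (1 + t : ℂ) ≠ 0 := by exact_mod_cast ht1.ne'
  have he : x + t = ((1 + t : ℝ) : ℂ) *
      (((t / (1 + t) : ℝ) : ℂ) + (1 - ((t / (1 + t) : ℝ) : ℂ)) * x) := by
    push_cast; field_simp; ring
  rw [he, norm_mul, Complex.norm_real, Real.norm_of_nonneg ht1.le, mul_comm]
  exact mul_le_mul_of_nonneg_left hm ht1.le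

/-- The Euler–Maclaurin regularization, of order `m`, of minus the divergent series
`∑_{k ≥ 0} (w + k) ^ j log (w + k)`. -/
noncomputable def powLogSum (m j : ℕ) (w : ℂ) : ℂ :=
  -emSum m (fun t => powLogPrimitive j (w + t)) (fun i t => powLogDeriv (-(j : ℂ)) i (w + t))

/-- The integrand of the remainder in `powLogSum` is dominated by a multiple of
`1 / (1 + t ^ 2)`. -/
lemma norm_periodicBernoulli_mul_powLogDeriv_le {m j : ℕ} (hm : j + 2 ≤ m) :
    ∃ C, 0 ≤ C ∧ ∀ w : ℂ, ∀ c t : ℝ, 0 < c → 0 ≤ t → c * (1 + t) ≤ ‖w + t‖ →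
      ‖(periodicBernoulli m t : ℂ) * powLogDeriv (-(j : ℂ)) m (w + t)‖
        ≤ C * (c ^ (m - j))⁻¹ * (1 + t ^ 2)⁻¹ := by
  obtain ⟨B, hB0, hB⟩ := exists_abs_periodicBernoulli_le m
  refine ⟨B * ‖powCoeffDeriv (-(j : ℂ)) m‖, by positivity, fun w c t hc ht h => ?_⟩
  rw [powLogDeriv_of_lt (by omega), norm_mul, norm_mul, norm_neg, norm_inv, norm_pow,
    Complex.norm_real, Real.norm_eq_abs, ← mul_assoc, mul_assoc (B * _), ← mul_inv]
  gcongr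
  · exact hB t
  · calc c ^ (m - j) * (1 + t ^ 2) ≤ c ^ (m - j) * (1 + t) ^ 2 := by gcongr; nlinarith
      _ ≤ c ^ (m - j) * (1 + t) ^ (m - j) := by gcongr; · linarith
                                                · omega
      _ ≤ _ := by rw [← mul_pow]; gcongr

lemma continuousOn_powLogDeriv_add (j i : ℕ) {w : ℂ} (hw : w ∈ Complex.slitPlane) :
    ContinuousOn (fun t : ℝ => powLogDeriv (-(j : ℂ)) i (w + t)) (Set.Ici 0) := fun t ht =>
  ((hasDerivAt_powLogDeriv _ i (add_ofReal_mem_slitPlane hw ht)).continuousAt.comp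
    (f := fun t : ℝ => w + (t : ℂ)) (by fun_prop)).continuousWithinAt

lemma aestronglyMeasurable_powLogDeriv (m j : ℕ) {w : ℂ} (hw : w ∈ Complex.slitPlane) :
    AEStronglyMeasurable (fun t : ℝ => (periodicBernoulli m t : ℂ) *
      powLogDeriv (-(j : ℂ)) m (w + t)) (volume.restrict (Set.Ioi 0)) :=
  (Complex.measurable_ofReal.comp (measurable_periodicBernoulli m)).aestronglyMeasurable.mul
    (((continuousOn_powLogDeriv_add j m hw).mono Set.Ioi_subset_Ici_self).aestronglyMeasurable
      measurableSet_Ioi)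

lemma integrableOn_powLogDeriv {m j : ℕ} (hm : j + 2 ≤ m) {w : ℂ} (hw : w ∈ Complex.slitPlane) :
    IntegrableOn (fun t : ℝ => (periodicBernoulli m t : ℂ) * powLogDeriv (-(j : ℂ)) m (w + t))
      (Set.Ioi 0) := by
  obtain ⟨C, -, hC⟩ := norm_periodicBernoulli_mul_powLogDeriv_le hm
  obtain ⟨ε, hε, c, hc, -, h⟩ := exists_ball_le_norm_add hw
  refine Integrable.mono' ((integrable_inv_one_add_sq.integrableOn).const_mul
    (C * (c ^ (m - j))⁻¹)) (aestronglyMeasurable_powLogDeriv m j hw) ?_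
  filter_upwards [ae_restrict_mem measurableSet_Ioi] with t ht
  exact hC w c t hc (le_of_lt ht) (h w (Metric.mem_ball_self hε) t (le_of_lt ht))

lemma powLogSum_eq {m j : ℕ} (w : ℂ) : powLogSum m j w = powLogPrimitive j w +
    ∑ r ∈ Finset.Icc 1 m, (bernoulli r : ℂ) / (r.factorial : ℂ) * powLogDeriv (-(j : ℂ)) (r - 1) w -
    (-1) ^ (m - 1) / (m.factorial : ℂ) *
      ∫ t in Set.Ioi (0 : ℝ), (periodicBernoulli m t : ℂ) * powLogDeriv (-(j : ℂ)) m (w + t) := by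
  rw [powLogSum, emSum]
  simp only [Complex.ofReal_zero, add_zero]
  ring

/-- The functional equation of the regularized sum: the term `k = 0` splits off. -/
lemma powLogSum_add_one {m j : ℕ} (hm : j + 2 ≤ m) {w : ℂ} (hw : w ∈ Complex.slitPlane) :
    powLogSum m j (w + 1) = powLogSum m j w + w ^ j * Complex.log w := by
  have hs : ∀ t ∈ Set.Icc (0 : ℝ) 1, w + t ∈ Complex.slitPlane := fun t ht =>
    add_ofReal_mem_slitPlane hw ht.1
  have := emSum_sub_emSum_add_one (m := m) (by omega)
    (Φ := fun t : ℝ => powLogPrimitive j (w + t))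
    (D := fun i t => powLogDeriv (-(j : ℂ)) i (w + t))
    (fun t ht => (hasDerivAt_powLogPrimitive j (hs t ht)).comp_const_add_ofReal)
    (fun i t ht => (hasDerivAt_powLogDeriv (-(j : ℂ)) i (hs t ht)).comp_const_add_ofReal)
    (integrableOn_powLogDeriv hm hw)
  simp only [Complex.ofReal_zero, add_zero, Complex.ofReal_add, Complex.ofReal_one,
    powLogDeriv_zero] at this
  simp only [add_comm _ (1 : ℂ), ← add_assoc] at this
  simp only [powLogSum, add_comm w 1]
  linear_combination this

lemma differentiableOn_powLogSum {m j : ℕ} (hm : j + 2 ≤ m) :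
    DifferentiableOn ℂ (powLogSum m j) Complex.slitPlane := by
  intro w hw
  refine DifferentiableAt.differentiableWithinAt ?_
  obtain ⟨C, -, hC⟩ := norm_periodicBernoulli_mul_powLogDeriv_le hm
  obtain ⟨ε, hε, c, hc, hsub, h⟩ := exists_ball_le_norm_add hw
  have hI : DifferentiableAt ℂ (fun w : ℂ => ∫ t in Set.Ioi (0 : ℝ),
      (periodicBernoulli m t : ℂ) * powLogDeriv (-(j : ℂ)) m (w + t)) w := by
    refine differentiableAt_integral_of_norm_le (b := fun t => C * (c ^ (m - j))⁻¹ * (1 + t ^ 2)⁻¹)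
      Metric.isOpen_ball (Metric.mem_ball_self hε)
      (fun x hx => aestronglyMeasurable_powLogDeriv m j (hsub hx)) ?_ ?_
      ((integrable_inv_one_add_sq.integrableOn).const_mul _)
    · filter_upwards [ae_restrict_mem measurableSet_Ioi] with t ht x hx
      exact (((hasDerivAt_powLogDeriv _ m (add_ofReal_mem_slitPlane (hsub hx)
        (le_of_lt ht))).comp_add_const x (t : ℂ)).const_mul _).differentiableAt.differentiableWithinAt
    · filter_upwards [ae_restrict_mem measurableSet_Ioi] with t ht x hx
      exact hC x c t hc (le_of_lt ht) (h x hx t (le_of_lt ht))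
  have he : powLogSum m j = fun w => powLogPrimitive j w +
      ∑ r ∈ Finset.Icc 1 m, (bernoulli r : ℂ) / (r.factorial : ℂ) *
        powLogDeriv (-(j : ℂ)) (r - 1) w -
      (-1) ^ (m - 1) / (m.factorial : ℂ) *
        ∫ t in Set.Ioi (0 : ℝ), (periodicBernoulli m t : ℂ) * powLogDeriv (-(j : ℂ)) m (w + t) :=
    funext powLogSum_eq
  rw [he]
  exact ((hasDerivAt_powLogPrimitive j hw).differentiableAt.add
    (DifferentiableAt.fun_sum fun r _ =>
      (hasDerivAt_powLogDeriv _ (r - 1) hw).differentiableAt.const_mul _)).sub (hI.const_mul _)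

/-- `powLogSum m j` grows at most polynomially in the half-plane `Re w ≥ 1`. -/
lemma exists_norm_powLogSum_le {m j : ℕ} (hm : j + 2 ≤ m) :
    ∃ C, ∀ w : ℂ, 1 ≤ w.re → ‖powLogSum m j w‖ ≤ C * ‖w‖ ^ (j + 2) := by
  obtain ⟨C, hC0, hC⟩ := norm_periodicBernoulli_mul_powLogDeriv_le hm
  have hlog : ∀ w : ℂ, 1 ≤ w.re → 1 ≤ ‖w‖ ∧ ‖Complex.log w‖ ≤ 5 * ‖w‖ := fun w hw => by
    have h1 : 1 ≤ ‖w‖ := hw.trans (Complex.re_le_norm w)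
    refine ⟨h1, (Complex.norm_le_abs_re_add_abs_im _).trans ?_⟩
    rw [Complex.log_re, Complex.log_im, abs_of_nonneg (Real.log_nonneg h1)]
    linarith [Real.log_le_self (norm_nonneg w), Complex.abs_arg_le_pi w, Real.pi_lt_four]
  refine ⟨6 + ∑ r ∈ Finset.Icc 1 m, ‖(bernoulli r : ℂ) / (r.factorial : ℂ)‖ *
    (‖powCoeff (-(j : ℂ)) (r - 1)‖ * 5 + ‖powCoeffDeriv (-(j : ℂ)) (r - 1)‖) +
    ‖(-1 : ℂ) ^ (m - 1) / (m.factorial : ℂ)‖ * (C * ∫ t in Set.Ioi (0 : ℝ), (1 + t ^ 2)⁻¹),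
    fun w hw => ?_⟩
  obtain ⟨h1, hl⟩ := hlog w hw
  have hpow : ∀ k ≤ j + 2, ‖w‖ ^ k ≤ ‖w‖ ^ (j + 2) := fun k hk => pow_le_pow_right₀ h1 hk
  have hj : (1 : ℝ) ≤ ‖(j : ℂ) + 1‖ := by
    rw [show (j : ℂ) + 1 = ((j + 1 : ℝ) : ℂ) by push_cast; rfl, Complex.norm_real,
      Real.norm_of_nonneg (by positivity)]
    linarith [(Nat.cast_nonneg j : (0 : ℝ) ≤ j)]
  rw [powLogSum_eq, add_mul, add_mul, Finset.sum_mul]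
  refine (norm_sub_le _ _).trans (add_le_add ((norm_add_le _ _).trans (add_le_add ?_
    ((norm_sum_le _ _).trans (Finset.sum_le_sum fun r _ => ?_)))) ?_)
  · rw [powLogPrimitive]
    refine (norm_sub_le _ _).trans ?_
    rw [norm_div, norm_div, norm_mul, norm_pow, norm_pow]
    have e1 : ‖w‖ ^ (j + 1) * ‖Complex.log w‖ / ‖(j : ℂ) + 1‖ ≤ 5 * ‖w‖ ^ (j + 2) := by
      refine (div_le_self (by positivity) hj).trans ?_
      calc _ ≤ ‖w‖ ^ (j + 1) * (5 * ‖w‖) := by gcongr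
        _ = _ := by ring
    have e2 : ‖w‖ ^ (j + 1) / ‖(j : ℂ) + 1‖ ^ 2 ≤ ‖w‖ ^ (j + 2) :=
      (div_le_self (by positivity) (one_le_pow₀ hj)).trans (hpow _ (by omega))
    linarith
  · have hz : ‖w ^ ((j : ℤ) - (r - 1 : ℕ))‖ ≤ ‖w‖ ^ j := by
      rw [norm_zpow, ← zpow_natCast]
      exact zpow_le_zpow_right₀ h1 (by omega)
    rw [powLogDeriv_neg_natCast, norm_mul, mul_assoc ‖(bernoulli r : ℂ) / _‖]
    refine mul_le_mul_of_nonneg_left ((norm_sub_le _ _).trans ?_) (norm_nonneg _)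
    rw [add_mul, norm_mul, norm_mul, norm_mul (powCoeffDeriv _ _)]
    refine add_le_add ?_ ?_
    · calc _ ≤ ‖powCoeff (-(j : ℂ)) (r - 1)‖ * ‖w‖ ^ j * (5 * ‖w‖) := by gcongr
        _ = ‖powCoeff (-(j : ℂ)) (r - 1)‖ * 5 * ‖w‖ ^ (j + 1) := by ring
        _ ≤ _ := by gcongr; omega
    · gcongr
      exact hz.trans (hpow j (by omega))
  · rw [norm_mul, mul_assoc]
    refine mul_le_mul_of_nonneg_left ?_ (norm_nonneg _)
    have hI : 0 ≤ ∫ t in Set.Ioi (0 : ℝ), (1 + t ^ 2)⁻¹ := integral_nonneg fun t => by positivity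
    refine le_trans ?_ (le_mul_of_one_le_right (mul_nonneg hC0 hI) (one_le_pow₀ h1))
    rw [← integral_const_mul]
    refine norm_integral_le_of_norm_le ((integrable_inv_one_add_sq.integrableOn).const_mul C) ?_
    filter_upwards [ae_restrict_mem measurableSet_Ioi] with t ht
    have ht' : (0 : ℝ) ≤ t := le_of_lt ht
    have := hC w 1 t one_pos ht' (by
      rw [one_mul]
      refine le_trans ?_ (Complex.re_le_norm _)
      simpa using hw)
    simpa using this

/-! ### Euler–Maclaurin summation for the Riemann zeta function -/

/-- The value that Euler–Maclaurin summation of order `m` assigns to the Hurwitz series `∑_{k ≥ 0} (w + k) ^ (-s)`. -/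
noncomputable def powSum (m : ℕ) (s w : ℂ) : ℂ :=
  emSum m (fun t => (w + t) ^ (1 - s) / (1 - s)) (fun i t => powDeriv s i (w + t))

lemma tendsto_natCast_add_cpow {a : ℂ} (ha : a.re < 0) {t : ℝ} (ht : 0 ≤ t) :
    Tendsto (fun k : ℕ => ((k : ℂ) + 1 + t) ^ a) atTop (𝓝 0) := by
  rw [tendsto_zero_iff_norm_tendsto_zero]
  have he : ∀ k : ℕ, ‖((k : ℂ) + 1 + t) ^ a‖ = ((k : ℝ) + 1 + t) ^ (-(-a.re)) := fun k => by
    rw [show (k : ℂ) + 1 + t = (((k : ℝ) + 1 + t : ℝ) : ℂ) by push_cast; rfl,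
      Complex.norm_cpow_eq_rpow_re_of_pos (by positivity), neg_neg]
  simp only [he]
  refine (tendsto_rpow_neg_atTop (neg_pos.2 ha)).comp ?_
  exact tendsto_atTop_add_const_right _ _
    (tendsto_atTop_add_const_right _ _ tendsto_natCast_atTop_atTop)

lemma integrableOn_one_add_rpow {a : ℝ} (ha : a < -1) :
    IntegrableOn (fun t : ℝ => (1 + t) ^ a) (Set.Ioi 0) := by
  have := (integrableOn_Ioi_comp_add_one (g := fun t : ℝ => t ^ a) (a := 0)).2
    (by rw [zero_add]; exact integrableOn_Ioi_rpow_of_lt ha one_pos)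
  simpa only [add_comm] using this

lemma natCast_add_one_mem_slitPlane (k : ℕ) : (k : ℂ) + 1 ∈ Complex.slitPlane :=
  Or.inl (by simp; positivity)

lemma aestronglyMeasurable_periodicBernoulli_mul_cpow (m k : ℕ) (a : ℂ) :
    AEStronglyMeasurable (fun t : ℝ => (periodicBernoulli m t : ℂ) * ((k : ℂ) + 1 + t) ^ a)
      (volume.restrict (Set.Ioi 0)) := by
  refine (Complex.measurable_ofReal.comp
    (measurable_periodicBernoulli m)).aestronglyMeasurable.mul
    (ContinuousOn.aestronglyMeasurable (fun t ht => ?_) measurableSet_Ioi)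
  exact (((hasDerivAt_cpow_const (add_ofReal_mem_slitPlane (natCast_add_one_mem_slitPlane k)
    (le_of_lt ht)) a).comp_const_add_ofReal).continuousAt).continuousWithinAt

lemma norm_periodicBernoulli_mul_cpow_le {m : ℕ} {B : ℝ} (hB : ∀ t, |periodicBernoulli m t| ≤ B)
    (k : ℕ) {a : ℂ} {b : ℝ} (hab : a.re ≤ b) (hb : b ≤ 0) {t : ℝ} (ht : 0 ≤ t) :
    ‖(periodicBernoulli m t : ℂ) * ((k : ℂ) + 1 + t) ^ a‖ ≤ B * (1 + t) ^ b := by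
  rw [show (k : ℂ) + 1 + t = (((k : ℝ) + 1 + t : ℝ) : ℂ) by push_cast; rfl, norm_mul,
    Complex.norm_cpow_eq_rpow_re_of_pos (by positivity), Complex.norm_real, Real.norm_eq_abs]
  have hk : (0 : ℝ) ≤ k := k.cast_nonneg
  gcongr
  · exact (abs_nonneg _).trans (hB 0)
  · exact hB t
  · calc ((k : ℝ) + 1 + t) ^ a.re ≤ ((k : ℝ) + 1 + t) ^ b :=
          Real.rpow_le_rpow_of_exponent_le (by linarith) hab
      _ ≤ (1 + t) ^ b := Real.rpow_le_rpow_of_nonpos (by linarith) (by linarith) hb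

lemma integrableOn_periodicBernoulli_mul_cpow (m k : ℕ) {a : ℂ} (ha : a.re < -1) :
    IntegrableOn (fun t : ℝ => (periodicBernoulli m t : ℂ) * ((k : ℂ) + 1 + t) ^ a)
      (Set.Ioi 0) := by
  obtain ⟨B, -, hB⟩ := exists_abs_periodicBernoulli_le m
  refine Integrable.mono' ((integrableOn_one_add_rpow ha).const_mul B)
    (aestronglyMeasurable_periodicBernoulli_mul_cpow m k a) ?_
  filter_upwards [ae_restrict_mem measurableSet_Ioi] with t ht
  exact norm_periodicBernoulli_mul_cpow_le hB k le_rfl (by linarith) (le_of_lt ht)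

lemma powSum_eq (m : ℕ) (s w : ℂ) : powSum m s w = -(w ^ (1 - s) / (1 - s)) -
    ∑ r ∈ Finset.Icc 1 m, (bernoulli r : ℂ) / (r.factorial : ℂ) * powDeriv s (r - 1) w +
    (-1) ^ (m - 1) / (m.factorial : ℂ) * (powCoeff s m *
      ∫ t in Set.Ioi (0 : ℝ), (periodicBernoulli m t : ℂ) * (w + t) ^ (-s - m)) := by
  rw [powSum, emSum, ← integral_const_mul (powCoeff s m)]
  simp only [Complex.ofReal_zero, add_zero, powDeriv, mul_left_comm _ (powCoeff s m)]

lemma powSum_sub_powSum_add_one {m : ℕ} (hm : 1 ≤ m) {s : ℂ} (hs : 1 - m < s.re) (hs1 : s ≠ 1)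
    (k : ℕ) : powSum m s (k + 1) - powSum m s ((k + 1 : ℕ) + 1) = 1 / ((k : ℂ) + 1) ^ s := by
  have hw : ∀ t ∈ Set.Icc (0 : ℝ) 1, (k : ℂ) + 1 + t ∈ Complex.slitPlane := fun t ht =>
    add_ofReal_mem_slitPlane (natCast_add_one_mem_slitPlane k) ht.1
  have hs1' : 1 - s ≠ 0 := sub_ne_zero.2 hs1.symm
  have hint : IntegrableOn (fun t : ℝ => (periodicBernoulli m t : ℂ) *
      powDeriv s m ((k : ℂ) + 1 + t)) (Set.Ioi 0) := by
    simp only [powDeriv, mul_left_comm]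
    exact (integrableOn_periodicBernoulli_mul_cpow m k (by simp; linarith)).const_mul _
  have := emSum_sub_emSum_add_one hm
    (Φ := fun t : ℝ => ((k : ℂ) + 1 + t) ^ (1 - s) / (1 - s))
    (D := fun i t => powDeriv s i ((k : ℂ) + 1 + t))
    (fun t ht => by
      refine (((hasDerivAt_cpow_const (hw t ht) (1 - s)).div_const
        (1 - s)).comp_const_add_ofReal).congr_deriv ?_
      simp only [powDeriv, powCoeff]
      rw [mul_div_cancel_left₀ _ hs1']
      simp)
    (fun i t ht => (hasDerivAt_powDeriv s i (hw t ht)).comp_const_add_ofReal) hint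
  simp only [Complex.ofReal_zero, add_zero, Complex.ofReal_add, Complex.ofReal_one] at this
  simp only [add_comm _ (1 : ℂ), ← add_assoc] at this
  rw [powSum, powSum, Nat.cast_add_one, add_comm _ (1 : ℂ), add_comm _ (1 : ℂ), ← add_assoc, this]
  simp [powDeriv, powCoeff, Complex.cpow_neg]

lemma tendsto_powSum (m : ℕ) {s : ℂ} (hs : 1 < s.re) :
    Tendsto (fun k : ℕ => powSum m s (k + 1)) atTop (𝓝 0) := by
  obtain ⟨B, -, hB⟩ := exists_abs_periodicBernoulli_le m
  have h0 : ∀ a : ℂ, a.re < 0 → Tendsto (fun k : ℕ => ((k : ℂ) + 1) ^ a) atTop (𝓝 0) :=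
    fun a ha => by simpa using tendsto_natCast_add_cpow ha le_rfl
  have hre : (-s - m).re < -1 := by
    simp only [Complex.sub_re, Complex.neg_re, Complex.natCast_re]
    linarith [(Nat.cast_nonneg m : (0 : ℝ) ≤ m)]
  have hI : Tendsto (fun k : ℕ => ∫ t in Set.Ioi (0 : ℝ),
      (periodicBernoulli m t : ℂ) * ((k : ℂ) + 1 + t) ^ (-s - m)) atTop
      (𝓝 (∫ _ in Set.Ioi (0 : ℝ), (0 : ℂ))) := by
    refine tendsto_integral_of_dominated_convergence (fun t => B * (1 + t) ^ (-s - m).re)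
      (fun k => aestronglyMeasurable_periodicBernoulli_mul_cpow m k _)
      ((integrableOn_one_add_rpow hre).const_mul B) (fun k => ?_) ?_
    · filter_upwards [ae_restrict_mem measurableSet_Ioi] with t ht
      exact norm_periodicBernoulli_mul_cpow_le hB k le_rfl (by linarith) (le_of_lt ht)
    · filter_upwards [ae_restrict_mem measurableSet_Ioi] with t ht
      simpa using (tendsto_natCast_add_cpow (a := -s - m) (by linarith) (le_of_lt ht)).const_mul
        (periodicBernoulli m t : ℂ)
  rw [integral_zero] at hI
  have h1 := ((((h0 (1 - s) (by simp; linarith)).div_const (1 - s)).neg).sub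
    (tendsto_finsetSum (Finset.Icc 1 m) fun r _ =>
      ((h0 (-s - (r - 1 : ℕ)) (by
        simp only [Complex.sub_re, Complex.neg_re, Complex.natCast_re]
        linarith [(Nat.cast_nonneg (r - 1) : (0 : ℝ) ≤ (r - 1 : ℕ))])).const_mul
        (powCoeff s (r - 1))).const_mul ((bernoulli r : ℂ) / (r.factorial : ℂ)))).add
    ((hI.const_mul (powCoeff s m)).const_mul ((-1) ^ (m - 1) / (m.factorial : ℂ)))
  simp only [zero_div, neg_zero, mul_zero, Finset.sum_const_zero, sub_zero, add_zero] at h1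
  simpa only [powSum_eq, powDeriv] using h1

lemma riemannZeta_eq_powSum_of_one_lt {m : ℕ} (hm : 1 ≤ m) {s : ℂ} (hs : 1 < s.re) :
    riemannZeta s = powSum m s 1 := by
  have hs1 : s ≠ 1 := fun h => by simp [h] at hs
  have htel : ∀ N : ℕ, ∑ k ∈ Finset.range N, 1 / ((k : ℂ) + 1) ^ s
      = powSum m s 1 - powSum m s (N + 1) := fun N => by
    induction N with
    | zero => simp
    | succ N ih =>
      rw [Finset.sum_range_succ, ih, ← powSum_sub_powSum_add_one hm
        (by linarith [(Nat.one_le_cast.2 hm : (1 : ℝ) ≤ m)]) hs1]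
      ring
  have hsum : Summable fun k : ℕ => 1 / ((k : ℂ) + 1) ^ s := by
    have := (summable_nat_add_iff 1).2 (Complex.summable_one_div_nat_cpow.2 hs)
    simpa using this
  rw [zeta_eq_tsum_one_div_nat_add_one_cpow hs]
  refine tendsto_nhds_unique hsum.hasSum.tendsto_sum_nat ?_
  simp only [htel]
  simpa using (tendsto_powSum m hs).const_sub (powSum m s 1)

lemma differentiableAt_integral_periodicBernoulli_mul_cpow {m : ℕ} {s : ℂ} (hs : 1 - m < s.re) :
    DifferentiableAt ℂ (fun s : ℂ => ∫ t in Set.Ioi (0 : ℝ),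
      (periodicBernoulli m t : ℂ) * (1 + t) ^ (-s - m)) s := by
  obtain ⟨B, -, hB⟩ := exists_abs_periodicBernoulli_le m
  obtain ⟨b, hb1, hbs⟩ := exists_between hs
  refine differentiableAt_integral_of_norm_le (U := {s : ℂ | b < s.re})
    (b := fun t => B * (1 + t) ^ (-b - m)) (isOpen_lt continuous_const Complex.continuous_re) hbs
    (fun x _ => by simpa using aestronglyMeasurable_periodicBernoulli_mul_cpow m 0 (-x - m)) ?_ ?_
    ((integrableOn_one_add_rpow (by linarith)).const_mul B)
  · filter_upwards [ae_restrict_mem measurableSet_Ioi] with t ht x _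
    have ht0 : (1 + t : ℂ) ≠ 0 := by
      exact_mod_cast (show (0 : ℝ) < 1 + t by linarith [Set.mem_Ioi.1 ht]).ne'
    exact (((((hasDerivAt_id x).neg.sub_const (m : ℂ)).const_cpow
      (Or.inl ht0)).const_mul _).differentiableAt).differentiableWithinAt
  · filter_upwards [ae_restrict_mem measurableSet_Ioi] with t ht x hx
    have hx' : b < x.re := hx
    simpa using norm_periodicBernoulli_mul_cpow_le hB 0 (a := -x - m) (b := -b - m)
      (by simp; linarith) (by linarith) (le_of_lt ht)

lemma powSum_one (m : ℕ) (s : ℂ) : powSum m s 1 = -(1 / (1 - s)) -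
    ∑ r ∈ Finset.Icc 1 m, (bernoulli r : ℂ) / (r.factorial : ℂ) * powCoeff s (r - 1) +
    (-1) ^ (m - 1) / (m.factorial : ℂ) * (powCoeff s m *
      ∫ t in Set.Ioi (0 : ℝ), (periodicBernoulli m t : ℂ) * (1 + t) ^ (-s - m)) := by
  simp only [powSum_eq, powDeriv, Complex.one_cpow, mul_one]

/-- Only the derivative of the integral in the last summand is left implicit; for `s = -j` its
coefficient `powCoeff s m` vanishes. -/
lemma hasDerivAt_powSum_one {m : ℕ} {s : ℂ} (hs : 1 - m < s.re) (hs1 : s ≠ 1) :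
    HasDerivAt (fun s => powSum m s 1) (-(1 / (1 - s) ^ 2) -
      ∑ r ∈ Finset.Icc 1 m, (bernoulli r : ℂ) / (r.factorial : ℂ) * powCoeffDeriv s (r - 1) +
      (-1) ^ (m - 1) / (m.factorial : ℂ) * (powCoeffDeriv s m *
        (∫ t in Set.Ioi (0 : ℝ), (periodicBernoulli m t : ℂ) * (1 + t) ^ (-s - m)) +
        powCoeff s m * deriv (fun s : ℂ => ∫ t in Set.Ioi (0 : ℝ),
          (periodicBernoulli m t : ℂ) * (1 + t) ^ (-s - m)) s)) s := by
  have hs1' : 1 - s ≠ 0 := sub_ne_zero.2 hs1.symm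
  have h1 : HasDerivAt (fun s : ℂ => -(1 / (1 - s))) (-(1 / (1 - s) ^ 2)) s := by
    have := (((hasDerivAt_id s).const_sub 1).inv hs1').neg
    simp only [id, one_div] at this ⊢
    refine this.congr_deriv ?_
    field_simp
  simp only [powSum_one]
  exact (h1.sub (HasDerivAt.fun_sum fun r _ => (hasDerivAt_powCoeff s (r - 1)).const_mul _)).add
    (((hasDerivAt_powCoeff s m).mul
      (differentiableAt_integral_periodicBernoulli_mul_cpow hs).hasDerivAt).const_mul _)

/-- Analytic continuation of the Euler–Maclaurin formula for `ζ` into the strip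
`1 - m < Re s < 1`, through the upper half plane. -/
lemma riemannZeta_eventuallyEq_powSum {m : ℕ} (hm : 1 ≤ m) {s : ℂ} (hs : 1 - m < s.re)
    (hs1 : s.re < 1) : riemannZeta =ᶠ[𝓝 s] fun s => powSum m s 1 := by
  have hm' : (1 : ℝ) ≤ m := Nat.one_le_cast.2 hm
  set A : Set ℂ := {s | 1 < s.re} with hA
  set B : Set ℂ := {s | 1 - m < s.re} ∩ {s | 0 < s.im}
  set C : Set ℂ := {s | 1 - m < s.re} ∩ {s | s.re < 1}
  have hAo : IsOpen A := isOpen_lt continuous_const Complex.continuous_re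
  have hBo : IsOpen B := (isOpen_lt continuous_const Complex.continuous_re).inter
    (isOpen_lt continuous_const Complex.continuous_im)
  have hCo : IsOpen C := (isOpen_lt continuous_const Complex.continuous_re).inter
    (isOpen_lt Complex.continuous_re continuous_const)
  have hUo : IsOpen (A ∪ B ∪ C) := (hAo.union hBo).union hCo
  have hUc : IsPreconnected (A ∪ B ∪ C) := by
    refine IsPreconnected.union ((1 / 2 : ℝ) + Complex.I) ?_ ?_
      (IsPreconnected.union (2 + Complex.I) ?_ ?_
        (convex_halfSpace_re_gt 1).isPreconnected
        ((convex_halfSpace_re_gt _).inter (convex_halfSpace_im_gt 0)).isPreconnected)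
      ((convex_halfSpace_re_gt _).inter (convex_halfSpace_re_lt 1)).isPreconnected
    · exact Or.inr ⟨by simp; linarith, by simp⟩
    · exact ⟨by simp; linarith, by simp; norm_num⟩
    · simp [hA]
    · exact ⟨by simp; linarith, by simp⟩
  have hsub : ∀ x ∈ A ∪ B ∪ C, 1 - m < x.re ∧ x ≠ 1 := by
    rintro x ((hx | hx) | hx)
    · have hx' : 1 < x.re := hx
      exact ⟨by linarith, fun h => by simp [h] at hx'⟩
    · have hx' : 0 < x.im := hx.2
      exact ⟨hx.1, fun h => by simp [h] at hx'⟩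
    · have hx' : x.re < 1 := hx.2
      exact ⟨hx.1, fun h => by simp [h] at hx'⟩
  have hz : AnalyticOnNhd ℂ riemannZeta (A ∪ B ∪ C) := DifferentiableOn.analyticOnNhd
    (fun x hx => (differentiableAt_riemannZeta (hsub x hx).2).differentiableWithinAt) hUo
  have hp : AnalyticOnNhd ℂ (fun s => powSum m s 1) (A ∪ B ∪ C) := DifferentiableOn.analyticOnNhd
    (fun x hx => (hasDerivAt_powSum_one (hsub x hx).1
      (hsub x hx).2).differentiableAt.differentiableWithinAt) hUo
  have h2 : (2 : ℂ) ∈ A := by simp [hA]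
  have heq := hz.eqOn_of_preconnected_of_eventuallyEq hp hUc (Or.inl (Or.inl h2))
    (by filter_upwards [hAo.mem_nhds h2] with x hx using riemannZeta_eq_powSum_of_one_lt hm hx)
  exact heq.eventuallyEq_of_mem (hUo.mem_nhds (Or.inr ⟨hs, hs1⟩))

/-- The regularized sum `-∑_{k ≥ 1} k ^ j log k` is `ζ'(-j)`. -/
lemma powLogSum_one {m j : ℕ} (hm : j + 2 ≤ m) :
    powLogSum m j 1 = deriv riemannZeta (-(j : ℂ)) := by
  have hj : (0 : ℝ) ≤ j := j.cast_nonneg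
  have hmj : (j : ℝ) + 2 ≤ m := by exact_mod_cast hm
  have hre : (1 : ℝ) - m < (-(j : ℂ)).re := by simp; linarith
  have h1 : -(j : ℂ) ≠ 1 := fun h => by
    have := congrArg Complex.re h
    simp at this
    linarith
  rw [(riemannZeta_eventuallyEq_powSum (m := m) (by omega) hre (by simp; linarith)).deriv_eq,
    (hasDerivAt_powSum_one hre h1).deriv, powLogSum_eq, powCoeff_neg_natCast (by omega)]
  simp only [powLogDeriv, Complex.log_one, Complex.one_cpow, mul_zero, zero_sub, mul_one,
    powLogPrimitive, one_pow, zero_div, zero_mul, add_zero, powCoeff_neg_natCast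
    (show j < m by omega), mul_neg, Finset.sum_neg_distrib]
  rw [integral_neg, ← integral_const_mul]
  simp only [mul_left_comm (powCoeffDeriv (-(j : ℂ)) m)]
  rw [sub_neg_eq_add, add_comm (j : ℂ) 1]
  ring

/-! ### The Euler–Maclaurin expression in terms of the regularized sums -/

lemma Polynomial.exists_derivative_eq {K : Type*} [Field K] [CharZero K] (P : Polynomial K) :
    ∃ Q : Polynomial K, Polynomial.derivative Q = P := by
  induction P using Polynomial.induction_on' with
  | add p q hp hq =>
    obtain ⟨a, rfl⟩ := hp
    obtain ⟨b, rfl⟩ := hq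
    exact ⟨a + b, Polynomial.derivative_add⟩
  | monomial n a =>
    refine ⟨Polynomial.monomial (n + 1) (a / (n + 1)), ?_⟩
    rw [Polynomial.derivative_monomial, Nat.add_sub_cancel, Nat.cast_add_one,
      div_mul_cancel₀ _ (Nat.cast_add_one_ne_zero n)]

lemma negDerivChoose_eq_eval (n s : ℕ) (z : ℂ) : negDerivChoose (n + 1) s z =
    (-1) ^ s * (Polynomial.derivative^[s] (choosePoly n)).eval z := by
  simp only [negDerivChoose, Nat.add_sub_cancel, ← choosePoly_eval, iteratedDeriv_polynomial_eval]

lemma negDerivChoose_eq_gCoeff (n s : ℕ) (z : ℂ) :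
    negDerivChoose (n + 1) s z = s.factorial * gCoeff (n + 1) s z := by
  have : (s.factorial : ℂ) ≠ 0 := by exact_mod_cast s.factorial_ne_zero
  rw [negDerivChoose_eq_eval, gCoeff_eq_eval]
  field_simp

lemma negDerivChoose_zero (n : ℕ) (z : ℂ) : negDerivChoose (n + 1) 0 z = Ring.choose z n := by
  rw [negDerivChoose_eq_eval]; simp [choosePoly_eval]

lemma negDerivChoose_eq_zero {n s : ℕ} (h : n < s) (z : ℂ) : negDerivChoose (n + 1) s z = 0 := by
  rw [negDerivChoose_eq_gCoeff, gCoeff_eq_zero h, mul_zero]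

lemma hasDerivAt_negDerivChoose_sub (n s : ℕ) (z : ℂ) (t : ℝ) :
    HasDerivAt (fun t : ℝ => negDerivChoose (n + 1) s (z - t)) (negDerivChoose (n + 1) (s + 1) (z - t))
      t := by
  simp only [negDerivChoose_eq_eval]
  have := (((Polynomial.derivative^[s] (choosePoly n)).hasDerivAt (z - t)).comp_const_sub z
    (t : ℂ)).comp_ofReal.const_mul ((-1) ^ s)
  refine this.congr_deriv ?_
  rw [Function.iterate_succ_apply', pow_succ]
  ring

/-- The polynomial identity behind the coefficient of `log (z + 1)`: both
`C(z + 1, n + 1)` and `∫_0^z C(v, n) dv - ∑ B_r / r! (-d/dz)^{r-1} C(z, n)` have the backward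
difference `C(z, n)`, the latter by Euler–Maclaurin summation, so they differ by a constant, whose
value is found at `z = -1`. -/
lemma choose_add_sum_negDerivChoose (n : ℕ) (z : ℂ) :
    Ring.choose (z + 1) (n + 1) + ∑ r ∈ Finset.Icc 1 (n + 1),
        (bernoulli r : ℂ) / (r.factorial : ℂ) * negDerivChoose (n + 1) (r - 1) z
      = ∑ r ∈ Finset.Icc 1 (n + 1),
        (bernoulli r : ℂ) / (r.factorial : ℂ) * negDerivChoose (n + 1) (r - 1) (-1) +
      ∑ j ∈ Finset.range (n + 1), gCoeff (n + 1) j z * ((z + 1) ^ (j + 1) / (j + 1)) := by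
  obtain ⟨Q, hQ⟩ := Polynomial.exists_derivative_eq (choosePoly n)
  -- the integral of `C(v, n)` from `-1` to `z`
  have hint : Q.eval z - Q.eval (-1)
      = ∑ j ∈ Finset.range (n + 1), gCoeff (n + 1) j z * ((z + 1) ^ (j + 1) / (j + 1)) := by
    have hd : ∀ u : ℂ, HasDerivAt (fun u : ℂ => Q.eval (z - u) +
        ∑ j ∈ Finset.range (n + 1), gCoeff (n + 1) j z * (u ^ (j + 1) / (j + 1))) 0 u := fun u => by
      have h1 := (Q.hasDerivAt (z - u)).comp_const_sub z u
      have h2 : HasDerivAt (fun u : ℂ => ∑ j ∈ Finset.range (n + 1),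
          gCoeff (n + 1) j z * (u ^ (j + 1) / (j + 1)))
          (∑ j ∈ Finset.range (n + 1), gCoeff (n + 1) j z * u ^ j) u :=
        HasDerivAt.fun_sum fun j _ => by
          refine (((hasDerivAt_pow (j + 1) u).div_const _).const_mul _).congr_deriv ?_
          have : (j : ℂ) + 1 ≠ 0 := Nat.cast_add_one_ne_zero j
          push_cast
          rw [mul_div_cancel_left₀ _ this]
      refine (h1.add h2).congr_deriv ?_
      rw [hQ, choosePoly_eval, ← choose_sub_eq_sum_gCoeff (n + 1) (by omega), Nat.add_sub_cancel,
        neg_add_cancel]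
    have := is_const_of_deriv_eq_zero (fun u => (hd u).differentiableAt) (fun u => (hd u).deriv)
      (z + 1) 0
    simp only [sub_zero, ne_eq, Nat.succ_ne_zero, not_false_eq_true, zero_pow, zero_div, mul_zero,
      Finset.sum_const_zero, add_zero, sub_add_cancel_left] at this
    rw [← this]; ring
  -- a polynomial which is 1-periodic
  let A : Polynomial ℂ := (choosePoly (n + 1)).comp (Polynomial.X + 1) +
    ∑ r ∈ Finset.Icc 1 (n + 1), Polynomial.C ((bernoulli r : ℂ) / (r.factorial : ℂ) *
      (-1) ^ (r - 1)) * Polynomial.derivative^[r - 1] (choosePoly n) - Q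
  have hA : ∀ x, A.eval x = Ring.choose (x + 1) (n + 1) + ∑ r ∈ Finset.Icc 1 (n + 1),
      (bernoulli r : ℂ) / (r.factorial : ℂ) * negDerivChoose (n + 1) (r - 1) x - Q.eval x := by
    intro x
    simp only [A, Polynomial.eval_sub, Polynomial.eval_add, Polynomial.eval_comp,
      Polynomial.eval_X, Polynomial.eval_one, choosePoly_eval, Polynomial.eval_finsetSum,
      Polynomial.eval_mul, Polynomial.eval_C, negDerivChoose_eq_eval, mul_assoc]
  have hper : ∀ x, A.eval x = A.eval (x - 1) := fun x => by
    have := euler_maclaurin_unit (Φ := fun t : ℝ => -Q.eval (x - t))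
      (D := fun i t => negDerivChoose (n + 1) i (x - t))
      (fun t _ => by
        refine (((Q.hasDerivAt (x - t)).comp_const_sub x (t : ℂ)).comp_ofReal.neg).congr_deriv ?_
        rw [hQ, choosePoly_eval, negDerivChoose_zero, neg_neg])
      (fun i t _ => hasDerivAt_negDerivChoose_sub n i x t) n
    simp only [negDerivChoose_eq_zero (Nat.lt_succ_self n), mul_zero,
      intervalIntegral.integral_zero, add_zero, Complex.ofReal_zero, sub_zero, Complex.ofReal_one,
      negDerivChoose_zero, mul_sub, Finset.sum_sub_distrib] at this
    rw [hA, hA, sub_add_cancel, choose_add_one]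
    linear_combination this
  have hconst : A = Polynomial.C (A.eval (-1)) := by
    refine Polynomial.eq_of_infinite_eval_eq _ _ (Set.infinite_of_injective_forall_mem
      (f := fun k : ℕ => (-1 : ℂ) + k) (fun a b h => by simpa using h) fun k => ?_)
    rw [Set.mem_ofPred_eq, Polynomial.eval_C]
    induction k with
    | zero => simp
    | succ k ih =>
      rw [hper, ← ih]
      congr 1
      push_cast; ring
  have h1 := congrArg (Polynomial.eval z) hconst
  rw [Polynomial.eval_C, hA, hA, neg_add_cancel, Ring.choose_zero_succ] at h1
  rw [← hint]
  linear_combination h1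

lemma log_div_add_one {z : ℂ} (hz : z + 1 ∈ Complex.slitPlane) {t : ℝ}
    (ht : z + t ∈ Complex.slitPlane) :
    Complex.log ((z + t) / (z + 1)) = Complex.log (z + t) - Complex.log (z + 1) := by
  have ha := Complex.slitPlane_arg_ne_pi hz
  have hb := Complex.slitPlane_arg_ne_pi ht
  rw [sub_eq_add_neg, ← Complex.log_inv _ ha, div_eq_mul_inv,
    Complex.log_mul_eq_add_log_iff (Complex.slitPlane_ne_zero ht)
      (inv_ne_zero (Complex.slitPlane_ne_zero hz)), Complex.arg_inv, if_neg ha]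
  have ha1 := (Complex.arg_le_pi (z + 1)).lt_of_ne ha
  have hb1 := (Complex.arg_le_pi (z + t)).lt_of_ne hb
  -- both arguments have the sign of `z.im`
  rcases le_or_gt 0 z.im with h | h
  · have ha0 : 0 ≤ (z + 1).arg := Complex.arg_nonneg_iff.2 (by simpa using h)
    have hb0 : 0 ≤ (z + t).arg := Complex.arg_nonneg_iff.2 (by simpa using h)
    exact ⟨by linarith, by linarith⟩
  · have ha0 : (z + 1).arg < 0 := Complex.arg_neg_iff.2 (by simpa using h)
    have hb0 : (z + t).arg < 0 := Complex.arg_neg_iff.2 (by simpa using h)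
    exact ⟨by linarith [Complex.neg_pi_lt_arg (z + t)], by linarith [Complex.neg_pi_lt_arg (z + 1)]⟩

/-- The derivatives of `C(-t, n) log ((z + t) / (z + 1))`, after `C(-t, n)` is expanded in powers of
`z + t` in the term with `log (z + t)`. -/
lemma iteratedDeriv_chooseLog (n i : ℕ) {z : ℂ} (hz : z + 1 ∈ Complex.slitPlane) {t : ℝ}
    (ht : z + t ∈ Complex.slitPlane) :
    iteratedDeriv i (chooseLog (n + 1) z) t = ∑ j ∈ Finset.range (n + 1),
      gCoeff (n + 1) j z * powLogDeriv (-(j : ℂ)) i (z + t) -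
        negDerivChoose (n + 1) i (0 - t) * Complex.log (z + 1) := by
  let D : ℕ → ℝ → ℂ := fun i t => ∑ j ∈ Finset.range (n + 1),
      gCoeff (n + 1) j z * powLogDeriv (-(j : ℂ)) i (z + t) -
        negDerivChoose (n + 1) i (0 - t) * Complex.log (z + 1)
  have hO : IsOpen {t : ℝ | z + t ∈ Complex.slitPlane} :=
    Complex.isOpen_slitPlane.preimage (by fun_prop)
  have hD : ∀ i, ∀ t ∈ {t : ℝ | z + t ∈ Complex.slitPlane}, HasDerivAt (D i) (D (i + 1) t) t :=
    fun i t ht => (HasDerivAt.fun_sum (u := Finset.range (n + 1)) fun (j : ℕ) _ =>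
      ((hasDerivAt_powLogDeriv (-(j : ℂ)) i ht).comp_const_add_ofReal).const_mul _).sub
      ((hasDerivAt_negDerivChoose_sub n i 0 t).mul_const _)
  have heq : chooseLog (n + 1) z =ᶠ[𝓝 t] D 0 := by
    filter_upwards [hO.mem_nhds ht] with x hx
    rw [chooseLog, log_div_add_one hz hx, Nat.add_sub_cancel, mul_sub]
    simp only [D, powLogDeriv_zero, negDerivChoose_zero, ← mul_assoc, ← Finset.sum_mul]
    rw [← choose_sub_eq_sum_gCoeff (n + 1) (by omega), Nat.add_sub_cancel, zero_sub,
      sub_add_cancel_left]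
  rw [heq.iteratedDeriv_eq, iteratedDeriv_eq_of_hasDerivAt hO hD i ht]

/-- For `m > n + 1` the term with `log (z + 1)` has no part in the remainder. -/
lemma remainderIntegrand_add_one {n m : ℕ} (hm : n + 1 < m) {z : ℂ}
    (hz : z + 1 ∈ Complex.slitPlane) {t : ℝ} (ht : 0 ≤ t) :
    remainderIntegrand (n + 1) m z (t + 1) = ∑ j ∈ Finset.range (n + 1), gCoeff (n + 1) j z *
      ((periodicBernoulli m t : ℂ) * powLogDeriv (-(j : ℂ)) m (z + 1 + t)) := by
  have hs : z + (t + 1 : ℝ) ∈ Complex.slitPlane := by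
    have := add_ofReal_mem_slitPlane hz ht
    rwa [add_assoc, add_comm (1 : ℂ), ← Complex.ofReal_one, ← Complex.ofReal_add] at this
  rw [remainderIntegrand, periodicBernoulli_add_one, iteratedDeriv_chooseLog n m hz hs,
    negDerivChoose_eq_zero (by omega), zero_mul, sub_zero, Finset.mul_sum]
  refine Finset.sum_congr rfl fun j _ => ?_
  rw [show z + ((t + 1 : ℝ) : ℂ) = z + 1 + t by push_cast; ring]
  ring

lemma integrableOn_remainderIntegrand {n m : ℕ} (hm : n + 1 < m) {z : ℂ}
    (hz : z + 1 ∈ Complex.slitPlane) :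
    IntegrableOn (remainderIntegrand (n + 1) m z) (Set.Ioi 1) := by
  rw [← zero_add (1 : ℝ), ← integrableOn_Ioi_comp_add_one]
  refine IntegrableOn.congr_fun ?_ (fun t ht =>
    (remainderIntegrand_add_one hm hz (le_of_lt ht)).symm) measurableSet_Ioi
  exact integrable_finsetSum _ fun j hj => (integrableOn_powLogDeriv (by
    have := Finset.mem_range.1 hj; omega) hz).const_mul _

lemma integral_remainderIntegrand {n m : ℕ} (hm : n + 1 < m) {z : ℂ}
    (hz : z + 1 ∈ Complex.slitPlane) :
    ∫ t in Set.Ioi (1 : ℝ), remainderIntegrand (n + 1) m z t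
      = ∑ j ∈ Finset.range (n + 1), gCoeff (n + 1) j z * ∫ t in Set.Ioi (0 : ℝ),
        (periodicBernoulli m t : ℂ) * powLogDeriv (-(j : ℂ)) m (z + 1 + t) := by
  rw [← zero_add (1 : ℝ), ← setIntegral_Ioi_comp_add_one,
    setIntegral_congr_fun measurableSet_Ioi fun t ht =>
      remainderIntegrand_add_one hm hz (le_of_lt ht),
    integral_finsetSum _ fun j hj => (integrableOn_powLogDeriv (by
      have := Finset.mem_range.1 hj; omega) hz).const_mul _]
  simp only [integral_const_mul]

/-- The Euler–Maclaurin expression is `∑_j G_{n,j}(z) (Z_j(z + 1) - ζ'(-j))`, where `Z_j(w)` is the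
regularization of `-∑_{k ≥ 0} (w + k) ^ j log (w + k)`; the sum over
`j` regularizes the formal series
`log G_n(z + 1) = ∑_{k ≥ 1} (C(z - k, n - 1) log k - C(-k, n - 1) log (z + k))`. -/
lemma eulerMaclaurinExpr_eq_sum {n m : ℕ} (hm : n + 1 < m) {z : ℂ}
    (hz : z + 1 ∈ Complex.slitPlane) :
    eulerMaclaurinExpr (n + 1) m z = ∑ j ∈ Finset.range (n + 1), gCoeff (n + 1) j z *
      (powLogSum m j (z + 1) - deriv riemannZeta (-(j : ℂ))) := by
  have hsub : Finset.Icc 1 (n + 1) ⊆ Finset.Icc 1 m := Finset.Icc_subset_Icc le_rfl (by omega)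
  have hF : ∀ r, bernoulliTerm (n + 1) (r - 1) z = ∑ j ∈ Finset.range (n + 1),
      gCoeff (n + 1) j z * powLogDeriv (-(j : ℂ)) (r - 1) (z + 1) -
        negDerivChoose (n + 1) (r - 1) (-1) * Complex.log (z + 1) := fun r => by
    rw [bernoulliTerm, iteratedDeriv_chooseLog n (r - 1) hz (by simpa using hz)]
    simp
  have hB : ∑ r ∈ Finset.Icc 1 m, (bernoulli r : ℂ) / (r.factorial : ℂ) *
      negDerivChoose (n + 1) (r - 1) (-1) = ∑ r ∈ Finset.Icc 1 (n + 1),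
        (bernoulli r : ℂ) / (r.factorial : ℂ) * negDerivChoose (n + 1) (r - 1) (-1) := by
    refine (Finset.sum_subset hsub fun r hr hr' => ?_).symm
    rw [Finset.mem_Icc] at hr hr'
    rw [negDerivChoose_eq_zero (by omega), mul_zero]
  have hsum : ∑ r ∈ Finset.Icc 1 (n + 1), negDerivChoose (n + 1) (r - 1) z *
      (1 / ((r.factorial : ℂ) * r) * ((z + 1) ^ r - 1)) = ∑ j ∈ Finset.range (n + 1),
        gCoeff (n + 1) j z * (((z + 1) ^ (j + 1) - 1) / ((j : ℂ) + 1) ^ 2) := by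
    rw [← Finset.Ico_succ_right_eq_Icc, Finset.sum_Ico_eq_sum_range]
    refine Finset.sum_congr (by simp) fun j _ => ?_
    have h1 : (j.factorial : ℂ) ≠ 0 := by exact_mod_cast j.factorial_ne_zero
    have h2 : (j : ℂ) + 1 ≠ 0 := Nat.cast_add_one_ne_zero j
    rw [add_comm 1 j, Nat.add_sub_cancel, negDerivChoose_eq_gCoeff, Nat.factorial_succ]
    push_cast
    field_simp
  have hswap : ∑ r ∈ Finset.Icc 1 m, (bernoulli r : ℂ) / (r.factorial : ℂ) *
      ∑ j ∈ Finset.range (n + 1), gCoeff (n + 1) j z * powLogDeriv (-(j : ℂ)) (r - 1) (z + 1)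
      = ∑ j ∈ Finset.range (n + 1), gCoeff (n + 1) j z * ∑ r ∈ Finset.Icc 1 m,
        (bernoulli r : ℂ) / (r.factorial : ℂ) * powLogDeriv (-(j : ℂ)) (r - 1) (z + 1) := by
    simp only [Finset.mul_sum]
    rw [Finset.sum_comm]
    exact Finset.sum_congr rfl fun j _ => Finset.sum_congr rfl fun r _ => by ring
  have hprim : ∑ j ∈ Finset.range (n + 1), gCoeff (n + 1) j z * powLogPrimitive j (z + 1)
      = (∑ j ∈ Finset.range (n + 1), gCoeff (n + 1) j z * ((z + 1) ^ (j + 1) / (j + 1))) *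
        Complex.log (z + 1) - ∑ j ∈ Finset.range (n + 1),
          gCoeff (n + 1) j z * ((z + 1) ^ (j + 1) / ((j : ℂ) + 1) ^ 2) := by
    rw [Finset.sum_mul, ← Finset.sum_sub_distrib]
    exact Finset.sum_congr rfl fun j _ => by rw [powLogPrimitive]; ring
  rw [eulerMaclaurinExpr, remainder, integral_remainderIntegrand hm hz, hsum,
    choose_add_sum_negDerivChoose]
  simp only [hF, mul_sub, Finset.sum_sub_distrib, hswap, ← mul_assoc, ← Finset.sum_mul, hB,
    powLogSum_eq]
  simp only [mul_assoc, mul_add, mul_sub, sub_div, Finset.sum_add_distrib, Finset.sum_sub_distrib,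
    hprim]
  rw [Finset.mul_sum]
  simp only [mul_left_comm (gCoeff _ _ _) ((-1) ^ (m - 1) / _)]
  ring

/-! ### Identification of the Euler–Maclaurin expression with `log G_n(z + 1)` -/

/-- The sum `∑_j G_{n+1,j}(z) (Z_j(z + 1) - ζ'(-j))` over the regularized sums `Z_j` of order `m`,
which equals the Euler–Maclaurin expression. -/
noncomputable def regularizedLogGamma (m n : ℕ) (z : ℂ) : ℂ :=
  ∑ j ∈ Finset.range (n + 1), gCoeff (n + 1) j z *
    (powLogSum m j (z + 1) - deriv riemannZeta (-(j : ℂ)))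

lemma regularizedLogGamma_zero {m n : ℕ} (hm : n + 1 < m) : regularizedLogGamma m n 0 = 0 := by
  refine Finset.sum_eq_zero fun j hj => ?_
  have := Finset.mem_range.1 hj
  rw [zero_add, powLogSum_one (by omega), sub_self, mul_zero]

lemma regularizedLogGamma_add_one_zero {m : ℕ} (hm : 1 < m) {z : ℂ}
    (hz : z + 1 ∈ Complex.slitPlane) :
    regularizedLogGamma m 0 (z + 1) = regularizedLogGamma m 0 z + Complex.log (z + 1) := by
  simp only [regularizedLogGamma, zero_add, Finset.sum_range_one, gCoeff_one, if_true, one_mul]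
  rw [powLogSum_add_one (by omega) hz, pow_zero]
  ring

lemma regularizedLogGamma_add_one_succ {m n : ℕ} (hm : n + 2 < m) {z : ℂ}
    (hz : z + 1 ∈ Complex.slitPlane) :
    regularizedLogGamma m (n + 1) (z + 1)
      = regularizedLogGamma m (n + 1) z + regularizedLogGamma m n z := by
  have h0 : ∑ j ∈ Finset.range (n + 2), gCoeff (n + 2) j (z + 1) * (z + 1) ^ j = 0 := by
    rw [← choose_sub_eq_sum_gCoeff (n + 2) (by omega), sub_self]
    exact Ring.choose_zero_succ ℂ n
  have h1 : regularizedLogGamma m n z = ∑ j ∈ Finset.range (n + 2), gCoeff (n + 1) j z *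
      (powLogSum m j (z + 1) - deriv riemannZeta (-(j : ℂ))) := by
    rw [Finset.sum_range_succ, gCoeff_eq_zero (Nat.lt_succ_self n), zero_mul, add_zero]
    rfl
  have h2 : ∑ j ∈ Finset.range (n + 2),
      gCoeff (n + 2) j (z + 1) * (z + 1) ^ j * Complex.log (z + 1) = 0 := by
    rw [← Finset.sum_mul, h0, zero_mul]
  rw [h1, regularizedLogGamma, regularizedLogGamma, ← Finset.sum_add_distrib, ← sub_eq_zero,
    ← Finset.sum_sub_distrib]
  refine (Finset.sum_congr rfl fun j hj => ?_).trans h2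
  have := Finset.mem_range.1 hj
  rw [powLogSum_add_one (by omega) hz, gCoeff_add_one]
  ring

lemma differentiable_gCoeff (n j : ℕ) : Differentiable ℂ (gCoeff (n + 1) j) := by
  have : gCoeff (n + 1) j = fun z => (-1) ^ j / (j.factorial : ℂ) *
    (Polynomial.derivative^[j] (choosePoly n)).eval z := funext (gCoeff_eq_eval n j)
  rw [this]
  exact (Polynomial.differentiable _).const_mul _

lemma differentiableAt_regularizedLogGamma {m n : ℕ} (hm : n + 1 < m) {z : ℂ}
    (hz : z + 1 ∈ Complex.slitPlane) : DifferentiableAt ℂ (regularizedLogGamma m n) z := by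
  refine DifferentiableAt.fun_sum fun j hj => ?_
  have hj' := Finset.mem_range.1 hj
  have h1 : DifferentiableAt ℂ (powLogSum m j) (z + 1) :=
    (differentiableOn_powLogSum (by omega)).differentiableAt (Complex.isOpen_slitPlane.mem_nhds hz)
  have h2 : DifferentiableAt ℂ (fun z => powLogSum m j (z + 1)) z :=
    DifferentiableAt.comp (g := powLogSum m j) z h1 (differentiableAt_id.add_const 1)
  exact (differentiable_gCoeff n j z).mul (h2.sub_const _)

lemma norm_le_norm_add_one {z : ℂ} (hz : 0 ≤ z.re) : ‖z‖ ≤ ‖z + 1‖ ∧ 1 ≤ ‖z + 1‖ := by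
  constructor
  · rw [← sq_le_sq₀ (norm_nonneg _) (norm_nonneg _), Complex.sq_norm, Complex.sq_norm,
      Complex.normSq_apply, Complex.normSq_apply]
    simp
    nlinarith
  · refine le_trans ?_ (Complex.re_le_norm _)
    simpa using hz

lemma isBigO_pow_of_le {a b : ℕ} (h : a ≤ b) :
    (fun z : ℂ => (z + 1) ^ a) =O[𝓟 {z : ℂ | 0 ≤ z.re}] fun z : ℂ => (z + 1) ^ b := by
  refine Asymptotics.isBigO_principal.2 ⟨1, fun z hz => ?_⟩
  rw [norm_pow, norm_pow, one_mul]
  exact pow_le_pow_right₀ (norm_le_norm_add_one hz).2 h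

lemma isBigO_polynomial_eval {p : Polynomial ℂ} {N : ℕ} (hp : p.natDegree ≤ N) :
    (fun z => p.eval z) =O[𝓟 {z : ℂ | 0 ≤ z.re}] fun z : ℂ => (z + 1) ^ N := by
  simp only [Polynomial.eval_eq_sum_range]
  refine Asymptotics.IsBigO.fun_sum fun i hi => ?_
  have h1 : (fun z : ℂ => z ^ i) =O[𝓟 {z : ℂ | 0 ≤ z.re}] fun z : ℂ => (z + 1) ^ i := by
    refine Asymptotics.isBigO_principal.2 ⟨1, fun z hz => ?_⟩
    rw [norm_pow, norm_pow, one_mul]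
    exact pow_le_pow_left₀ (norm_nonneg _) (norm_le_norm_add_one hz).1 i
  exact (h1.const_mul_left _).trans (isBigO_pow_of_le (by
    have := Finset.mem_range.1 hi; omega))

lemma isBigO_regularizedLogGamma {m n : ℕ} (hm : n + 1 < m) :
    regularizedLogGamma m n =O[𝓟 {z : ℂ | 0 ≤ z.re}] fun z : ℂ => (z + 1) ^ (n + (n + 2)) := by
  refine Asymptotics.IsBigO.fun_sum fun j hj => ?_
  have hj' := Finset.mem_range.1 hj
  simp only [pow_add _ n (n + 2)]
  refine Asymptotics.IsBigO.mul ?_ (Asymptotics.IsBigO.sub ?_ ?_)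
  · rw [show gCoeff (n + 1) j = _ from funext (gCoeff_eq_eval n j)]
    exact (isBigO_polynomial_eval ((Polynomial.natDegree_iterate_derivative _ _).trans
      ((Nat.sub_le _ _).trans (natDegree_choosePoly_le n)))).const_mul_left _
  · obtain ⟨C, hC⟩ := exists_norm_powLogSum_le (m := m) (j := j) (by omega)
    refine Asymptotics.IsBigO.trans (Asymptotics.isBigO_principal.2 ⟨C, fun z hz => ?_⟩)
      (isBigO_pow_of_le (show j + 2 ≤ n + 2 by omega))
    rw [norm_pow]
    exact hC (z + 1) (by simpa using hz)
  · refine Asymptotics.isBigO_principal.2 ⟨‖deriv riemannZeta (-(j : ℂ))‖, fun z hz => ?_⟩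
    rw [norm_pow]
    exact le_mul_of_one_le_right (norm_nonneg _) (one_le_pow₀ (norm_le_norm_add_one hz).2)

/-- High derivatives of a holomorphic function of polynomial growth tend to `0`, by Cauchy's
estimate on the disc with centre `x` and radius `x`. -/
lemma tendsto_iteratedDeriv_of_isBigO {f : ℂ → ℂ} {M N : ℕ} (hMN : M < N)
    (hd : ∀ z : ℂ, 0 ≤ z.re → DifferentiableAt ℂ f z)
    (hf : f =O[𝓟 {z : ℂ | 0 ≤ z.re}] fun z : ℂ => (z + 1) ^ M) :
    Tendsto (fun x : ℝ => iteratedDeriv N f x) atTop (𝓝 0) := by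
  obtain ⟨C, hC⟩ := Asymptotics.isBigO_principal.1 hf
  have hC0 : 0 ≤ C := by
    have := hC 0 (by simp)
    simp at this
    exact (norm_nonneg _).trans this
  have hlim : Tendsto (fun x : ℝ => N.factorial * (C * 3 ^ M) * x⁻¹) atTop (𝓝 0) := by
    simpa using tendsto_inv_atTop_zero.const_mul (N.factorial * (C * 3 ^ M) : ℝ)
  refine squeeze_zero_norm' ?_ hlim
  filter_upwards [eventually_ge_atTop 1] with x hx
  have hx0 : 0 < x := by linarith
  have hre : ∀ z ∈ Metric.closedBall (x : ℂ) x, 0 ≤ z.re := fun z hz => by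
    have h1 := (Complex.abs_re_le_norm (z - x)).trans (mem_closedBall_iff_norm.1 hz)
    have := (abs_le.1 h1).1
    simp at this
    exact this
  refine (Complex.norm_iteratedDeriv_le_of_forall_mem_sphere_norm_le N (C := C * (3 * x) ^ M) hx0
    (DifferentiableOn.diffContOnCl_ball (U := Metric.closedBall (x : ℂ) x)
      (fun z hz => (hd z (hre z hz)).differentiableWithinAt) le_rfl) fun z hz => ?_).trans ?_
  · have hz' := Metric.sphere_subset_closedBall hz
    refine (hC z (hre z hz')).trans ?_
    rw [norm_pow]
    gcongr
    have h1 : ‖z - x‖ = x := mem_sphere_iff_norm.1 hz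
    calc ‖z + 1‖ = ‖(z - x) + ((x + 1 : ℝ) : ℂ)‖ := by congr 1; push_cast; ring
      _ ≤ x + (x + 1) := by
        refine (norm_add_le _ _).trans (add_le_add h1.le ?_)
        rw [Complex.norm_real, Real.norm_of_nonneg (by linarith)]
      _ ≤ 3 * x := by linarith
  · rw [mul_pow, ← mul_assoc C, ← mul_assoc, mul_div_assoc]
    gcongr
    rw [div_le_iff₀ (by positivity)]
    calc x ^ M ≤ x ^ (N - 1) := pow_le_pow_right₀ hx (by omega)
      _ = x⁻¹ * x ^ N := by
        rw [← Nat.sub_add_cancel (show 1 ≤ N by omega), pow_succ, Nat.add_sub_cancel]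
        field_simp

/-- A holomorphic function whose restriction to the reals is 1-periodic and has a derivative
tending to `0` is constant on the positive reals. -/
lemma exists_const_of_periodic_of_tendsto {F : ℂ → ℂ} {N : ℕ}
    (hF : ∀ z : ℂ, -1 < z.re → DifferentiableAt ℂ F z)
    (hper : ∀ x : ℝ, 0 < x → F (x + 1) = F x)
    (hlim : Tendsto (fun x : ℝ => iteratedDeriv N F x) atTop (𝓝 0)) :
    ∃ c, ∀ x : ℝ, 0 < x → F x = c := by
  have hFU : DifferentiableOn ℂ F {z : ℂ | -1 < z.re} := fun z hz =>
    (hF z hz).differentiableWithinAt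
  have hmem : ∀ x : ℝ, 0 < x → (x : ℂ) ∈ {z : ℂ | -1 < z.re} := fun x hx => by
    simp only [Set.mem_ofPred_eq, Complex.ofReal_re]; linarith
  have hit : ∀ i, ∀ x : ℝ, 0 < x → iteratedDeriv i (fun y : ℝ => F y) x = iteratedDeriv i F x :=
    fun i x hx => iteratedDeriv_comp_ofReal isOpen_re_gt_neg_one hFU i (hmem x hx)
  have hp : ∀ x : ℝ, 0 < x → F ((x + 1 : ℝ) : ℂ) = F x := fun x hx => by
    rw [← hper x hx]; push_cast; rfl
  refine exists_const_of_periodic N (fun y : ℝ => F y) (fun i x hx => ?_) hp ⟨0, fun x hx => ?_⟩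
  · have h1 := (hasDerivAt_iteratedDeriv isOpen_re_gt_neg_one hFU i (hmem x hx)).comp_ofReal
    refine h1.differentiableAt.congr_of_eventuallyEq ?_
    filter_upwards [lt_mem_nhds hx] with y hy using hit i y hy
  · have hstep : ∀ x : ℝ, 0 < x → iteratedDeriv N (fun y : ℝ => F y) (x + 1)
        = iteratedDeriv N (fun y : ℝ => F y) x := fun x hx => by
      rw [← congrFun (iteratedDeriv_comp_add_const N (fun y : ℝ => F y) 1) x]
      refine Filter.EventuallyEq.iteratedDeriv_eq N ?_
      filter_upwards [lt_mem_nhds hx] with y hy using hp y hy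
    have hk : ∀ k : ℕ, iteratedDeriv N (fun y : ℝ => F y) (x + k)
        = iteratedDeriv N (fun y : ℝ => F y) x := fun k => by
      induction k with
      | zero => simp
      | succ k ih =>
        rw [Nat.cast_succ, ← add_assoc, hstep _ (by positivity), ih]
    have h2 : Tendsto (fun k : ℕ => iteratedDeriv N F ((x + k : ℝ) : ℂ)) atTop (𝓝 0) :=
      hlim.comp (tendsto_atTop_add_const_left _ x tendsto_natCast_atTop_atTop)
    refine tendsto_nhds_unique (f := fun _ : ℕ => iteratedDeriv N (fun y : ℝ => F y) x)
      tendsto_const_nhds (h2.congr fun k => ?_)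
    rw [← hk k, hit N _ (by positivity)]

lemma add_one_mem_slitPlane_of_re {z : ℂ} (hz : -1 < z.re) : z + 1 ∈ Complex.slitPlane :=
  Or.inl (by simp; linarith)

/-- The difference of both sides is periodic by the functional equations, and its derivatives of
high order tend to `0`, so it is a constant, which vanishes because both sides do at `0`. -/
lemma regularizedLogGamma_ofReal_of_add_one {m n : ℕ} (hm : n + 1 < m)
    (hadd : ∀ x : ℝ, 0 ≤ x →
      regularizedLogGamma m n (x + 1) = regularizedLogGamma m n x + logMultipleGamma n x)
    {x : ℝ} (hx : 0 < x) : regularizedLogGamma m n x = logMultipleGamma (n + 1) x := by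
  set F : ℂ → ℂ := fun z => regularizedLogGamma m n z - logMultipleGamma (n + 1) z with hF
  have hdR : ∀ z : ℂ, -1 < z.re → DifferentiableAt ℂ (regularizedLogGamma m n) z := fun z hz =>
    differentiableAt_regularizedLogGamma hm (add_one_mem_slitPlane_of_re hz)
  have hdL : ∀ z : ℂ, -1 < z.re → DifferentiableAt ℂ (logMultipleGamma (n + 1)) z := fun z hz =>
    differentiableAt_logMultipleGamma (n + 1) hz
  have hper : ∀ x : ℝ, 0 ≤ x → F (x + 1) = F x := fun x hx => by
    simp only [hF]
    rw [hadd x hx, logMultipleGamma_add_one n (by rw [Complex.ofReal_re]; linarith)]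
    ring
  set N : ℕ := n + (n + 2) + 1
  have hlim : Tendsto (fun x : ℝ => iteratedDeriv N F x) atTop (𝓝 0) := by
    have h1 := tendsto_iteratedDeriv_of_isBigO (Nat.lt_succ_self (n + (n + 2)))
      (fun z hz => hdR z (by linarith)) (isBigO_regularizedLogGamma hm)
    have h2 := tendsto_iteratedDeriv_logMultipleGamma (n := n + 1) (N := n + (n + 2)) (by omega)
    refine (sub_zero (0 : ℂ) ▸ h1.sub h2).congr' ?_
    filter_upwards [eventually_gt_atTop 0] with x hx
    have hx1 : -1 < (x : ℂ).re := by rw [Complex.ofReal_re]; linarith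
    exact (iteratedDeriv_fun_sub
      ((DifferentiableOn.analyticAt (fun z hz => (hdR z hz).differentiableWithinAt)
        (isOpen_re_gt_neg_one.mem_nhds hx1)).contDiffAt)
      (analyticAt_logMultipleGamma (n + 1) hx1).contDiffAt).symm
  obtain ⟨c, hc⟩ := exists_const_of_periodic_of_tendsto (F := F)
    (fun z hz => (hdR z hz).sub (hdL z hz)) (fun x hx => hper x hx.le) hlim
  have h0 : F 0 = 0 := by
    simp only [hF, regularizedLogGamma_zero hm, logMultipleGamma_zero, sub_zero]
  have h1 := hper 0 le_rfl
  rw [Complex.ofReal_zero, zero_add, h0, ← Complex.ofReal_one, hc 1 one_pos] at h1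
  exact sub_eq_zero.1 ((hc x hx).trans h1)

/-- On the positive reals the regularized sum is `log G_{n+1}(x + 1)`. -/
lemma regularizedLogGamma_ofReal {m n : ℕ} (hm : n + 1 < m) {x : ℝ} (hx : 0 < x) :
    regularizedLogGamma m n x = logMultipleGamma (n + 1) x := by
  have hzero : ∀ k, logMultipleGamma k ((0 : ℝ) : ℂ) = 0 := fun k => by
    rw [Complex.ofReal_zero, logMultipleGamma_zero]
  induction n generalizing x with
  | zero =>
    refine regularizedLogGamma_ofReal_of_add_one hm (fun y hy => ?_) hx
    rw [regularizedLogGamma_add_one_zero (by omega) (add_one_mem_slitPlane_of_re (by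
      rw [Complex.ofReal_re]; linarith))]
    rfl
  | succ n ih =>
    refine regularizedLogGamma_ofReal_of_add_one hm (fun y hy => ?_) hx
    rw [regularizedLogGamma_add_one_succ (by omega) (add_one_mem_slitPlane_of_re (by
      rw [Complex.ofReal_re]; linarith))]
    congr 1
    rcases hy.eq_or_lt with rfl | hy
    · rw [hzero, Complex.ofReal_zero, regularizedLogGamma_zero (by omega)]
    · exact ih (by omega) hy

lemma isOpen_add_one_mem_slitPlane : IsOpen {z : ℂ | z + 1 ∈ Complex.slitPlane} :=
  Complex.isOpen_slitPlane.preimage (by fun_prop)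

lemma isPreconnected_add_one_mem_slitPlane :
    IsPreconnected {z : ℂ | z + 1 ∈ Complex.slitPlane} := by
  have h : {z : ℂ | z + 1 ∈ Complex.slitPlane} = (fun w : ℂ => w - 1) '' Complex.slitPlane := by
    ext z
    exact ⟨fun hz => ⟨z + 1, hz, by ring⟩, by rintro ⟨w, hw, rfl⟩; simpa using hw⟩
  rw [h]
  exact (Complex.starConvex_one_slitPlane.isPathConnected
    Complex.one_mem_slitPlane).isConnected.isPreconnected.image _ (by fun_prop)

lemma mem_complNonposInt_of_mem_slitPlane {w : ℂ} (hw : w ∈ Complex.slitPlane) :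
    w ∈ complNonposInt := by
  rintro k rfl
  rw [Complex.mem_slitPlane_iff] at hw
  simp only [Complex.neg_re, Complex.natCast_re, Complex.neg_im, Complex.natCast_im, neg_zero,
    ne_eq, not_true_eq_false, or_false] at hw
  linarith [(Nat.cast_nonneg k : (0 : ℝ) ≤ k)]

lemma differentiableOn_regularizedLogGamma {m n : ℕ} (hm : n + 1 < m) :
    DifferentiableOn ℂ (regularizedLogGamma m n) {z : ℂ | z + 1 ∈ Complex.slitPlane} := fun _ hz =>
  (differentiableAt_regularizedLogGamma hm hz).differentiableWithinAt

/-- The regularized sum does not depend on the order of Euler–Maclaurin summation. -/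
lemma regularizedLogGamma_eqOn {m m' n : ℕ} (hm : n + 1 < m) (hm' : n + 1 < m') :
    Set.EqOn (regularizedLogGamma m n) (regularizedLogGamma m' n)
      {z : ℂ | z + 1 ∈ Complex.slitPlane} :=
  eqOn_of_eq_ofReal isOpen_add_one_mem_slitPlane isPreconnected_add_one_mem_slitPlane
    (differentiableOn_regularizedLogGamma hm) (differentiableOn_regularizedLogGamma hm')
    one_pos (by simp [Complex.mem_slitPlane_iff]) fun x hx => by
      rw [regularizedLogGamma_ofReal hm hx, regularizedLogGamma_ofReal hm' hx]

lemma exp_regularizedLogGamma {m n : ℕ} (hm : n + 1 < m) :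
    Set.EqOn (fun z => Complex.exp (regularizedLogGamma m n z))
      (fun z => multipleGamma (n + 1) (z + 1)) {z : ℂ | z + 1 ∈ Complex.slitPlane} := by
  refine eqOn_of_eq_ofReal isOpen_add_one_mem_slitPlane isPreconnected_add_one_mem_slitPlane
    (differentiableOn_regularizedLogGamma hm).cexp (fun z hz => ?_) one_pos
    (by simp [Complex.mem_slitPlane_iff]) fun x hx => ?_
  · exact (DifferentiableAt.comp (g := multipleGamma (n + 1)) z
      (differentiableAt_multipleGamma (n + 1) (mem_complNonposInt_of_mem_slitPlane hz))
      (differentiableAt_id.add_const 1)).differentiableWithinAt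
  · rw [regularizedLogGamma_ofReal hm hx, multipleGamma_eq_exp (n + 1) (by simp; linarith),
      add_sub_cancel_right]

/-- The Vignéras hierarchy exists; its members are the limits, locally uniformly on `ℂ ∖ ℤ_{<0}`, of
the multiple `q`-gamma functions as `q → 1-0`; and on `ℂ ∖ (-∞, -1]` the holomorphic branch `ℓ` of
`log G_n(z + 1)` with `ℓ 0 = 0` is given by the Euler–Maclaurin formula for every `m > n`. -/
theorem theorem2 :
    (∃ G : ℕ → ℂ → ℂ, IsMultipleGamma G) ∧
    ∀ G : ℕ → ℂ → ℂ, IsMultipleGamma G →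
      (∀ n : ℕ, ∀ K : Set ℂ, IsCompact K → K ⊆ complNegInt →
        TendstoUniformlyOn (fun (q : ℝ) (z : ℂ) => qMultipleGamma q n (z + 1))
          (fun z : ℂ => G n (z + 1)) (𝓝[<] (1 : ℝ)) K) ∧
      (∀ n : ℕ, 1 ≤ n →
        ∃ ℓ : ℂ → ℂ,
          DifferentiableOn ℂ ℓ {z : ℂ | z + 1 ∈ Complex.slitPlane} ∧
          ℓ 0 = 0 ∧
          ∀ z : ℂ, z + 1 ∈ Complex.slitPlane →
            Complex.exp (ℓ z) = G n (z + 1) ∧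
            ∀ m : ℕ, n < m →
              IntegrableOn (remainderIntegrand n m z) (Set.Ioi (1 : ℝ)) ∧
              ℓ z = eulerMaclaurinExpr n m z) := by
  refine ⟨⟨multipleGamma, isMultipleGamma_multipleGamma⟩, fun G hG => ⟨fun n K hK hKs => ?_,
    fun n hn => ?_⟩⟩
  · refine (tendstoUniformlyOn_qMultipleGamma n hK hKs).congr_right fun z hz => ?_
    exact (hG.eq_multipleGamma n fun k h => hKs hz k (by linear_combination h)).symm
  · obtain ⟨n, rfl⟩ := Nat.exists_eq_add_of_le' hn
    have hm : n + 1 < n + 2 := Nat.lt_succ_self _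
    refine ⟨regularizedLogGamma (n + 2) n, differentiableOn_regularizedLogGamma hm,
      regularizedLogGamma_zero hm, fun z hz => ⟨?_, fun m hnm =>
        ⟨integrableOn_remainderIntegrand hnm hz, ?_⟩⟩⟩
    · rw [hG.eq_multipleGamma (n + 1) (mem_complNonposInt_of_mem_slitPlane hz)]
      exact exp_regularizedLogGamma hm hz
    · rw [eulerMaclaurinExpr_eq_sum hnm hz]
      exact regularizedLogGamma_eqOn hm hnm hz
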